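/- Let $\xi$ be a random variable with values in $\{0,1,2,\dots\}$, with $\mathbb{E}\,\xi=1$ and $0<\operatorname{Var}\xi<\infty$. Let $\mathcal{T}$ be the (rooted, ordered) Galton–Watson tree with offspring distribution $\xi$, and for $n\ge 1$ with $\mathbb{P}(|\mathcal{T}|=n)>0$ let $T_n$ be $\mathcal{T}$ conditioned on having exactly $n$ vertices. For vertices $v,w$ of a rooted tree let $v\wedge w$ be their last common ancestor and $d$ the graph distance, and put $$h_n(x,y)=\mathbb{E}\sum_{v,w\in T_n}x^{d(v,v\wedge w)}\,y^{d(w,v\wedge w)},$$ where the sum is over all ordered pairs $(v,w)$ of vertices of $T_n$ (including $v=w$). For $0<\beta<\pi/2$ and $\delta>0$ let $$\Delta(\beta,\delta)=\{z\in\mathbb{C}: |z|<1+\delta,\ z\ne 1,\ |\arg(z-1)|>\pi/2-\beta\},\qquad \arg\in(-\pi,\pi].$$ Then there exist constants $C>0$, $\beta\in(0,\pi/2)$ and $\delta>0$, depending only on the distribution of $\xi$, such that for every $n\ge 1$ with $\mathbb{P}(|\mathcal{T}|=n)>0$ the function $h_n$ is analytic on $\Delta(\beta,\delta)\times\Delta(\beta,\delta)$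 and $$|h_n(x,y)|\le C\,n\,|1-x|^{-1}\,|1-y|^{-1}\qquad\text{for all }x,y\in\Delta(\beta,\delta).$$ -/

import Mathlib

open MeasureTheory ProbabilityTheory

namespace GaltonWatson

/-- Vertices are Ulam-Harris words: the root is the empty word `[]`, and the children of a
vertex `u` are the words `u ++ [0], u ++ [1], …`.  A configuration `ω` gives the number `ω u` of
children of every potential vertex `u`.  The family tree of `ω` is the set of all words `u` such
that every step on the way from the root to `u` goes to an existing child. -/
def familyTree (ω : List ℕ → ℕ) : Set (List ℕ) :=
  {u | ∀ (v : List ℕ) (i : ℕ), v ++ [i] <+: u → i < ω v}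

/-- The parent-child graph on the words.  Family trees are subtrees of it, so that distances in
a family tree are distances in this graph. -/
def wordTree : SimpleGraph (List ℕ) :=
  SimpleGraph.fromRel fun u v => ∃ i : ℕ, v = u ++ [i]

/-- The last common ancestor `v ∧ w` of two vertices: the longest common prefix. -/
def lca : List ℕ → List ℕ → List ℕ
  | i :: v, j :: w => if i = j then i :: lca v w else []
  | _, _ => []

/-- The law of the numbers of children in a Galton-Watson process with offspring law `ν`:
they are independent, each with law `ν`. -/
noncomputable def law (ν : Measure ℕ) [IsProbabilityMeasure ν] : Measure (List ℕ → ℕ) :=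
  Measure.infinitePi fun _ : List ℕ => ν

/-- The event that the family tree has exactly `n` vertices. -/
def sizeEvent (n : ℕ) : Set (List ℕ → ℕ) :=
  {ω | (familyTree ω).encard = n}

/-- The sum over ordered pairs of vertices `v, w` of a tree `t` of
`x ^ d(v, v ∧ w) * y ^ d(w, v ∧ w)`. -/
noncomputable def pairSum (t : Set (List ℕ)) (x y : ℂ) : ℂ :=
  ∑ᶠ (v ∈ t) (w ∈ t), x ^ wordTree.dist v (lca v w) * y ^ wordTree.dist w (lca v w)

/-- The function `h_n`: the expectation of the pair sum of the Galton-Watson tree conditioned to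
have `n` vertices. -/
noncomputable def pairGF (ν : Measure ℕ) [IsProbabilityMeasure ν] (n : ℕ) (x y : ℂ) : ℂ :=
  ∫ ω, pairSum (familyTree ω) x y ∂(cond (law ν) (sizeEvent n))

/-- The domain `Δ(β, δ)`. -/
def deltaDomain (β δ : ℝ) : Set ℂ :=
  {z | ‖z‖ < 1 + δ ∧ z ≠ 1 ∧ Real.pi / 2 - β < |Complex.arg (z - 1)|}

end GaltonWatson

/-! Let `Φ` be the offspring generating function, `F(z) = E z^|T|`, and `w(z) = z Φ'(F(z))`.
Splitting a tree at its root gives `F = z Φ(F)` and linear equations for the generating functions of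
the height sum and of the pair sum. Solving them shows that `P(|T| = n) h_n(x, y)` is the
coefficient of `z^n` in `F (1 + xy (z F Φ''(F) - w²)) / ((1 - w)(1 - xw)(1 - yw))` (`pairKernel`,
`treeExp_pairPoly_eq_pairKernel`). The function `h_n` is a polynomial, so analyticity is immediate
and only the bound requires work.

Let `d` be the span of the offspring law. Lagrange inversion expresses `n P(|T| = n)` as a
coefficient of `Φ^n`, and Fourier inversion with the central limit theorem then shows that `P(|T| =
n)` is of order `n^(-3/2)` whenever it is nonzero (`ProgenyLaw.exists_bounds`). These bounds on
coefficients control the generating functions in the unit disc: `1 - |F|` and `1 - |w|` are at least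
of order `√|1 - z^d|`, while `|1 - w|` is at most of that order (`ProgenyLaw.exists_disc_bounds`).
Hence `w` stays in a Stolz region `|1 - w| ≤ const (1 - |w|)`. If `x` lies in a domain `Δ(β, δ)`
that leaves the disc at a small enough angle, then `|1 - xw|` dominates both `|1 - x|` and `|1 - w|`
(`norm_one_sub_mul_bounds`).

The kernel alone is of order `|1 - z^d|^(-1/2)`, whose circle means are bounded; that would only
give `O(1)` for the coefficients. Its `z`-derivative is at most of order `|1 - x|⁻¹ |1 - y|⁻¹ |1 -
z^d|^(-3/2)` (`ProgenyLaw.exists_norm_deriv_pairKernel_le`), and on the circle of radius about `1 -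
1/n` the mean of `|1 - z^d|^(-3/2)` is `O(√n)`. Cauchy's estimate for the derivative therefore
bounds the coefficient by `n^(-1/2) |1 - x|⁻¹ |1 - y|⁻¹` (`norm_coeff_mul_le_sqrt`), and division by
`P(|T| = n)` gives the factor `n`. The argument needs no continuation of `F` beyond the unit disc,
and two moments suffice: the third derivative of `Φ`, which appears on differentiating, costs only
`1 / (1 - |F|)`. -/

namespace GaltonWatson

/-! ### The branching property and measurability of the family tree. -/

/-- The configuration whose root has `q.1` children and whose `i`th branch is `q.2 i`. -/
def graft (q : ℕ × (ℕ → List ℕ → ℕ)) : List ℕ → ℕ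
  | [] => q.1
  | i :: u => q.2 i u

lemma nil_mem_familyTree (ω : List ℕ → ℕ) : [] ∈ familyTree ω := by
  intro v i h
  simp at h

lemma cons_mem_familyTree_graft {k : ℕ} {η : ℕ → List ℕ → ℕ} {i : ℕ} {u : List ℕ} :
    i :: u ∈ familyTree (graft (k, η)) ↔ i < k ∧ u ∈ familyTree (η i) := by
  constructor
  · intro h
    refine ⟨h [] i (by simp), fun v j hv => h (i :: v) j (by simpa using hv)⟩
  · rintro ⟨hi, h⟩ v j hv
    cases v with
    | nil =>
      simp only [List.nil_append, List.cons_prefix_cons, List.nil_prefix, and_true] at hv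
      subst hv
      exact hi
    | cons a v =>
      simp only [List.cons_append, List.cons_prefix_cons] at hv
      obtain ⟨rfl, hv⟩ := hv
      exact h v j hv

lemma familyTree_graft (k : ℕ) (η : ℕ → List ℕ → ℕ) :
    familyTree (graft (k, η)) = insert [] (⋃ i ∈ Finset.range k, List.cons i '' familyTree (η i)) := by
  ext u
  cases u with
  | nil => simp [nil_mem_familyTree]
  | cons i u => simp [cons_mem_familyTree_graft, and_comm]

lemma measurable_graft : Measurable graft := by
  refine measurable_pi_iff.2 fun u => ?_
  cases u with
  | nil => exact measurable_fst
  | cons i u => exact (measurable_pi_apply u).comp ((measurable_pi_apply i).comp measurable_snd)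

instance (ν : Measure ℕ) [IsProbabilityMeasure ν] : IsProbabilityMeasure (law ν) := by
  unfold law
  infer_instance

/-- Branching property: the root degree and the branches are independent, and every branch is a
copy of the whole process. -/
lemma measurePreserving_graft (ν : Measure ℕ) [IsProbabilityMeasure ν] :
    MeasurePreserving graft (ν.prod (Measure.infinitePi fun _ : ℕ => law ν)) (law ν) := by
  refine ⟨measurable_graft, Measure.eq_infinitePi _ fun s t ht => ?_⟩
  -- A measure on the product is identified by its values on finite boxes. The set `A` at the root
  -- is left free so that one computation covers both cases: `A = t []` if the box constrains the
  -- root, `A = univ` if it does not.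
  have key : ∀ (A : Set ℕ), MeasurableSet A →
      (ν.prod (Measure.infinitePi fun _ : ℕ => law ν))
        {q | q.1 ∈ A ∧ ∀ i u, i :: u ∈ s → q.2 i u ∈ t (i :: u)} =
      ν A * ∏ u ∈ s.erase [], ν (t u) := by
    intro A hA
    set s' : Finset (ℕ × List ℕ) := s.preimage (fun p => p.1 :: p.2)
      (fun a _ b _ hab => by simpa [Prod.ext_iff] using hab)
    have hs' : ∀ p : ℕ × List ℕ, p ∈ s' ↔ p.1 :: p.2 ∈ s := fun p => Finset.mem_preimage
    have h1 : {q : ℕ × (ℕ → List ℕ → ℕ) | q.1 ∈ A ∧ ∀ i u, i :: u ∈ s → q.2 i u ∈ t (i :: u)} =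
        A ×ˢ ((MeasurableEquiv.curry ℕ (List ℕ) ℕ).symm ⁻¹'
          (Set.pi s' fun p => t (p.1 :: p.2))) := by
      ext q
      simp [hs', Set.mem_pi]
    rw [h1, Measure.prod_prod]
    congr 1
    have h2 := Measure.infinitePi_map_curry_symm (fun (_ : ℕ) (_ : List ℕ) => ν)
    rw [show (Measure.infinitePi fun _ : ℕ => law ν) =
      Measure.infinitePi (fun _ : ℕ => Measure.infinitePi fun _ : List ℕ => ν) from rfl,
      ← Measure.map_apply (MeasurableEquiv.measurable _)
        (MeasurableSet.pi (Finset.countable_toSet _) fun _ _ => ht _), h2,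
      Measure.infinitePi_pi _ (fun _ _ => ht _)]
    refine Finset.prod_bij (fun p _ => p.1 :: p.2) ?_ ?_ ?_ ?_
    · intro p hp
      simpa [hs'] using hp
    · intro a _ b _ hab
      simpa [Prod.ext_iff] using hab
    · intro u hu
      cases u with
      | nil => simp at hu
      | cons i u => exact ⟨(i, u), by simpa [hs'] using hu, rfl⟩
    · intros; rfl
  have hms : MeasurableSet (Set.pi (s : Set (List ℕ)) t) :=
    MeasurableSet.pi (Finset.countable_toSet _) fun _ _ => ht _
  rw [Measure.map_apply measurable_graft hms]
  by_cases h : [] ∈ s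
  · rw [← Finset.mul_prod_erase s _ h, ← key _ (ht [])]
    congr 1
    ext q
    simp only [Set.mem_preimage, Set.mem_pi, Set.mem_ofPred_eq]
    constructor
    · exact fun hq => ⟨hq [] h, fun i u hu => hq _ hu⟩
    · rintro ⟨h1, h2⟩ u hu
      cases u with
      | nil => exact h1
      | cons i u => exact h2 i u hu
  · have := key Set.univ MeasurableSet.univ
    rw [measure_univ, one_mul, Finset.erase_eq_of_notMem h] at this
    rw [← this]
    congr 1
    ext q
    simp only [Set.mem_preimage, Set.mem_pi, Set.mem_ofPred_eq, Set.mem_univ, true_and]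
    constructor
    · exact fun hq i u hu => hq _ hu
    · intro h2 u hu
      cases u with
      | nil => exact absurd hu h
      | cons i u => exact h2 i u hu

open Classical in
/-- The family tree as a finite set, with the junk value `∅` for infinite trees. -/
noncomputable def treeFinset (ω : List ℕ → ℕ) : Finset (List ℕ) :=
  if h : (familyTree ω).Finite then h.toFinset else ∅

lemma coe_treeFinset {ω : List ℕ → ℕ} (h : (familyTree ω).Finite) :
    (treeFinset ω : Set (List ℕ)) = familyTree ω := by
  simp [treeFinset, h]

lemma treeFinset_ne_empty_iff {ω : List ℕ → ℕ} :
    treeFinset ω ≠ ∅ ↔ (familyTree ω).Finite := by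
  constructor
  · intro h
    by_contra h'
    exact h (by simp [treeFinset, h'])
  · intro h h'
    have := coe_treeFinset h
    rw [h', Finset.coe_empty] at this
    have h2 := nil_mem_familyTree ω
    rw [← this] at h2
    exact h2

lemma treeFinset_eq_iff {ω : List ℕ → ℕ} {t : Finset (List ℕ)} (ht : t ≠ ∅) :
    treeFinset ω = t ↔ familyTree ω = t := by
  constructor
  · rintro rfl
    exact (coe_treeFinset (treeFinset_ne_empty_iff.1 ht)).symm
  · intro h
    have hf : (familyTree ω).Finite := h ▸ t.finite_toSet
    exact Finset.coe_injective ((coe_treeFinset hf).trans h)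

lemma measurable_familyTree : Measurable familyTree := by
  refine measurable_set_iff.2 fun u => ?_
  refine Measurable.forall fun v => Measurable.forall fun i => Measurable.imp measurable_const ?_
  exact measurableSet_setOfPred.1 (measurableSet_lt measurable_const (measurable_pi_apply v))

/-- Finite sets of words are countable in number, so fibres suffice. A nonempty fibre is a condition
on the family tree; the junk fibre over `∅` is the complement of all the others. -/
lemma measurable_treeFinset : Measurable treeFinset := by
  have h : ∀ t : Finset (List ℕ), t ≠ ∅ → MeasurableSet (treeFinset ⁻¹' {t}) := by
    intro t ht
    have : treeFinset ⁻¹' {t} = familyTree ⁻¹' {(t : Set (List ℕ))} := by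
      ext ω
      simp [treeFinset_eq_iff ht]
    rw [this]
    exact measurable_familyTree (measurableSet_singleton _)
  refine measurable_to_countable' fun t => ?_
  by_cases ht : t = ∅
  · have : treeFinset ⁻¹' {t} = (⋃ s ∈ {s : Finset (List ℕ) | s ≠ ∅}, treeFinset ⁻¹' {s})ᶜ := by
      ext ω
      simp only [ht, Set.mem_preimage, Set.mem_singleton_iff, Set.mem_compl_iff, Set.mem_iUnion]
      exact ⟨fun h ⟨_, hi, h'⟩ => hi (h'.symm.trans h),
        fun h => by_contra fun h' => h ⟨_, h', rfl⟩⟩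
    rw [this]
    exact (MeasurableSet.biUnion (Set.to_countable _) fun s hs => h s hs).compl
  · exact h t ht

end GaltonWatson

/-! ### Decomposition of tree functionals at the root. -/

namespace GaltonWatson

/-- The tree whose root has the `k` branches `t 0, …, t (k - 1)`. -/
def joinTrees (k : ℕ) (t : ℕ → Finset (List ℕ)) : Finset (List ℕ) :=
  insert [] ((Finset.range k).biUnion fun i => (t i).map ⟨List.cons i, List.cons_injective⟩)

lemma joinTrees_ne_empty (k : ℕ) (t : ℕ → Finset (List ℕ)) : joinTrees k t ≠ ∅ :=
  Finset.insert_ne_empty _ _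

/-- The whole tree is infinite as soon as one of the first `k` branches is, so the junk value
propagates from branches to the tree. -/
lemma treeFinset_graft (k : ℕ) (η : ℕ → List ℕ → ℕ) :
    treeFinset (graft (k, η)) =
      if ∀ i ∈ Finset.range k, treeFinset (η i) ≠ ∅ then joinTrees k (fun i => treeFinset (η i))
      else ∅ := by
  split_ifs with h
  · rw [treeFinset_eq_iff (joinTrees_ne_empty _ _), familyTree_graft]
    ext u
    cases u with
    | nil => simp [joinTrees]
    | cons j u =>
      have (hj : j < k) : u ∈ treeFinset (η j) ↔ u ∈ familyTree (η j) := by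
        rw [← coe_treeFinset (treeFinset_ne_empty_iff.1 (h j (by simpa using hj)))]
        rfl
      simpa [joinTrees] using fun hj => (this hj).symm
  · by_contra hne
    refine h fun i hi => treeFinset_ne_empty_iff.2 ?_
    have hf := treeFinset_ne_empty_iff.1 hne
    rw [familyTree_graft] at hf
    refine Set.Finite.of_finite_image (f := List.cons i) (hf.subset ?_) List.cons_injective.injOn
    exact (Set.subset_biUnion_of_mem (u := fun i => List.cons i '' familyTree (η i)) hi).trans
      (Set.subset_insert _ _)

lemma sum_joinTrees {M : Type*} [AddCommMonoid M] (k : ℕ) (t : ℕ → Finset (List ℕ))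
    (f : List ℕ → M) :
    ∑ v ∈ joinTrees k t, f v = f [] + ∑ i ∈ Finset.range k, ∑ v ∈ t i, f (i :: v) := by
  rw [joinTrees, Finset.sum_insert (by simp), Finset.sum_biUnion]
  · simp
  · intro i _ j _ hij
    rw [Function.onFun, Finset.disjoint_left]
    simp only [Finset.mem_map, Function.Embedding.coeFn_mk]
    rintro _ ⟨u, _, rfl⟩ ⟨v, _, h⟩
    exact hij (List.cons.inj h).1.symm

lemma card_joinTrees (k : ℕ) (t : ℕ → Finset (List ℕ)) :
    (joinTrees k t).card = 1 + ∑ i ∈ Finset.range k, (t i).card := by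
  simp only [Finset.card_eq_sum_ones, sum_joinTrees]

/-- `z ^ |t|`, with value `0` at the junk tree `∅` standing for infinite trees. -/
noncomputable def sizeWeight (z : ℂ) (t : Finset (List ℕ)) : ℂ := if t = ∅ then 0 else z ^ t.card

/-- The sum of `x ^ height` over the vertices. -/
noncomputable def heightSum (x : ℂ) (t : Finset (List ℕ)) : ℂ := ∑ v ∈ t, x ^ v.length

/-- The pair sum of a finite tree in terms of heights. -/
noncomputable def pairPoly (x y : ℂ) (t : Finset (List ℕ)) : ℂ :=
  ∑ v ∈ t, ∑ w ∈ t,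
    x ^ (v.length - (lca v w).length) * y ^ (w.length - (lca v w).length)

/-- The value `0` at `∅` keeps this multiplicative when a branch is infinite: both sides then
vanish. -/
lemma sizeWeight_graft (z : ℂ) (k : ℕ) (η : ℕ → List ℕ → ℕ) :
    sizeWeight z (treeFinset (graft (k, η))) =
      z * ∏ i ∈ Finset.range k, sizeWeight z (treeFinset (η i)) := by
  rw [treeFinset_graft]
  split_ifs with h
  · rw [sizeWeight, if_neg (joinTrees_ne_empty _ _), card_joinTrees, pow_add, pow_one,
      ← Finset.prod_pow_eq_pow_sum]
    congr 1
    refine Finset.prod_congr rfl fun i hi => ?_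
    rw [sizeWeight, if_neg (h i hi)]
  · push Not at h
    obtain ⟨i, hi, h⟩ := h
    rw [Finset.prod_eq_zero hi (by simp [sizeWeight, h])]
    simp [sizeWeight]

lemma heightSum_joinTrees (x : ℂ) (k : ℕ) (t : ℕ → Finset (List ℕ)) :
    heightSum x (joinTrees k t) = 1 + x * ∑ i ∈ Finset.range k, heightSum x (t i) := by
  simp [heightSum, sum_joinTrees, pow_succ', Finset.mul_sum]

/-- Pairs are sorted by position relative to the root: both at the root, exactly one at the root,
both in the same branch (removing the common first letter changes no distance to the common
ancestor), or in different branches. In the last case the common ancestor is the root and the sum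
factorises into height sums. -/
lemma pairPoly_joinTrees (x y : ℂ) (k : ℕ) (t : ℕ → Finset (List ℕ)) :
    pairPoly x y (joinTrees k t) =
      1 + x * ∑ i ∈ Finset.range k, heightSum x (t i) +
        y * ∑ i ∈ Finset.range k, heightSum y (t i) +
        ∑ i ∈ Finset.range k, pairPoly x y (t i) +
        x * y * ∑ i ∈ Finset.range k, ∑ j ∈ (Finset.range k).erase i,
          heightSum x (t i) * heightSum y (t j) := by
  have h : ∀ i ∈ Finset.range k, ∑ j ∈ Finset.range k, ∑ v ∈ t i, ∑ w ∈ t j,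
      x ^ ((i :: v).length - (lca (i :: v) (j :: w)).length) *
        y ^ ((j :: w).length - (lca (i :: v) (j :: w)).length) =
      pairPoly x y (t i) + x * y * ∑ j ∈ (Finset.range k).erase i,
          heightSum x (t i) * heightSum y (t j) := by
    intro i hi
    rw [← Finset.add_sum_erase _ _ hi]
    congr 1
    · simp [lca, pairPoly]
    · rw [Finset.mul_sum]
      refine Finset.sum_congr rfl fun j hj => ?_
      have hij : i ≠ j := (Finset.ne_of_mem_erase hj).symm
      rw [heightSum, heightSum, Finset.sum_mul_sum]
      simp only [lca, if_neg hij, Finset.mul_sum]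
      refine Finset.sum_congr rfl fun v _ => Finset.sum_congr rfl fun w _ => ?_
      simp only [List.length_cons, List.length_nil, Nat.sub_zero, pow_succ]
      ring
  have hl : ∀ v : List ℕ, lca v [] = [] := fun v => by cases v <;> rfl
  have hl' : ∀ v : List ℕ, lca [] v = [] := fun v => by cases v <;> rfl
  have h2 : ∑ i ∈ Finset.range k, ∑ v ∈ t i, ∑ j ∈ Finset.range k, ∑ w ∈ t j,
      x ^ ((i :: v).length - (lca (i :: v) (j :: w)).length) *
        y ^ ((j :: w).length - (lca (i :: v) (j :: w)).length) =
      ∑ i ∈ Finset.range k, pairPoly x y (t i) + x * y * ∑ i ∈ Finset.range k,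
        ∑ j ∈ (Finset.range k).erase i, heightSum x (t i) * heightSum y (t j) := by
    rw [Finset.mul_sum, ← Finset.sum_add_distrib]
    refine Finset.sum_congr rfl fun i hi => ?_
    rw [← h i hi, Finset.sum_comm]
  rw [pairPoly, sum_joinTrees]
  simp only [sum_joinTrees, Finset.sum_add_distrib, h2]
  simp only [hl, hl', heightSum, List.length_nil, List.length_cons, Nat.sub_zero, pow_zero,
    one_mul, mul_one, pow_succ', Finset.mul_sum]
  ring

lemma sizeWeight_mul_heightSum_graft (z x : ℂ) (k : ℕ) (η : ℕ → List ℕ → ℕ) :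
    sizeWeight z (treeFinset (graft (k, η))) * heightSum x (treeFinset (graft (k, η))) =
      z * (∏ i ∈ Finset.range k, sizeWeight z (treeFinset (η i))) *
        (1 + x * ∑ i ∈ Finset.range k, heightSum x (treeFinset (η i))) := by
  have h := sizeWeight_graft z k η
  rw [treeFinset_graft] at h ⊢
  split_ifs at h ⊢ with hk
  · rw [h, heightSum_joinTrees]
  · rw [← h]
    simp [sizeWeight]

lemma sizeWeight_mul_pairPoly_graft (z x y : ℂ) (k : ℕ) (η : ℕ → List ℕ → ℕ) :
    sizeWeight z (treeFinset (graft (k, η))) * pairPoly x y (treeFinset (graft (k, η))) =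
      z * (∏ i ∈ Finset.range k, sizeWeight z (treeFinset (η i))) *
        (1 + x * ∑ i ∈ Finset.range k, heightSum x (treeFinset (η i)) +
        y * ∑ i ∈ Finset.range k, heightSum y (treeFinset (η i)) +
        ∑ i ∈ Finset.range k, pairPoly x y (treeFinset (η i)) +
        x * y * ∑ i ∈ Finset.range k, ∑ j ∈ (Finset.range k).erase i,
          heightSum x (treeFinset (η i)) * heightSum y (treeFinset (η j))) := by
  have h := sizeWeight_graft z k η
  rw [treeFinset_graft] at h ⊢
  split_ifs at h ⊢ with hk
  · rw [h, pairPoly_joinTrees]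
  · rw [← h]
    simp [sizeWeight]

end GaltonWatson

/-! ### Expectations over the root degree and independent branches. -/

namespace GaltonWatson

/-- The expectation of a functional of the family tree. -/
noncomputable def treeExp (ν : Measure ℕ) [IsProbabilityMeasure ν] (f : Finset (List ℕ) → ℂ) : ℂ :=
  ∫ ω, f (treeFinset ω) ∂law ν

lemma measurable_comp_treeFinset (f : Finset (List ℕ) → ℂ) :
    Measurable fun ω => f (treeFinset ω) :=
  (measurable_of_countable f).comp measurable_treeFinset

variable (ν : Measure ℕ) [IsProbabilityMeasure ν]

lemma integrable_comp_treeFinset {f : Finset (List ℕ) → ℂ} (C : ℝ)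
    (hf : ∀ ω, ‖f (treeFinset ω)‖ ≤ C) : Integrable (fun ω => f (treeFinset ω)) (law ν) :=
  Integrable.of_bound (measurable_comp_treeFinset f).aestronglyMeasurable C
    (Filter.Eventually.of_forall hf)

lemma integral_prod_branches (k : ℕ) (h : ℕ → Finset (List ℕ) → ℂ) :
    ∫ η : ℕ → List ℕ → ℕ, ∏ i ∈ Finset.range k, h i (treeFinset (η i))
      ∂(Measure.infinitePi fun _ : ℕ => law ν) = ∏ i ∈ Finset.range k, treeExp ν (h i) := by
  have h1 := integral_restrict_infinitePi (μ := fun _ : ℕ => law ν) (s := Finset.range k)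
    (f := fun η => ∏ i : Finset.range k, h i (treeFinset (η i)))
    (Finset.measurable_prod Finset.univ fun (i : Finset.range k) _ =>
      (measurable_comp_treeFinset (h i)).comp (measurable_pi_apply i)).aestronglyMeasurable
  rw [integral_fintype_prod_eq_prod (fun (i : Finset.range k) ω => h i (treeFinset ω))] at h1
  rw [Finset.prod_coe_sort (Finset.range k) (fun i => ∫ ω, h i (treeFinset ω) ∂law ν)] at h1
  rw [show (∏ i ∈ Finset.range k, treeExp ν (h i)) =
    ∏ i ∈ Finset.range k, ∫ ω, h i (treeFinset ω) ∂law ν from rfl, ← h1]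
  refine integral_congr_ae (Filter.Eventually.of_forall fun η => ?_)
  exact (Finset.prod_coe_sort (Finset.range k) fun i => h i (treeFinset (η i))).symm

lemma integrable_prod_branches (k : ℕ) {h : ℕ → Finset (List ℕ) → ℂ}
    (hh : ∀ i ω, ‖h i (treeFinset ω)‖ ≤ 1) :
    Integrable (fun η : ℕ → List ℕ → ℕ => ∏ i ∈ Finset.range k, h i (treeFinset (η i)))
      (Measure.infinitePi fun _ : ℕ => law ν) := by
  refine Integrable.of_bound (Finset.measurable_prod _ fun i _ =>
      (measurable_comp_treeFinset (h i)).comp (measurable_pi_apply i)).aestronglyMeasurable 1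
    (Filter.Eventually.of_forall fun η => ?_)
  rw [norm_prod]
  exact Finset.prod_le_one (fun _ _ => norm_nonneg _) fun i _ => hh i _

/-- This is conditioning on the root degree through the branching property. -/
lemma hasSum_treeExp {f : Finset (List ℕ) → ℂ} {C : ℝ} (hf : ∀ ω, ‖f (treeFinset ω)‖ ≤ C) :
    HasSum (fun k => (ν.real {k} : ℂ) * ∫ η : ℕ → List ℕ → ℕ, f (treeFinset (graft (k, η)))
      ∂(Measure.infinitePi fun _ : ℕ => law ν)) (treeExp ν f) := by
  have hm := measurePreserving_graft ν
  have hI : Integrable (fun q : ℕ × (ℕ → List ℕ → ℕ) => f (treeFinset (graft q)))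
      (ν.prod (Measure.infinitePi fun _ : ℕ => law ν)) :=
    Integrable.of_bound ((measurable_comp_treeFinset f).comp measurable_graft).aestronglyMeasurable
      C (Filter.Eventually.of_forall fun q => hf _)
  have h1 : treeExp ν f = ∫ k, ∫ η : ℕ → List ℕ → ℕ, f (treeFinset (graft (k, η)))
      ∂(Measure.infinitePi fun _ : ℕ => law ν) ∂ν := by
    rw [← integral_prod _ hI, ← integral_map (f := fun ω => f (treeFinset ω))
      measurable_graft.aemeasurable (measurable_comp_treeFinset f).aestronglyMeasurable, hm.map_eq,
      treeExp]
  rw [h1]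
  have h2 := hasSum_integral_measure (μ := fun k : ℕ => ν {k} • Measure.dirac k) (f := fun k => ∫ η : ℕ → List ℕ → ℕ, f (treeFinset (graft (k, η)))
      ∂(Measure.infinitePi fun _ : ℕ => law ν)) (by
        rw [Measure.sum_smul_dirac]; exact hI.integral_prod_left)
  rw [Measure.sum_smul_dirac] at h2
  simpa [integral_smul_measure, measureReal_def] using h2

lemma prod_mul_eq_prod_ite {k i : ℕ} (hi : i ∈ Finset.range k) (W V : ℕ → ℂ) :
    (∏ j ∈ Finset.range k, W j) * V i = ∏ j ∈ Finset.range k, if j = i then W j * V j else W j := by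
  rw [← Finset.mul_prod_erase _ _ hi, ← Finset.mul_prod_erase _ (fun j => ite _ _ _) hi, if_pos rfl,
    mul_right_comm]
  congr 1
  exact Finset.prod_congr rfl fun j hj => by rw [if_neg (Finset.ne_of_mem_erase hj)]

/-- Each summand replaces one factor `W` by `W * V`, and independence factorises the integral.
Summed against the offspring law, `k W^(k-1)` becomes `Φ'`. Only `W * V` is assumed bounded, since
the sums over vertices used as `V` are unbounded. -/
lemma integral_prod_mul_sum {W V : Finset (List ℕ) → ℂ} (hW : ∀ ω, ‖W (treeFinset ω)‖ ≤ 1)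
    (hV : ∀ ω, ‖W (treeFinset ω) * V (treeFinset ω)‖ ≤ 1) (k : ℕ) :
    Integrable (fun η : ℕ → List ℕ → ℕ => (∏ i ∈ Finset.range k, W (treeFinset (η i))) *
      ∑ i ∈ Finset.range k, V (treeFinset (η i))) (Measure.infinitePi fun _ : ℕ => law ν) ∧
    ∫ η : ℕ → List ℕ → ℕ, (∏ i ∈ Finset.range k, W (treeFinset (η i))) *
      ∑ i ∈ Finset.range k, V (treeFinset (η i)) ∂(Measure.infinitePi fun _ : ℕ => law ν) =
    k * treeExp ν W ^ (k - 1) * treeExp ν (fun t => W t * V t) := by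
  set h : ℕ → ℕ → Finset (List ℕ) → ℂ := fun i j t => if j = i then W t * V t else W t with hdef
  have h1 : ∀ η : ℕ → List ℕ → ℕ, (∏ i ∈ Finset.range k, W (treeFinset (η i))) *
      ∑ i ∈ Finset.range k, V (treeFinset (η i)) = ∑ i ∈ Finset.range k, ∏ j ∈ Finset.range k,
        h i j (treeFinset (η j)) := by
    intro η
    rw [Finset.mul_sum]
    refine Finset.sum_congr rfl fun i hi => ?_
    rw [prod_mul_eq_prod_ite hi (fun j => W (treeFinset (η j))) fun j => V (treeFinset (η j))]
  have hb : ∀ i j ω, ‖h i j (treeFinset ω)‖ ≤ 1 := by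
    intro i j ω
    simp only [hdef]
    split_ifs
    exacts [hV ω, hW ω]
  simp_rw [h1]
  refine ⟨integrable_finsetSum _ fun i _ => integrable_prod_branches ν k (hb i), ?_⟩
  rw [integral_finsetSum _ fun i _ => integrable_prod_branches ν k (hb i)]
  simp_rw [integral_prod_branches]
  rw [Finset.sum_congr rfl (g := fun _ => treeExp ν W ^ (k - 1) * treeExp ν (fun t => W t * V t))]
  · simp [mul_assoc]
  · intro i hi
    rw [← Finset.mul_prod_erase _ _ hi, mul_comm, Finset.prod_congr rfl (g := fun _ => treeExp ν W)]
    · simp [Finset.card_erase_of_mem hi, hdef]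
    · intro j hj
      simp [hdef, Finset.ne_of_mem_erase hj]

/-- Two distinct branches now carry a changed factor; the `k (k - 1)` ordered choices are the source
of `Φ''`. -/
lemma integral_prod_mul_sum_sum {W V V' : Finset (List ℕ) → ℂ} (hW : ∀ ω, ‖W (treeFinset ω)‖ ≤ 1)
    (hV : ∀ ω, ‖W (treeFinset ω) * V (treeFinset ω)‖ ≤ 1)
    (hV' : ∀ ω, ‖W (treeFinset ω) * V' (treeFinset ω)‖ ≤ 1) (k : ℕ) :
    Integrable (fun η : ℕ → List ℕ → ℕ => (∏ i ∈ Finset.range k, W (treeFinset (η i))) *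
      ∑ i ∈ Finset.range k, ∑ j ∈ (Finset.range k).erase i,
        V (treeFinset (η i)) * V' (treeFinset (η j))) (Measure.infinitePi fun _ : ℕ => law ν) ∧
    ∫ η : ℕ → List ℕ → ℕ, (∏ i ∈ Finset.range k, W (treeFinset (η i))) *
      ∑ i ∈ Finset.range k, ∑ j ∈ (Finset.range k).erase i,
        V (treeFinset (η i)) * V' (treeFinset (η j)) ∂(Measure.infinitePi fun _ : ℕ => law ν) =
    k * (k - 1 : ℕ) * treeExp ν W ^ (k - 2) * treeExp ν (fun t => W t * V t) *
      treeExp ν (fun t => W t * V' t) := by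
  set h : ℕ → ℕ → ℕ → Finset (List ℕ) → ℂ := fun i l j t =>
    if j = i then W t * V t else if j = l then W t * V' t else W t with hdef
  have h1 : ∀ η : ℕ → List ℕ → ℕ, (∏ i ∈ Finset.range k, W (treeFinset (η i))) *
      ∑ i ∈ Finset.range k, ∑ j ∈ (Finset.range k).erase i,
        V (treeFinset (η i)) * V' (treeFinset (η j)) =
      ∑ i ∈ Finset.range k, ∑ l ∈ (Finset.range k).erase i, ∏ j ∈ Finset.range k,
        h i l j (treeFinset (η j)) := by
    intro η
    rw [Finset.mul_sum]
    refine Finset.sum_congr rfl fun i hi => ?_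
    rw [Finset.mul_sum]
    refine Finset.sum_congr rfl fun l hl => ?_
    rw [← mul_assoc, prod_mul_eq_prod_ite hi (fun j => W (treeFinset (η j)))
      (fun j => V (treeFinset (η j))), prod_mul_eq_prod_ite (Finset.mem_of_mem_erase hl) _
      (fun j => V' (treeFinset (η j)))]
    refine Finset.prod_congr rfl fun j _ => ?_
    have hli := Finset.ne_of_mem_erase hl
    by_cases hj : j = i
    · subst hj
      simp [hdef, hli.symm]
    · simp [hdef, hj]
  have hb : ∀ i l j ω, ‖h i l j (treeFinset ω)‖ ≤ 1 := by
    intro i l j ω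
    simp only [hdef]
    split_ifs
    exacts [hV ω, hV' ω, hW ω]
  simp_rw [h1]
  refine ⟨integrable_finsetSum _ fun i _ => integrable_finsetSum _ fun l _ =>
    integrable_prod_branches ν k (hb i l), ?_⟩
  rw [integral_finsetSum _ fun i _ => integrable_finsetSum _ fun l _ =>
    integrable_prod_branches ν k (hb i l)]
  rw [Finset.sum_congr rfl (g := fun _ => ((k - 1 : ℕ) : ℂ) * (treeExp ν W ^ (k - 2) *
    treeExp ν (fun t => W t * V t) * treeExp ν (fun t => W t * V' t)))]
  · simp [mul_assoc]
  · intro i hi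
    rw [integral_finsetSum _ fun l _ => integrable_prod_branches ν k (hb i l)]
    simp_rw [integral_prod_branches]
    rw [Finset.sum_congr rfl (g := fun _ => treeExp ν W ^ (k - 2) *
      treeExp ν (fun t => W t * V t) * treeExp ν (fun t => W t * V' t))]
    · simp [Finset.card_erase_of_mem hi]
    · intro l hl
      have hli := Finset.ne_of_mem_erase hl
      rw [← Finset.mul_prod_erase _ _ hi, ← Finset.mul_prod_erase _ _ hl,
        Finset.prod_congr rfl (g := fun _ => treeExp ν W)]
      · rw [Finset.prod_const, Finset.card_erase_of_mem hl, Finset.card_erase_of_mem hi,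
          Finset.card_range, Nat.sub_sub]
        simp only [hdef, if_true, if_neg hli]
        ring
      · intro j hj
        have hjl := Finset.ne_of_mem_erase hj
        have hji := Finset.ne_of_mem_erase (Finset.mem_of_mem_erase hj)
        simp [hdef, hjl, hji]

end GaltonWatson

/-! ### Functional equations for small `z`. -/

namespace GaltonWatson

lemma familyTree_prefix {ω : List ℕ → ℕ} {u v : List ℕ} (hv : v ∈ familyTree ω) (h : u <+: v) :
    u ∈ familyTree ω :=
  fun a i ha => hv a i (ha.trans h)

/-- All `v.length + 1` prefixes of a vertex are vertices too. -/
lemma length_lt_card {ω : List ℕ → ℕ} {v : List ℕ} (hv : v ∈ treeFinset ω) :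
    v.length < (treeFinset ω).card := by
  have hf := coe_treeFinset (treeFinset_ne_empty_iff.1 (Finset.ne_empty_of_mem hv))
  have hmem : ∀ {u}, u ∈ treeFinset ω ↔ u ∈ familyTree ω := fun {u} => by rw [← hf]; rfl
  have := Finset.card_le_card_of_injOn (s := Finset.range (v.length + 1)) (t := treeFinset ω)
    (fun j => v.take j) (fun j _ => hmem.2 (familyTree_prefix (hmem.1 hv) (List.take_prefix j v)))
    (by
      intro i hi j hj hij
      have := congrArg List.length hij
      simp only [List.length_take, Finset.coe_range, Set.mem_Iio] at this hi hj
      omega)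
  simpa using this

lemma norm_pow_le_two_pow {x : ℂ} (hx : ‖x‖ ≤ 2) {a n : ℕ} (h : a ≤ n) : ‖x ^ a‖ ≤ 2 ^ n := by
  rw [norm_pow]
  exact (pow_le_pow_left₀ (norm_nonneg _) hx _).trans (pow_le_pow_right₀ one_le_two h)

/-- The base `16` is crude but common to height and pair sums. It makes every weighted functional
bounded by `1` for `‖z‖ ≤ 1 / 16`; so small a disc is enough, because it already determines the
coefficients. -/
lemma norm_heightSum_le {x : ℂ} (hx : ‖x‖ ≤ 2) (ω : List ℕ → ℕ) :
    ‖heightSum x (treeFinset ω)‖ ≤ 16 ^ (treeFinset ω).card := by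
  set n := (treeFinset ω).card with hn
  calc ‖heightSum x (treeFinset ω)‖ ≤ ∑ v ∈ treeFinset ω, (2 : ℝ) ^ n :=
        norm_sum_le_of_le _ fun v hv => norm_pow_le_two_pow hx (length_lt_card hv).le
    _ = n * 2 ^ n := by simp [hn]
    _ ≤ 2 ^ n * 8 ^ n := by
        gcongr
        · exact_mod_cast (Nat.lt_two_pow_self).le
        · norm_num
    _ = 16 ^ n := by rw [← mul_pow]; norm_num

lemma norm_pairPoly_le {x y : ℂ} (hx : ‖x‖ ≤ 2) (hy : ‖y‖ ≤ 2) (ω : List ℕ → ℕ) :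
    ‖pairPoly x y (treeFinset ω)‖ ≤ 16 ^ (treeFinset ω).card := by
  set n := (treeFinset ω).card with hn
  calc ‖pairPoly x y (treeFinset ω)‖
      ≤ ∑ v ∈ treeFinset ω, ∑ w ∈ treeFinset ω, (2 : ℝ) ^ n * 2 ^ n := by
        refine norm_sum_le_of_le _ fun v hv => norm_sum_le_of_le _ fun w hw => ?_
        rw [norm_mul]
        exact mul_le_mul (norm_pow_le_two_pow hx (by have := length_lt_card hv; omega))
          (norm_pow_le_two_pow hy (by have := length_lt_card hw; omega)) (norm_nonneg _)
          (by positivity)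
    _ = n * 2 ^ n * (n * 2 ^ n) := by simp [hn]; ring
    _ ≤ 2 ^ n * 2 ^ n * (2 ^ n * 2 ^ n) := by
        have : (n : ℝ) ≤ 2 ^ n := by exact_mod_cast (Nat.lt_two_pow_self).le
        gcongr
    _ = 16 ^ n := by simp only [← mul_pow]; norm_num

lemma norm_sizeWeight_le {z : ℂ} (hz : ‖z‖ ≤ 1) (t : Finset (List ℕ)) : ‖sizeWeight z t‖ ≤ 1 := by
  unfold sizeWeight
  split_ifs
  · simp
  · rw [norm_pow]; exact pow_le_one₀ (norm_nonneg _) hz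

lemma norm_sizeWeight_mul_le {z : ℂ} (hz : ‖z‖ ≤ 1 / 16) {t : Finset (List ℕ)} {c : ℂ}
    (hc : ‖c‖ ≤ 16 ^ t.card) : ‖sizeWeight z t * c‖ ≤ 1 := by
  unfold sizeWeight
  split_ifs
  · simp
  · rw [norm_mul, norm_pow]
    calc ‖z‖ ^ t.card * ‖c‖ ≤ (1 / 16) ^ t.card * 16 ^ t.card := by gcongr
      _ = 1 := by rw [← mul_pow]; norm_num

lemma integral_add_five {α : Type*} [MeasurableSpace α] {μ : Measure α} {f₀ f₁ f₂ f₃ f₄ : α → ℂ}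
    (h₀ : Integrable f₀ μ) (h₁ : Integrable f₁ μ) (h₂ : Integrable f₂ μ) (h₃ : Integrable f₃ μ)
    (h₄ : Integrable f₄ μ) :
    ∫ a, (f₀ a + f₁ a + f₂ a + f₃ a + f₄ a) ∂μ =
      ∫ a, f₀ a ∂μ + ∫ a, f₁ a ∂μ + ∫ a, f₂ a ∂μ + ∫ a, f₃ a ∂μ + ∫ a, f₄ a ∂μ := by
  rw [← integral_add' h₀ h₁, ← integral_add' (h₀.add h₁) h₂, ← integral_add' ((h₀.add h₁).add h₂) h₃,
    ← integral_add' (((h₀.add h₁).add h₂).add h₃) h₄]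
  rfl

/-- The `j`th derivative of the generating function `∑ p k u ^ k`. -/
noncomputable def pgfDeriv (p : ℕ → ℝ) (j : ℕ) (u : ℂ) : ℂ :=
  ∑' k, ((p k * k.descFactorial j : ℝ) : ℂ) * u ^ (k - j)

lemma hasSum_pgfDeriv {p : ℕ → ℝ} (hp : ∀ k, 0 ≤ p k) {j : ℕ}
    (hs : Summable fun k => p k * k.descFactorial j) {u : ℂ} (hu : ‖u‖ ≤ 1) :
    HasSum (fun k => ((p k * k.descFactorial j : ℝ) : ℂ) * u ^ (k - j)) (pgfDeriv p j u) := by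
  refine (Summable.of_norm_bounded hs fun k => ?_).hasSum
  rw [norm_mul, norm_pow, Complex.norm_real, Real.norm_eq_abs,
    abs_of_nonneg (mul_nonneg (hp k) (Nat.cast_nonneg _))]
  exact mul_le_of_le_one_right (mul_nonneg (hp k) (Nat.cast_nonneg _))
    (pow_le_one₀ (norm_nonneg _) hu)

variable (ν : Measure ℕ) [IsProbabilityMeasure ν]

lemma norm_treeExp_le_one {f : Finset (List ℕ) → ℂ} (hf : ∀ ω, ‖f (treeFinset ω)‖ ≤ 1) :
    ‖treeExp ν f‖ ≤ 1 := by
  simpa [treeExp] using norm_integral_le_of_norm_le_const (μ := law ν) (Filter.Eventually.of_forall hf)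

lemma treeExp_sizeWeight {z : ℂ} (hz : ‖z‖ ≤ 1) :
    HasSum (fun k => (ν.real {k} : ℂ) * (z * treeExp ν (sizeWeight z) ^ k))
      (treeExp ν (sizeWeight z)) := by
  convert! hasSum_treeExp ν (f := sizeWeight z) (fun ω => norm_sizeWeight_le hz _) using 3 with k
  simp_rw [sizeWeight_graft]
  rw [integral_const_mul, integral_prod_branches ν k fun _ => sizeWeight z]
  simp

variable {ν}

/-- A vertex is the root or lies in one branch, one level lower. The resulting linear equation has
the solution `F / (1 - x w)`. -/
lemma treeExp_heightSum {z x : ℂ} (hz : ‖z‖ ≤ 1 / 16) (hx : ‖x‖ ≤ 2)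
    (h1 : Summable fun k => ν.real {k} * k.descFactorial 1) :
    treeExp ν (fun t => sizeWeight z t * heightSum x t) = treeExp ν (sizeWeight z) +
      x * (z * pgfDeriv (fun k => ν.real {k}) 1 (treeExp ν (sizeWeight z))) *
        treeExp ν (fun t => sizeWeight z t * heightSum x t) := by
  have hz1 : ‖z‖ ≤ 1 := hz.trans (by norm_num)
  have hW : ∀ ω, ‖sizeWeight z (treeFinset ω)‖ ≤ 1 := fun ω => norm_sizeWeight_le hz1 _
  have hV := fun ω => norm_sizeWeight_mul_le hz (norm_heightSum_le hx ω)
  have hF := norm_treeExp_le_one ν hW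
  refine (hasSum_treeExp ν (f := fun t => sizeWeight z t * heightSum x t) hV).unique ?_
  have e1 := treeExp_sizeWeight ν hz1
  have e2 := hasSum_pgfDeriv (p := fun k => ν.real {k}) (fun _ => measureReal_nonneg) h1 hF
  convert! e1.add ((e2.mul_left (x * z)).mul_right
    (treeExp ν (fun t => sizeWeight z t * heightSum x t))) using 1
  · funext k
    obtain ⟨i1, i2⟩ := integral_prod_mul_sum ν hW hV k
    simp_rw [sizeWeight_mul_heightSum_graft]
    have : ∀ η : ℕ → List ℕ → ℕ, z * (∏ i ∈ Finset.range k, sizeWeight z (treeFinset (η i))) *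
        (1 + x * ∑ i ∈ Finset.range k, heightSum x (treeFinset (η i))) =
        z * (∏ i ∈ Finset.range k, sizeWeight z (treeFinset (η i))) + z * x *
        ((∏ i ∈ Finset.range k, sizeWeight z (treeFinset (η i))) *
          ∑ i ∈ Finset.range k, heightSum x (treeFinset (η i))) := fun η => by ring
    simp_rw [this]
    have i0 := integrable_prod_branches ν k (h := fun _ => sizeWeight z) (fun _ => hW)
    rw [integral_add (i0.const_mul z) (i1.const_mul (z * x)), integral_const_mul,
      integral_const_mul, i2, integral_prod_branches ν k fun _ => sizeWeight z]
    simp only [Finset.prod_const, Finset.card_range, Nat.descFactorial_one]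
    push_cast
    ring
  · ring

/-- Terms that involve one branch contribute `Φ'`, terms that involve two contribute `Φ''`. The
unknown enters linearly with coefficient `w`, which produces the factor `1 / (1 - w)`. -/
lemma treeExp_pairPoly {z x y : ℂ} (hz : ‖z‖ ≤ 1 / 16) (hx : ‖x‖ ≤ 2) (hy : ‖y‖ ≤ 2)
    (h1 : Summable fun k => ν.real {k} * k.descFactorial 1)
    (h2 : Summable fun k => ν.real {k} * k.descFactorial 2) :
    treeExp ν (fun t => sizeWeight z t * pairPoly x y t) = treeExp ν (sizeWeight z) +
      z * pgfDeriv (fun k => ν.real {k}) 1 (treeExp ν (sizeWeight z)) *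
        (x * treeExp ν (fun t => sizeWeight z t * heightSum x t) +
          y * treeExp ν (fun t => sizeWeight z t * heightSum y t) +
          treeExp ν (fun t => sizeWeight z t * pairPoly x y t)) +
      x * y * (z * pgfDeriv (fun k => ν.real {k}) 2 (treeExp ν (sizeWeight z))) *
        treeExp ν (fun t => sizeWeight z t * heightSum x t) *
        treeExp ν (fun t => sizeWeight z t * heightSum y t) := by
  have hz1 : ‖z‖ ≤ 1 := hz.trans (by norm_num)
  have hW : ∀ ω, ‖sizeWeight z (treeFinset ω)‖ ≤ 1 := fun ω => norm_sizeWeight_le hz1 _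
  have hV := fun ω => norm_sizeWeight_mul_le hz (norm_heightSum_le hx ω)
  have hV' := fun ω => norm_sizeWeight_mul_le hz (norm_heightSum_le hy ω)
  have hP := fun ω => norm_sizeWeight_mul_le hz (norm_pairPoly_le hx hy ω)
  have hF := norm_treeExp_le_one ν hW
  refine (hasSum_treeExp ν (f := fun t => sizeWeight z t * pairPoly x y t) hP).unique ?_
  have e0 := treeExp_sizeWeight ν hz1
  have e1 := hasSum_pgfDeriv (p := fun k => ν.real {k}) (fun _ => measureReal_nonneg) h1 hF
  have e2 := hasSum_pgfDeriv (p := fun k => ν.real {k}) (fun _ => measureReal_nonneg) h2 hF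
  convert! (e0.add ((e1.mul_left z).mul_right
    (x * treeExp ν (fun t => sizeWeight z t * heightSum x t) +
          y * treeExp ν (fun t => sizeWeight z t * heightSum y t) +
          treeExp ν (fun t => sizeWeight z t * pairPoly x y t)))).add
      ((e2.mul_left (x * y * z)).mul_right (treeExp ν (fun t => sizeWeight z t * heightSum x t) *
        treeExp ν (fun t => sizeWeight z t * heightSum y t))) using 1
  · funext k
    obtain ⟨i1, j1⟩ := integral_prod_mul_sum ν hW hV k
    obtain ⟨i2, j2⟩ := integral_prod_mul_sum ν hW hV' k
    obtain ⟨i3, j3⟩ := integral_prod_mul_sum ν hW hP k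
    obtain ⟨i4, j4⟩ := integral_prod_mul_sum_sum ν hW hV hV' k
    have i0 := integrable_prod_branches ν k (h := fun _ => sizeWeight z) (fun _ => hW)
    simp_rw [sizeWeight_mul_pairPoly_graft]
    have : ∀ P a b c d : ℂ, z * P * (1 + x * a + y * b + c + x * y * d) =
        z * P + z * x * (P * a) + z * y * (P * b) + z * (P * c) + z * x * y * (P * d) :=
      fun P a b c d => by ring
    simp_rw [this]
    rw [integral_add_five (i0.const_mul z) (i1.const_mul (z * x)) (i2.const_mul (z * y))
      (i3.const_mul z) (i4.const_mul (z * x * y))]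
    simp only [integral_const_mul]
    rw [j1, j2, j3, j4, integral_prod_branches ν k fun _ => sizeWeight z]
    have hd : (k.descFactorial 2 : ℝ) = k * (k - 1 : ℕ) := by
      rw [Nat.descFactorial_succ, Nat.descFactorial_one]
      push_cast
      ring
    simp only [Finset.prod_const, Finset.card_range, Nat.descFactorial_one, hd]
    push_cast
    ring
  · ring

end GaltonWatson

/-! ### Splitting by tree size, distances as word lengths, and polynomiality in `x` and `y`. -/

namespace GaltonWatson

lemma mem_sizeEvent {n : ℕ} {ω : List ℕ → ℕ} :
    ω ∈ sizeEvent n ↔ treeFinset ω ≠ ∅ ∧ (treeFinset ω).card = n := by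
  constructor
  · intro h
    have hf : (familyTree ω).Finite := Set.finite_of_encard_eq_coe h
    refine ⟨treeFinset_ne_empty_iff.2 hf, ?_⟩
    have h' : (familyTree ω).encard = n := h
    rw [← coe_treeFinset hf, Set.encard_coe_eq_coe_finsetCard] at h'
    exact_mod_cast h'
  · rintro ⟨h1, h2⟩
    change (familyTree ω).encard = n
    rw [← coe_treeFinset (treeFinset_ne_empty_iff.1 h1), Set.encard_coe_eq_coe_finsetCard, h2]

lemma measurableSet_sizeEvent (n : ℕ) : MeasurableSet (sizeEvent n) := by
  have : sizeEvent n = treeFinset ⁻¹' {t | t ≠ ∅ ∧ t.card = n} := Set.ext fun ω => mem_sizeEvent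
  rw [this]
  exact measurable_treeFinset (Set.to_countable _).measurableSet

/-- The size events cover all finite trees; the condition `f ∅ = 0` removes the infinite ones. -/
lemma hasSum_treeExp_size (ν : Measure ℕ) [IsProbabilityMeasure ν] {f : Finset (List ℕ) → ℂ}
    {C : ℝ} (hf : ∀ ω, ‖f (treeFinset ω)‖ ≤ C) (h0 : f ∅ = 0) :
    HasSum (fun n => ∫ ω in sizeEvent n, f (treeFinset ω) ∂law ν) (treeExp ν f) := by
  have h1 := hasSum_integral_iUnion (μ := law ν) (f := fun ω => f (treeFinset ω))
    (s := sizeEvent) measurableSet_sizeEvent (by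
      intro m n hmn
      rw [Function.onFun, Set.disjoint_left]
      intro ω h h'
      exact hmn ((mem_sizeEvent.1 h).2.symm.trans (mem_sizeEvent.1 h').2))
    (integrable_comp_treeFinset ν C hf).integrableOn
  rwa [setIntegral_eq_integral_of_forall_compl_eq_zero] at h1
  intro ω hω
  have : treeFinset ω = ∅ := by
    by_contra h
    exact hω (Set.mem_iUnion.2 ⟨_, mem_sizeEvent.2 ⟨h, rfl⟩⟩)
  rw [this, h0]

/-- The probability that the tree has exactly `n` vertices. -/
noncomputable def sizeProb (ν : Measure ℕ) [IsProbabilityMeasure ν] (n : ℕ) : ℝ :=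
  (law ν).real (sizeEvent n)

/-- The integral of the pair sum over the trees with `n` vertices. -/
noncomputable def pairMoment (ν : Measure ℕ) [IsProbabilityMeasure ν] (n : ℕ) (x y : ℂ) : ℂ :=
  ∫ ω in sizeEvent n, pairPoly x y (treeFinset ω) ∂law ν

variable (ν : Measure ℕ) [IsProbabilityMeasure ν]

lemma hasSum_sizeProb {z : ℂ} (hz : ‖z‖ ≤ 1) :
    HasSum (fun n => (sizeProb ν n : ℂ) * z ^ n) (treeExp ν (sizeWeight z)) := by
  convert! hasSum_treeExp_size ν (f := sizeWeight z) (fun ω => norm_sizeWeight_le hz _)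
    (by simp [sizeWeight]) using 2 with n
  rw [setIntegral_congr_fun (measurableSet_sizeEvent n) (g := fun _ => z ^ n)]
  · simp [sizeProb]
  · intro ω hω
    obtain ⟨h1, h2⟩ := mem_sizeEvent.1 hω
    simp [sizeWeight, h1, h2]

lemma hasSum_pairMoment {z x y : ℂ} (hz : ‖z‖ ≤ 1 / 16) (hx : ‖x‖ ≤ 2) (hy : ‖y‖ ≤ 2) :
    HasSum (fun n => pairMoment ν n x y * z ^ n)
      (treeExp ν fun t => sizeWeight z t * pairPoly x y t) := by
  convert! hasSum_treeExp_size ν (f := fun t => sizeWeight z t * pairPoly x y t)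
    (fun ω => norm_sizeWeight_mul_le hz (norm_pairPoly_le hx hy ω))
    (by simp [sizeWeight]) using 2 with n
  rw [pairMoment, ← integral_mul_const]
  refine setIntegral_congr_fun (measurableSet_sizeEvent n) fun ω hω => ?_
  obtain ⟨h1, h2⟩ := mem_sizeEvent.1 hω
  simp only [sizeWeight, h1, h2, if_false]
  ring

lemma lca_prefix_left (v w : List ℕ) : lca v w <+: v := by
  induction v generalizing w with
  | nil => cases w <;> simp [lca]
  | cons i v ih =>
    cases w with
    | nil => simp [lca]
    | cons j w =>
      rw [lca]
      split_ifs
      · exact (List.cons_prefix_cons).2 ⟨rfl, ih w⟩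
      · exact List.nil_prefix

lemma lca_comm (v w : List ℕ) : lca v w = lca w v := by
  induction v generalizing w with
  | nil => cases w <;> simp [lca]
  | cons i v ih =>
    cases w with
    | nil => simp [lca]
    | cons j w =>
      rw [lca, lca]
      by_cases h : i = j
      · simp [h, ih]
      · simp [h, Ne.symm h]

lemma wordTree_adj_append (u : List ℕ) (i : ℕ) : wordTree.Adj (u ++ [i]) u := by
  rw [wordTree, SimpleGraph.fromRel_adj]
  exact ⟨by simp, Or.inr ⟨i, rfl⟩⟩

/-- Each edge changes the word length by one. This gives the lower bound for distances to a prefix.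
-/
lemma length_le_of_walk {u v : List ℕ} (p : wordTree.Walk u v) :
    u.length ≤ v.length + p.length := by
  induction p with
  | nil => simp
  | cons h p ih =>
    rw [wordTree, SimpleGraph.fromRel_adj] at h
    rw [SimpleGraph.Walk.length_cons]
    obtain ⟨-, ⟨i, h⟩ | ⟨i, h⟩⟩ := h
    all_goals
      have := congrArg List.length h
      simp only [List.length_append, List.length_singleton] at this
      omega

lemma exists_walk_append (u s : List ℕ) : ∃ p : wordTree.Walk (u ++ s) u, p.length = s.length := by
  induction s using List.reverseRecOn with
  | nil => exact ⟨SimpleGraph.Walk.nil.copy (by simp) rfl, by simp⟩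
  | append_singleton s i ih =>
    obtain ⟨p, hp⟩ := ih
    refine ⟨(SimpleGraph.Walk.cons (wordTree_adj_append (u ++ s) i) p).copy (by simp) rfl, ?_⟩
    simp [hp]

lemma wordTree_dist_of_prefix {u v : List ℕ} (h : u <+: v) :
    wordTree.dist v u = v.length - u.length := by
  obtain ⟨s, rfl⟩ := h
  obtain ⟨p, hp⟩ := exists_walk_append u s
  refine le_antisymm ((SimpleGraph.dist_le p).trans (by simp [hp])) ?_
  obtain ⟨q, hq⟩ := (SimpleGraph.Walk.reachable p).exists_walk_length_eq_dist
  have := length_le_of_walk q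
  rw [← hq]
  omega

lemma pairSum_eq_pairPoly {ω : List ℕ → ℕ} (h : (familyTree ω).Finite) (x y : ℂ) :
    pairSum (familyTree ω) x y = pairPoly x y (treeFinset ω) := by
  have key : ∀ v w : List ℕ, x ^ wordTree.dist v (lca v w) * y ^ wordTree.dist w (lca v w) =
      x ^ (v.length - (lca v w).length) * y ^ (w.length - (lca v w).length) := fun v w => by
    rw [wordTree_dist_of_prefix (lca_prefix_left v w),
      wordTree_dist_of_prefix (lca_comm v w ▸ lca_prefix_left w v)]
  rw [pairSum, ← coe_treeFinset h]
  rw [finsum_mem_coe_finset]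
  refine Finset.sum_congr rfl fun v _ => ?_
  rw [finsum_mem_coe_finset]
  exact Finset.sum_congr rfl fun w _ => key v w

lemma pairGF_eq (n : ℕ) (x y : ℂ) :
    pairGF ν n x y = ((sizeProb ν n)⁻¹ : ℝ) * pairMoment ν n x y := by
  rw [pairGF, ProbabilityTheory.cond, integral_smul_measure, pairMoment, sizeProb,
    setIntegral_congr_fun (measurableSet_sizeEvent n) fun ω hω =>
      pairSum_eq_pairPoly (treeFinset_ne_empty_iff.1 (mem_sizeEvent.1 hω).1) x y]
  rw [ENNReal.toReal_inv, Complex.real_smul]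
  rfl

/-- The number of pairs of vertices at distances `a` and `b` from their last common ancestor. -/
noncomputable def pairCount (a b : ℕ) (t : Finset (List ℕ)) : ℂ :=
  ∑ v ∈ t, ∑ w ∈ t,
    if v.length - (lca v w).length = a ∧ w.length - (lca v w).length = b then 1 else 0

lemma pairPoly_eq_sum_pairCount {t : Finset (List ℕ)} {n : ℕ} (ht : ∀ v ∈ t, v.length < n)
    (x y : ℂ) : pairPoly x y t =
      ∑ a ∈ Finset.range n, ∑ b ∈ Finset.range n, pairCount a b t * (x ^ a * y ^ b) := by
  have : ∀ a b, pairCount a b t * (x ^ a * y ^ b) = ∑ v ∈ t, ∑ w ∈ t,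
      if v.length - (lca v w).length = a ∧ w.length - (lca v w).length = b then x ^ a * y ^ b
      else 0 := fun a b => by
    simp only [pairCount, Finset.sum_mul, ite_mul, one_mul, zero_mul]
  simp_rw [this]
  rw [Finset.sum_congr rfl fun a _ => Finset.sum_comm]
  rw [Finset.sum_comm]
  refine Finset.sum_congr rfl fun v hv => ?_
  rw [Finset.sum_congr rfl fun a _ => Finset.sum_comm]
  rw [Finset.sum_comm]
  refine Finset.sum_congr rfl fun w hw => ?_
  have h1 := ht v hv
  have h2 := ht w hw
  rw [Finset.sum_eq_single (v.length - (lca v w).length),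
    Finset.sum_eq_single (w.length - (lca v w).length)]
  · simp
  · intro b _ hb
    simp [hb.symm]
  · intro h
    exact absurd (Finset.mem_range.2 (by omega)) h
  · intro a _ ha
    simp [ha.symm]
  · intro h
    exact absurd (Finset.mem_range.2 (by omega)) h

lemma norm_pairCount_le (a b : ℕ) (t : Finset (List ℕ)) : ‖pairCount a b t‖ ≤ t.card * t.card := by
  calc ‖pairCount a b t‖ ≤ ∑ v ∈ t, ∑ w ∈ t, (1 : ℝ) := by
        refine norm_sum_le_of_le _ fun v _ => norm_sum_le_of_le _ fun w _ => ?_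
        split_ifs <;> simp
    _ = t.card * t.card := by simp

/-- In a tree with `n` vertices every distance is below `n`, so grouping pairs by their two
distances gives a polynomial whose coefficients are bounded integrals. -/
lemma pairMoment_eq_sum (n : ℕ) (x y : ℂ) : pairMoment ν n x y =
    ∑ a ∈ Finset.range n, ∑ b ∈ Finset.range n,
      (∫ ω in sizeEvent n, pairCount a b (treeFinset ω) ∂law ν) * (x ^ a * y ^ b) := by
  have hI : ∀ a b, Integrable (fun ω => pairCount a b (treeFinset ω))
      ((law ν).restrict (sizeEvent n)) := fun a b =>
    Integrable.of_bound (measurable_comp_treeFinset _).aestronglyMeasurable ((n : ℝ) * n) <|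
      (ae_restrict_iff' (measurableSet_sizeEvent n)).2 (Filter.Eventually.of_forall fun ω hω => by
        rw [← (mem_sizeEvent.1 hω).2]; exact norm_pairCount_le a b _)
  rw [pairMoment, setIntegral_congr_fun (measurableSet_sizeEvent n) fun ω hω =>
    pairPoly_eq_sum_pairCount (n := n) (fun v hv => (mem_sizeEvent.1 hω).2 ▸ length_lt_card hv) x y]
  rw [integral_finsetSum _ fun a _ => integrable_finsetSum _ fun b _ => (hI a b).mul_const _]
  refine Finset.sum_congr rfl fun a _ => ?_
  rw [integral_finsetSum _ fun b _ => (hI a b).mul_const _]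
  exact Finset.sum_congr rfl fun b _ => integral_mul_const _ _

lemma analyticOnNhd_pairGF (n : ℕ) (s : Set (ℂ × ℂ)) :
    AnalyticOnNhd ℂ (fun p : ℂ × ℂ => pairGF ν n p.1 p.2) s := by
  simp_rw [pairGF_eq, pairMoment_eq_sum]
  intro p _
  refine analyticAt_const.mul (Finset.analyticAt_fun_sum _ fun a _ =>
    Finset.analyticAt_fun_sum _ fun b _ => analyticAt_const.mul ?_)
  exact (analyticAt_fst.pow a).mul (analyticAt_snd.pow b)

end GaltonWatson

/-! ### Power series: products, powers, composition and uniqueness of coefficients. -/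

namespace GaltonWatson

open PowerSeries in
lemma hasSum_coeff_mul {A B : PowerSeries ℝ} {z a b : ℂ}
    (hA : Summable fun n => ‖((coeff n A : ℝ) : ℂ) * z ^ n‖)
    (hB : Summable fun n => ‖((coeff n B : ℝ) : ℂ) * z ^ n‖)
    (ha : HasSum (fun n => ((coeff n A : ℝ) : ℂ) * z ^ n) a)
    (hb : HasSum (fun n => ((coeff n B : ℝ) : ℂ) * z ^ n) b) :
    (Summable fun n => ‖((coeff n (A * B) : ℝ) : ℂ) * z ^ n‖) ∧
      HasSum (fun n => ((coeff n (A * B) : ℝ) : ℂ) * z ^ n) (a * b) := by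
  have h : (fun n => ((coeff n (A * B) : ℝ) : ℂ) * z ^ n) = fun n =>
      ∑ kl ∈ Finset.HasAntidiagonal.antidiagonal n, ((coeff kl.1 A : ℝ) : ℂ) * z ^ kl.1 *
        (((coeff kl.2 B : ℝ) : ℂ) * z ^ kl.2) := by
    funext n
    rw [coeff_mul]
    push_cast
    rw [Finset.sum_mul]
    refine Finset.sum_congr rfl fun kl hkl => ?_
    rw [← Finset.HasAntidiagonal.mem_antidiagonal.1 hkl, pow_add]
    ring
  have h1 := summable_norm_sum_mul_antidiagonal_of_summable_norm hA hB
  have h2 := tsum_mul_tsum_eq_tsum_sum_antidiagonal_of_summable_norm hA hB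
  rw [ha.tsum_eq, hb.tsum_eq] at h2
  rw [← h] at h2
  have h3 : (fun n => ‖((coeff n (A * B) : ℝ) : ℂ) * z ^ n‖) = fun n =>
      ‖∑ kl ∈ Finset.HasAntidiagonal.antidiagonal n, ((coeff kl.1 A : ℝ) : ℂ) * z ^ kl.1 *
        (((coeff kl.2 B : ℝ) : ℂ) * z ^ kl.2)‖ := by
    funext n
    rw [← congrFun h n]
  have h4 : Summable fun n => ‖((coeff n (A * B) : ℝ) : ℂ) * z ^ n‖ := by
    rw [h3]
    exact h1
  exact ⟨h4, h2 ▸ h4.of_norm.hasSum⟩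

open PowerSeries in
lemma hasSum_coeff_pow {A : PowerSeries ℝ} {z a : ℂ}
    (hA : Summable fun n => ‖((coeff n A : ℝ) : ℂ) * z ^ n‖)
    (ha : HasSum (fun n => ((coeff n A : ℝ) : ℂ) * z ^ n) a) (k : ℕ) :
    (Summable fun n => ‖((coeff n (A ^ k) : ℝ) : ℂ) * z ^ n‖) ∧
      HasSum (fun n => ((coeff n (A ^ k) : ℝ) : ℂ) * z ^ n) (a ^ k) := by
  induction k with
  | zero =>
    have h : ∀ n, n ≠ 0 → ((coeff n (A ^ 0) : ℝ) : ℂ) * z ^ n = 0 := fun n hn => by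
      simp [coeff_one, hn]
    constructor
    · exact (hasSum_single 0 fun n hn => by rw [h n hn, norm_zero]).summable
    · simpa using hasSum_single 0 h
  | succ k ih =>
    rw [pow_succ, pow_succ]
    exact hasSum_coeff_mul ih.1 hA ih.2 ha

open PowerSeries in
lemma coeff_pow_nonneg {A : PowerSeries ℝ} (hA : ∀ n, 0 ≤ coeff n A) (k n : ℕ) :
    0 ≤ coeff n (A ^ k) := by
  induction k generalizing n with
  | zero =>
    rw [pow_zero, coeff_one]
    split_ifs <;> norm_num
  | succ k ih =>
    rw [pow_succ, coeff_mul]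
    exact Finset.sum_nonneg fun kl _ => mul_nonneg (ih _) (hA _)

lemma hasFPowerSeriesOnBall_of_hasSum {c : ℕ → ℂ} {f : ℂ → ℂ} {ρ : ℝ} (hρ : 0 < ρ)
    (h : ∀ z, ‖z‖ < ρ → HasSum (fun n => c n * z ^ n) (f z)) :
    HasFPowerSeriesOnBall f (FormalMultilinearSeries.ofScalars ℂ c) 0 (ENNReal.ofReal ρ) where
  r_le := by
    refine ENNReal.le_of_forall_nnreal_lt fun r hr => ?_
    have hr' : (r : ℝ) < ρ := by
      rw [← ENNReal.ofReal_coe_nnreal, ENNReal.ofReal_lt_ofReal_iff hρ] at hr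
      exact hr
    refine FormalMultilinearSeries.le_radius_of_tendsto _ (l := 0) ?_
    have := (h (r : ℂ) (by simpa using hr')).summable.tendsto_atTop_zero.norm
    simpa using this
  r_pos := by simpa using hρ
  hasSum := by
    intro y hy
    have hy' : ‖y‖ < ρ := by
      simpa [Metric.mem_eball, edist_zero_right, ← ofReal_norm, ENNReal.ofReal_lt_ofReal_iff hρ] using hy
    simpa [FormalMultilinearSeries.ofScalars_apply_eq, mul_comm] using h y hy'

lemma coeff_unique_of_hasSum {c d : ℕ → ℂ} {f : ℂ → ℂ} {ρ : ℝ} (hρ : 0 < ρ)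
    (hc : ∀ z, ‖z‖ < ρ → HasSum (fun n => c n * z ^ n) (f z))
    (hd : ∀ z, ‖z‖ < ρ → HasSum (fun n => d n * z ^ n) (f z)) : c = d := by
  have := (hasFPowerSeriesOnBall_of_hasSum hρ hc).hasFPowerSeriesAt.eq_formalMultilinearSeries
    (hasFPowerSeriesOnBall_of_hasSum hρ hd).hasFPowerSeriesAt
  funext n
  have h2 := congrArg (fun p => FormalMultilinearSeries.coeff p n) this
  simpa using h2

open PowerSeries in
lemma hasSum_coeff_pow_of_nonneg {A : PowerSeries ℝ} (hA : ∀ n, 0 ≤ coeff n A) {s : ℝ}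
    (hs : HasSum (fun n => coeff n A) s) (k : ℕ) : HasSum (fun n => coeff n (A ^ k)) (s ^ k) := by
  have h1 : HasSum (fun n => ((coeff n A : ℝ) : ℂ) * 1 ^ n) s := by
    simpa using Complex.hasSum_ofReal.2 hs
  have h0 : Summable fun n => ‖((coeff n A : ℝ) : ℂ) * 1 ^ n‖ := by
    simpa only [one_pow, mul_one, Complex.norm_real, Real.norm_of_nonneg (hA _)] using hs.summable
  have h2 := (hasSum_coeff_pow h0 h1 k).2
  simp only [one_pow, mul_one, ← Complex.ofReal_pow] at h2
  exact Complex.hasSum_ofReal.1 h2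

open PowerSeries in
/-- Coefficients of a composition `∑ q i A ^ i`. -/
lemma hasSum_comp_coeff {A : PowerSeries ℝ} (hA : ∀ n, 0 ≤ coeff n A) {s : ℝ}
    (hs : HasSum (fun n => coeff n A) s) (hs1 : s ≤ 1) {q : ℕ → ℝ} (hq : ∀ i, 0 ≤ q i)
    (hq1 : Summable q) {z a : ℂ} (hz : ‖z‖ ≤ 1)
    (ha : HasSum (fun n => ((coeff n A : ℝ) : ℂ) * z ^ n) a) :
    HasSum (fun n => ((∑' i, q i * coeff n (A ^ i) : ℝ) : ℂ) * z ^ n) (∑' i, (q i : ℂ) * a ^ i) := by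
  have hle : ∀ (B : PowerSeries ℝ) (hB : ∀ n, 0 ≤ coeff n B) (n : ℕ),
      ‖((coeff n B : ℝ) : ℂ) * z ^ n‖ ≤ coeff n B := fun B hB n => by
    rw [norm_mul, norm_pow, Complex.norm_real, Real.norm_of_nonneg (hB n)]
    exact mul_le_of_le_one_right (hB n) (pow_le_one₀ (norm_nonneg _) hz)
  have hsA : Summable fun n => ‖((coeff n A : ℝ) : ℂ) * z ^ n‖ :=
    Summable.of_nonneg_of_le (fun _ => norm_nonneg _) (hle A hA) hs.summable
  have hpow1 := hasSum_coeff_pow_of_nonneg hA hs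
  have hs0 : 0 ≤ s := hs.nonneg hA
  -- All terms are nonnegative and row `i` sums to `q i * s ^ i ≤ q i`, so the double series
  -- converges absolutely and may be summed by columns.
  have hdouble : Summable fun p : ℕ × ℕ => q p.1 * coeff p.2 (A ^ p.1) := by
    have h0 : ∀ i n, 0 ≤ q i * coeff n (A ^ i) := fun i n =>
      mul_nonneg (hq i) (coeff_pow_nonneg hA i n)
    rw [summable_prod_of_nonneg fun p => h0 p.1 p.2]
    have h1 : ∀ i, HasSum (fun n => q i * coeff n (A ^ i)) (q i * s ^ i) := fun i =>
      (hpow1 i).mul_left (q i)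
    refine ⟨fun i => (h1 i).summable, ?_⟩
    simp only [(h1 _).tsum_eq]
    refine Summable.of_nonneg_of_le (fun i => mul_nonneg (hq i) (pow_nonneg hs0 i)) (fun i => ?_) hq1
    exact mul_le_of_le_one_right (hq i) (pow_le_one₀ hs0 hs1)
  have hdoubleC : Summable fun p : ℕ × ℕ => (q p.1 : ℂ) * (((coeff p.2 (A ^ p.1) : ℝ) : ℂ) * z ^ p.2) := by
    refine Summable.of_norm_bounded hdouble fun p => ?_
    rw [norm_mul, Complex.norm_real, Real.norm_of_nonneg (hq _)]
    exact mul_le_mul_of_nonneg_left (hle _ (coeff_pow_nonneg hA _) _) (hq _)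
  have h1 := hdoubleC.hasSum.prod_fiberwise fun i =>
    ((hasSum_coeff_pow hsA ha i).2.mul_left (q i : ℂ))
  have hswap := (Equiv.prodComm ℕ ℕ).summable_iff.2 hdoubleC
  have hsw2 := (Equiv.prodComm ℕ ℕ).hasSum_iff.2 hdoubleC.hasSum
  have h2 := hsw2.prod_fiberwise (g := fun n => ((∑' i, q i * coeff n (A ^ i) : ℝ) : ℂ) * z ^ n) fun n => by
    have h3 : Summable fun i => q i * coeff n (A ^ i) :=
      ((Equiv.prodComm ℕ ℕ).summable_iff.2 hdouble).prod_factor n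
    have h4 := (Complex.hasSum_ofReal.2 h3.hasSum).mul_right (z ^ n)
    simpa [mul_assoc] using h4
  rw [h1.tsum_eq]
  exact h2

end GaltonWatson

/-! ### Critical offspring laws and Lagrange inversion for the total progeny. -/

namespace GaltonWatson

/-- `p` is a nondegenerate critical offspring distribution with finite variance. -/
structure CriticalOffspring (p : ℕ → ℝ) : Prop where
  nonneg : ∀ k, 0 ≤ p k
  hasSum_one : HasSum p 1
  hasSum_mean : HasSum (fun k => p k * k) 1
  summable_sq : Summable fun k => p k * (k : ℝ) ^ 2
  zero_pos : 0 < p 0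
  exists_two_le : ∃ k, 2 ≤ k ∧ 0 < p k

/-- `a` is the law of the total progeny for the offspring distribution `p`, with generating
function `F`. -/
structure ProgenyLaw (p a : ℕ → ℝ) (F : ℂ → ℂ) : Prop where
  nonneg : ∀ n, 0 ≤ a n
  summable : Summable a
  tsum_le_one : ∑' n, a n ≤ 1
  hasSum : ∀ z, ‖z‖ ≤ 1 → HasSum (fun n => (a n : ℂ) * z ^ n) (F z)
  hasSum_offspring : ∀ z, ‖z‖ ≤ 1 → HasSum (fun k => (p k : ℂ) * (z * F z ^ k)) (F z)

lemma hasSum_integral_nat {ν : Measure ℕ} [IsProbabilityMeasure ν] {f : ℕ → ℝ}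
    (hf : Integrable f ν) : HasSum (fun k => ν.real {k} * f k) (∫ k, f k ∂ν) := by
  have h := hasSum_integral_measure (μ := fun k : ℕ => ν {k} • Measure.dirac k) (f := f)
    (by rwa [Measure.sum_smul_dirac])
  rw [Measure.sum_smul_dirac] at h
  simpa [integral_smul_measure, measureReal_def] using h

/-- Mean one says `∑ p k (k - 1) = 0`, and positive variance excludes `p 1 = 1`. Hence the series
has terms of both signs: mass at `0` and mass at some `k ≥ 2`. -/
lemma criticalOffspring_of_measure {ν : Measure ℕ} [IsProbabilityMeasure ν]
    (hmean : ∫ k, (k : ℝ) ∂ν = 1) (hL2 : MemLp (fun k : ℕ => (k : ℝ)) 2 ν)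
    (hvar : 0 < variance (fun k : ℕ => (k : ℝ)) ν) :
    CriticalOffspring fun k => ν.real {k} := by
  have hone : HasSum (fun k => ν.real {k}) 1 := by
    simpa using hasSum_integral_nat (ν := ν) (integrable_const (1 : ℝ))
  have hm : HasSum (fun k => ν.real {k} * k) 1 :=
    hmean ▸ hasSum_integral_nat (hL2.integrable (by norm_num))
  have hdiff : HasSum (fun k => ν.real {k} * ((k : ℝ) - 1)) 0 := by
    simpa [mul_sub] using hm.sub hone
  have hnd : ∃ k, k ≠ 1 ∧ 0 < ν.real {k} := by
    by_contra! h
    have h0 : ∀ᵐ k : ℕ ∂ν, (k : ℝ) = 1 := by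
      rw [ae_iff_of_countable]
      intro k hk
      by_contra hk1
      have h1 := h k (by exact_mod_cast hk1)
      rw [measureReal_def] at h1
      exact absurd h1 (not_le.2 (ENNReal.toReal_pos hk (measure_ne_top _ _)))
    rw [variance_congr h0] at hvar
    simp [variance, evariance] at hvar
  have hbig : ∃ k, 2 ≤ k ∧ 0 < ν.real {k} := by
    by_contra! h
    have hle : ∀ k, ν.real {k} * ((k : ℝ) - 1) ≤ 0 := by
      intro k
      rcases Nat.lt_or_ge k 2 with hk | hk
      · exact mul_nonpos_of_nonneg_of_nonpos measureReal_nonneg (by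
          have : (k : ℝ) ≤ 1 := by exact_mod_cast (by omega : k ≤ 1)
          linarith)
      · rw [le_antisymm (h k hk) measureReal_nonneg]
        simp
    have hz : HasSum (fun k => -(ν.real {k} * ((k : ℝ) - 1))) 0 := by simpa using hdiff.neg
    have hz' := (hasSum_zero_iff_of_nonneg fun k => by simpa using hle k).1 hz
    obtain ⟨k, hk1, hk⟩ := hnd
    rcases Nat.lt_or_ge k 2 with hk2 | hk2
    · have : k = 0 := by omega
      subst this
      have := congrFun hz' 0
      simp at this
      linarith
    · linarith [h k hk2]
  refine ⟨fun k => measureReal_nonneg, hone, hm, ?_, ?_, hbig⟩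
  · exact (hasSum_integral_nat hL2.integrable_sq).summable
  · by_contra h
    have h0 : ν.real {0} = 0 := le_antisymm (not_lt.1 h) measureReal_nonneg
    have hnn : ∀ k, 0 ≤ ν.real {k} * ((k : ℝ) - 1) := by
      intro k
      rcases Nat.eq_zero_or_pos k with hk | hk
      · subst hk
        simp [h0]
      · exact mul_nonneg measureReal_nonneg (by
          have : (1 : ℝ) ≤ k := by exact_mod_cast hk
          linarith)
    have hz' := (hasSum_zero_iff_of_nonneg hnn).1 hdiff
    obtain ⟨k, hk2, hk⟩ := hbig
    have h1 := congrFun hz' k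
    have : (2 : ℝ) ≤ k := by exact_mod_cast hk2
    have : 0 < ν.real {k} * ((k : ℝ) - 1) := mul_pos hk (by linarith)
    simp only [Pi.zero_apply] at h1
    linarith

lemma progenyLaw_sizeProb (ν : Measure ℕ) [IsProbabilityMeasure ν] :
    ProgenyLaw (fun k => ν.real {k}) (sizeProb ν) fun z => treeExp ν (sizeWeight z) := by
  have h1 : HasSum (fun n => (sizeProb ν n : ℂ)) (treeExp ν (sizeWeight 1)) := by
    simpa using hasSum_sizeProb ν (z := 1) (by simp)
  have hnn : ∀ n, 0 ≤ sizeProb ν n := fun n => measureReal_nonneg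
  have hs : Summable (sizeProb ν) := Complex.summable_ofReal.1 h1.summable
  refine ⟨hnn, hs, ?_, fun z hz => hasSum_sizeProb ν hz, fun z hz => treeExp_sizeWeight ν hz⟩
  have h2 : ((∑' n, sizeProb ν n : ℝ) : ℂ) = treeExp ν (sizeWeight 1) := by
    rw [← h1.tsum_eq, Complex.ofReal_tsum]
  have h3 := norm_treeExp_le_one ν (f := sizeWeight 1) fun ω => norm_sizeWeight_le (by simp) _
  rw [← h2, Complex.norm_real] at h3
  exact (le_abs_self _).trans h3

namespace ProgenyLaw

variable {p a : ℕ → ℝ} {F : ℂ → ℂ}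

open PowerSeries

/-- Coefficients are compared in `F ^ j = z ^ j Φ(F) ^ j`. The degree drops from `n` to `n - j`,
which makes an induction on `n` possible. -/
lemma coeff_mk_pow (hp : CriticalOffspring p) (h : ProgenyLaw p a F) (j n : ℕ) :
    coeff n ((PowerSeries.mk a) ^ j) =
      if j ≤ n then ∑' i, coeff i ((PowerSeries.mk p) ^ j) * coeff (n - j) ((PowerSeries.mk a) ^ i) else 0 := by
  have hA : ∀ n, 0 ≤ coeff n (PowerSeries.mk a) := fun n => by simpa using h.nonneg n
  have hP : ∀ n, 0 ≤ coeff n (PowerSeries.mk p) := fun n => by simpa using hp.nonneg n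
  have hFle : ∀ z : ℂ, ‖z‖ ≤ 1 → ‖F z‖ ≤ 1 := fun z hz => by
    refine (h.hasSum z hz).tsum_eq ▸ (tsum_of_norm_bounded h.summable.hasSum fun n => ?_).trans
      h.tsum_le_one
    rw [norm_mul, norm_pow, Complex.norm_real, Real.norm_of_nonneg (h.nonneg n)]
    exact mul_le_of_le_one_right (h.nonneg n) (pow_le_one₀ (norm_nonneg _) hz)
  set c : ℕ → ℝ := fun n => ∑' i, coeff i ((PowerSeries.mk p) ^ j) * coeff n ((PowerSeries.mk a) ^ i) with hc
  have hPs : ∀ u : ℂ, ‖u‖ ≤ 1 → Summable fun n => ‖((coeff n (PowerSeries.mk p) : ℝ) : ℂ) * u ^ n‖ :=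
    fun u hu => by
      refine Summable.of_nonneg_of_le (fun _ => norm_nonneg _) (fun n => ?_) hp.hasSum_one.summable
      rw [norm_mul, norm_pow, Complex.norm_real, coeff_mk, Real.norm_of_nonneg (hp.nonneg n)]
      exact mul_le_of_le_one_right (hp.nonneg n) (pow_le_one₀ (norm_nonneg _) hu)
  have hAs : ∀ u : ℂ, ‖u‖ ≤ 1 → Summable fun n => ‖((coeff n (PowerSeries.mk a) : ℝ) : ℂ) * u ^ n‖ :=
    fun u hu => by
      refine Summable.of_nonneg_of_le (fun _ => norm_nonneg _) (fun n => ?_) h.summable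
      rw [norm_mul, norm_pow, Complex.norm_real, coeff_mk, Real.norm_of_nonneg (h.nonneg n)]
      exact mul_le_of_le_one_right (h.nonneg n) (pow_le_one₀ (norm_nonneg _) hu)
  have key : (fun n => ((coeff n ((PowerSeries.mk a) ^ j) : ℝ) : ℂ)) =
      fun n => if j ≤ n then ((c (n - j) : ℝ) : ℂ) else 0 := by
    refine coeff_unique_of_hasSum (f := fun z => F z ^ j) one_pos (fun z hz => ?_) fun z hz => ?_
    · exact (hasSum_coeff_pow (hAs z hz.le) (by simpa using h.hasSum z hz.le) j).2
    · have hu := hFle z hz.le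
      have hΦ := (hPs _ hu).of_norm.hasSum
      set P := ∑' n, ((coeff n (PowerSeries.mk p) : ℝ) : ℂ) * F z ^ n with hPdef
      have hF : F z = z * P := by
        refine (h.hasSum_offspring z hz.le).unique ?_
        convert! hΦ.mul_left z using 2 with k
        rw [coeff_mk]
        ring
      have h1 := (hasSum_coeff_pow (hPs _ hu) hΦ j).2
      have h2 := hasSum_comp_coeff hA (by simpa using h.summable.hasSum) h.tsum_le_one
        (q := fun i => coeff i ((PowerSeries.mk p) ^ j)) (fun i => coeff_pow_nonneg hP j i)
        (hasSum_coeff_pow_of_nonneg hP (by simpa using hp.hasSum_one) j).summable hz.le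
        (by simpa using h.hasSum z hz.le)
      rw [h1.tsum_eq] at h2
      have h3 := h2.mul_left (z ^ j)
      rw [← mul_pow, ← hF] at h3
      rw [← hasSum_nat_add_iff' j]
      rw [Finset.sum_eq_zero (by
        intro i hi
        rw [if_neg (by have := Finset.mem_range.1 hi; omega), zero_mul]), sub_zero]
      convert! h3 using 2 with n
      rw [if_pos (by omega), Nat.add_sub_cancel, pow_add]
      ring
  have := congrFun key n
  split_ifs at this ⊢ with hjn
  · exact_mod_cast this
  · exact_mod_cast this

/-- The cycle lemma formula for the total progeny of a forest, an instance of Lagrange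
inversion. -/
lemma natCast_mul_coeff_pow (hp : CriticalOffspring p) (h : ProgenyLaw p a F) {n : ℕ} :
    ∀ {j : ℕ}, 0 < n → j ≤ n →
      (n : ℝ) * coeff n ((PowerSeries.mk a) ^ j) = j * coeff (n - j) ((PowerSeries.mk p) ^ n) := by
  induction n using Nat.strong_induction_on with
  | _ n ih =>
    intro j hn hj
    rcases Nat.eq_zero_or_pos j with rfl | hj0
    · simp [coeff_one, hn.ne']
    have hlow : ∀ m i, m < i → coeff m ((PowerSeries.mk a) ^ i) = 0 := fun m i hmi => by
      rw [h.coeff_mk_pow hp, if_neg (by omega)]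
    rw [h.coeff_mk_pow hp, if_pos hj]
    obtain ⟨m, rfl⟩ : ∃ m, n = j + m := ⟨n - j, by omega⟩
    rw [Nat.add_sub_cancel_left, tsum_eq_sum (s := Finset.range (m + 1)) fun i hi => by
      rw [hlow m i (by simpa using hi), mul_zero]]
    rcases Nat.eq_zero_or_pos m with rfl | hm
    · simp
    have hm' : (m : ℝ) ≠ 0 := by exact_mod_cast hm.ne'
    -- With `n = j + m`, the factor `m` lets the induction hypothesis at `m < n` replace `m [z^m]
    -- F^i` by `i [u^(m-i)] Φ^m`. The weight `i` turns the sum into a coefficient of `u (Φ^j)' Φ^m`.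
    refine mul_left_cancel₀ hm' ?_
    have e1 : (m : ℝ) * ∑ i ∈ Finset.range (m + 1),
        coeff i ((PowerSeries.mk p) ^ j) * coeff m ((PowerSeries.mk a) ^ i) =
        coeff m (X * PowerSeries.derivative ℝ ((PowerSeries.mk p) ^ j) * (PowerSeries.mk p) ^ m) := by
      rw [PowerSeries.coeff_mul, Finset.Nat.sum_antidiagonal_eq_sum_range_succ_mk, Finset.mul_sum]
      refine Finset.sum_congr rfl fun i hi => ?_
      have him : i ≤ m := by have := Finset.mem_range.1 hi; omega
      rw [mul_left_comm, ih m (by omega) hm him]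
      cases i with
      | zero => simp
      | succ i =>
        rw [coeff_succ_X_mul, coeff_derivative]
        push_cast
        ring
    -- Both sides equal `j (j + m) u Φ^(j+m-1) Φ'`.
    have e2 : ((j + m : ℕ) : ℝ⟦X⟧) * (X * PowerSeries.derivative ℝ ((PowerSeries.mk p) ^ j) * (PowerSeries.mk p) ^ m) =
        (j : ℝ⟦X⟧) * (X * PowerSeries.derivative ℝ ((PowerSeries.mk p) ^ (j + m))) := by
      rw [Derivation.leibniz_pow, Derivation.leibniz_pow]
      obtain ⟨j, rfl⟩ := Nat.exists_eq_add_of_lt hj0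
      simp only [nsmul_eq_mul, smul_eq_mul]
      rw [show 0 + j + 1 - 1 = j by omega, show 0 + j + 1 + m - 1 = j + m by omega, pow_add]
      ring
    have e3 := congrArg (coeff m) e2
    rw [← map_natCast (C (R := ℝ)), ← map_natCast (C (R := ℝ)), coeff_C_mul, coeff_C_mul] at e3
    calc (m : ℝ) * (((j + m : ℕ) : ℝ) * ∑ i ∈ Finset.range (m + 1),
        coeff i ((PowerSeries.mk p) ^ j) * coeff m ((PowerSeries.mk a) ^ i))
        = ((j + m : ℕ) : ℝ) * (m * ∑ i ∈ Finset.range (m + 1),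
            coeff i ((PowerSeries.mk p) ^ j) * coeff m ((PowerSeries.mk a) ^ i)) := by ring
      _ = j * coeff m (X * PowerSeries.derivative ℝ ((PowerSeries.mk p) ^ (j + m))) := by rw [e1, e3]
      _ = m * (j * coeff m ((PowerSeries.mk p) ^ (j + m))) := by
          obtain ⟨m, rfl⟩ := Nat.exists_eq_add_of_lt hm
          rw [zero_add, coeff_succ_X_mul, coeff_derivative]
          push_cast
          ring

lemma natCast_mul_eq_coeff (hp : CriticalOffspring p) (h : ProgenyLaw p a F) {n : ℕ} (hn : 0 < n) :
    (n : ℝ) * a n = coeff (n - 1) ((PowerSeries.mk p) ^ n) := by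
  simpa using h.natCast_mul_coeff_pow hp (j := 1) hn hn

lemma apply_zero (hp : CriticalOffspring p) (h : ProgenyLaw p a F) : a 0 = 0 := by
  simpa using h.coeff_mk_pow hp 1 0

end ProgenyLaw

end GaltonWatson

/-! ### The characteristic function, the span, and Fourier coefficients. -/

namespace GaltonWatson

/-- The characteristic function `∑ p k e^{ikt}`. -/
noncomputable def charSeries (p : ℕ → ℝ) (t : ℝ) : ℂ :=
  ∑' k, (p k : ℂ) * Complex.exp (t * Complex.I) ^ k

lemma norm_mul_exp_pow {p : ℕ → ℝ} (hp : ∀ k, 0 ≤ p k) (t : ℝ) (k : ℕ) :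
    ‖(p k : ℂ) * Complex.exp (t * Complex.I) ^ k‖ = p k := by
  rw [norm_mul, norm_pow, Complex.norm_exp_ofReal_mul_I, one_pow, mul_one, Complex.norm_real,
    Real.norm_of_nonneg (hp k)]

namespace CriticalOffspring

variable {p : ℕ → ℝ}

lemma hasSum_charSeries (hp : CriticalOffspring p) (t : ℝ) :
    HasSum (fun k => (p k : ℂ) * Complex.exp (t * Complex.I) ^ k) (charSeries p t) :=
  (Summable.of_norm_bounded hp.hasSum_one.summable
    fun k => (norm_mul_exp_pow hp.nonneg t k).le).hasSum

lemma norm_charSeries_le (hp : CriticalOffspring p) (t : ℝ) : ‖charSeries p t‖ ≤ 1 :=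
  tsum_of_norm_bounded hp.hasSum_one fun k => (norm_mul_exp_pow hp.nonneg t k).le

lemma continuous_charSeries (hp : CriticalOffspring p) : Continuous (charSeries p) :=
  continuous_tsum (fun k => by fun_prop) hp.hasSum_one.summable
    fun k t => (norm_mul_exp_pow hp.nonneg t k).le

/-- The terms with indices `0` and `k` are isolated. With `S = p 0 + p k` and `A` the modulus of
their combined contribution, the remaining terms have mass `1 - S`, so `S - A ≤ 1 - ‖charSeries p
t‖`. Moreover `S² - A²` is exactly `p 0 p k |1 - e^{ikt}|²`, and `S + A ≤ 2`. -/
lemma sq_norm_one_sub_le (hp : CriticalOffspring p) {k : ℕ} (hk : k ≠ 0) (t : ℝ) :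
    p 0 * p k * ‖1 - Complex.exp (t * Complex.I) ^ k‖ ^ 2 ≤ 2 * (1 - ‖charSeries p t‖) := by
  set w := Complex.exp (t * Complex.I) ^ k with hw
  have hw1 : ‖w‖ = 1 := by rw [hw, norm_pow, Complex.norm_exp_ofReal_mul_I, one_pow]
  set S := p 0 + p k with hS
  set A := ‖(p 0 : ℂ) + p k * w‖ with hA
  have hSle : S ≤ 1 := by
    have := hp.hasSum_one.summable.sum_le_tsum {0, k} fun i _ => hp.nonneg i
    rwa [Finset.sum_pair hk.symm, hp.hasSum_one.tsum_eq] at this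
  have hAS : A ≤ S := by
    refine (norm_add_le _ _).trans ?_
    rw [norm_mul, hw1, Complex.norm_real, Complex.norm_real, Real.norm_of_nonneg (hp.nonneg _),
      Real.norm_of_nonneg (hp.nonneg _), mul_one]
  have hφ : ‖charSeries p t‖ ≤ A + (1 - S) := by
    have h1 := hp.hasSum_charSeries t
    have h2 := h1.sub (hasSum_sum_of_ne_finset_zero (s := {0, k})
      (f := fun i => if i ∈ ({0, k} : Finset ℕ) then
        (p i : ℂ) * Complex.exp (t * Complex.I) ^ i else 0) fun i hi => if_neg hi)
    have h3 := hp.hasSum_one.sub (hasSum_sum_of_ne_finset_zero (s := {0, k})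
      (f := fun i => if i ∈ ({0, k} : Finset ℕ) then p i else 0) fun i hi => if_neg hi)
    have h4 := tsum_of_norm_bounded h3.summable.hasSum (f := fun i =>
      (p i : ℂ) * Complex.exp (t * Complex.I) ^ i - (if i ∈ ({0, k} : Finset ℕ) then
        (p i : ℂ) * Complex.exp (t * Complex.I) ^ i else 0)) (fun i => by
      split_ifs
      · simp
      · rw [sub_zero, sub_zero, norm_mul_exp_pow hp.nonneg])
    rw [h2.tsum_eq, h3.tsum_eq, Finset.sum_pair hk.symm, Finset.sum_pair hk.symm] at h4
    simp only [Finset.mem_insert, Finset.mem_singleton, true_or, or_true, if_true, pow_zero,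
      mul_one] at h4
    calc ‖charSeries p t‖ = ‖((p 0 : ℂ) + p k * w) + (charSeries p t - (p 0 + p k * w))‖ := by
          congr 1; ring
      _ ≤ A + (1 - S) := (norm_add_le _ _).trans (by gcongr)
  have hsq : S ^ 2 - A ^ 2 = p 0 * p k * ‖1 - w‖ ^ 2 := by
    have hw2 : w.re ^ 2 + w.im ^ 2 = 1 := by
      have := Complex.sq_norm w
      rw [hw1, Complex.normSq_apply] at this
      linarith
    rw [hA, Complex.sq_norm, Complex.sq_norm, Complex.normSq_apply, Complex.normSq_apply]
    simp only [Complex.add_re, Complex.add_im, Complex.mul_re, Complex.mul_im, Complex.ofReal_re,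
      Complex.ofReal_im, Complex.sub_re, Complex.sub_im, Complex.one_re, Complex.one_im]
    linear_combination (-(p k) ^ 2 - p 0 * p k) * hw2
  have hA0 : 0 ≤ A := norm_nonneg _
  nlinarith [mul_nonneg (sub_nonneg.2 hAS) (by linarith : 0 ≤ 2 - (S + A))]

/-- The integers `m` for which `e^{imt}` stays close to `1` wherever the characteristic function
has modulus close to `1`. -/
def periodGroup (p : ℕ → ℝ) : AddSubgroup ℤ where
  carrier := {m | ∃ C : ℝ, ∀ t : ℝ,
    ‖1 - Complex.exp (t * Complex.I) ^ m‖ ^ 2 ≤ C * (1 - ‖charSeries p t‖)}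
  zero_mem' := ⟨0, fun t => by simp⟩
  add_mem' := by
    rintro m n ⟨C, hC⟩ ⟨D, hD⟩
    refine ⟨2 * C + 2 * D, fun t => ?_⟩
    have h1 := hC t
    have h2 := hD t
    set u := Complex.exp (t * Complex.I) with hu
    have hu1 : ‖u‖ = 1 := Complex.norm_exp_ofReal_mul_I t
    have h3 : ‖1 - u ^ (m + n)‖ ≤ ‖1 - u ^ m‖ + ‖1 - u ^ n‖ := by
      rw [zpow_add₀ (Complex.exp_ne_zero _)]
      calc ‖1 - u ^ m * u ^ n‖ = ‖(1 - u ^ m) + u ^ m * (1 - u ^ n)‖ := by congr 1; ring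
        _ ≤ _ := (norm_add_le _ _).trans (by rw [norm_mul, norm_zpow, hu1, one_zpow, one_mul])
    nlinarith [norm_nonneg (1 - u ^ (m + n)), sq_nonneg (‖1 - u ^ m‖ - ‖1 - u ^ n‖),
      norm_nonneg (1 - u ^ m), norm_nonneg (1 - u ^ n)]
  neg_mem' := by
    rintro m ⟨C, hC⟩
    refine ⟨C, fun t => ?_⟩
    have h1 := hC t
    set u := Complex.exp (t * Complex.I) with hu
    have hu1 : ‖u‖ = 1 := Complex.norm_exp_ofReal_mul_I t
    have hum : u ^ m ≠ 0 := zpow_ne_zero _ (Complex.exp_ne_zero _)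
    have h3 : ‖1 - u ^ (-m)‖ = ‖1 - u ^ m‖ := by
      rw [zpow_neg, ← norm_neg (1 - u ^ m)]
      calc ‖1 - (u ^ m)⁻¹‖ = ‖(u ^ m)⁻¹ * -(1 - u ^ m)‖ := by
            congr 1; field_simp; ring
        _ = _ := by rw [norm_mul, norm_inv, norm_zpow, hu1, one_zpow, inv_one, one_mul]
    rwa [h3]

/-- The span of an offspring distribution, together with the resulting bound on the characteristic
function. -/
lemma exists_span (hp : CriticalOffspring p) : ∃ d : ℕ, 0 < d ∧ (∀ k, p k ≠ 0 → d ∣ k) ∧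
    ∃ C : ℝ, ∀ t : ℝ,
      ‖1 - Complex.exp (t * Complex.I) ^ d‖ ^ 2 ≤ C * (1 - ‖charSeries p t‖) := by
  -- The generator is the span. It divides every `k` in the support because such `k` lie in the
  -- group, and it obeys the estimate because it lies in the group itself.
  obtain ⟨b, hb⟩ := Int.subgroup_cyclic (periodGroup p)
  rw [← AddSubgroup.zmultiples_eq_closure] at hb
  have hmem : ∀ k : ℕ, p k ≠ 0 → b ∣ (k : ℤ) := by
    intro k hk
    rw [← Int.mem_zmultiples_iff, ← hb]
    rcases eq_or_ne k 0 with rfl | hk0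
    · exact (periodGroup p).zero_mem
    have h0 : 0 < p 0 * p k := mul_pos hp.zero_pos ((hp.nonneg k).lt_of_ne' hk)
    refine ⟨(p 0 * p k)⁻¹ * 2, fun t => ?_⟩
    rw [zpow_natCast, mul_assoc, ← div_eq_inv_mul, le_div_iff₀' h0]
    exact hp.sq_norm_one_sub_le hk0 t
  refine ⟨b.natAbs, ?_, fun k hk => by simpa using Int.natAbs_dvd_natAbs.2 (hmem k hk), ?_⟩
  · obtain ⟨k, hk, hk0⟩ := hp.exists_two_le
    refine Int.natAbs_pos.2 fun h => ?_
    have := hmem k hk0.ne'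
    rw [h, zero_dvd_iff] at this
    omega
  · have : ((b.natAbs : ℕ) : ℤ) ∈ periodGroup p := by
      rw [hb, Int.mem_zmultiples_iff]
      exact Int.dvd_natAbs_self
    obtain ⟨C, hC⟩ := this
    exact ⟨C, fun t => by simpa only [zpow_natCast] using hC t⟩

/-- Here `|1 - e^{idt}| = 2 |sin (d t / 2)|`, which by concavity of the sine is at least `(2 / π) d
|t|` for `|t| ≤ π / d`. The inequality `1 - s ≤ exp (-s)` then gives the Gaussian bound. -/
lemma exists_norm_charSeries_le_exp (hp : CriticalOffspring p) {d : ℕ} (hd : 0 < d) {C : ℝ}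
    (hC : ∀ t : ℝ,
      ‖1 - Complex.exp (t * Complex.I) ^ d‖ ^ 2 ≤ C * (1 - ‖charSeries p t‖)) :
    ∃ c : ℝ, 0 < c ∧ ∀ t : ℝ, |t| ≤ Real.pi / d → ‖charSeries p t‖ ≤ Real.exp (-c * t ^ 2) := by
  have hd' : (0 : ℝ) < d := by exact_mod_cast hd
  have hpi := Real.pi_pos
  -- The given `C` is not known to be positive.
  set K := max C 1 with hK
  have hK0 : 0 < K := by positivity
  refine ⟨(2 / Real.pi * d) ^ 2 / K, by positivity, fun t ht => ?_⟩
  have h1 : ‖1 - Complex.exp (t * Complex.I) ^ d‖ = 2 * |Real.sin (d * t / 2)| := by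
    rw [← Complex.exp_nat_mul, show (d : ℂ) * (t * Complex.I) = Complex.I * ((d * t : ℝ) : ℂ) by
      push_cast; ring, norm_sub_rev, Complex.norm_exp_I_mul_ofReal_sub_one, norm_mul]
    simp
  have h2 : 2 / Real.pi * |d * t / 2| ≤ |Real.sin (d * t / 2)| := by
    refine Real.mul_abs_le_abs_sin ?_
    rw [abs_div, abs_mul, abs_of_pos hd', abs_two]
    rw [le_div_iff₀ hd'] at ht
    linarith
  have h3 : (2 / Real.pi * d) * |t| ≤ ‖1 - Complex.exp (t * Complex.I) ^ d‖ := by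
    rw [h1]
    rw [abs_div, abs_mul, abs_of_pos hd', abs_two] at h2
    calc _ = 2 * (2 / Real.pi * (d * |t| / 2)) := by ring
      _ ≤ _ := by gcongr
  have h4 : (2 / Real.pi * d) ^ 2 * t ^ 2 ≤ K * (1 - ‖charSeries p t‖) := by
    calc (2 / Real.pi * d) ^ 2 * t ^ 2 = ((2 / Real.pi * d) * |t|) ^ 2 := by
          rw [mul_pow, mul_pow, sq_abs, mul_pow]
      _ ≤ ‖1 - Complex.exp (t * Complex.I) ^ d‖ ^ 2 := by gcongr
      _ ≤ C * (1 - ‖charSeries p t‖) := hC t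
      _ ≤ _ := by
          gcongr
          · exact sub_nonneg.2 (hp.norm_charSeries_le t)
          · exact le_max_left _ _
  have h5 : (2 / Real.pi * d) ^ 2 / K * t ^ 2 ≤ 1 - ‖charSeries p t‖ := by
    rw [div_mul_eq_mul_div, div_le_iff₀ hK0]
    linarith
  have h6 := Real.add_one_le_exp (-((2 / Real.pi * d) ^ 2 / K) * t ^ 2)
  linarith

end CriticalOffspring

open PowerSeries in
lemma coeff_eq_integral {b : ℕ → ℝ} (hb : Summable fun n => ‖b n‖) {g : ℝ → ℂ}
    (hg : ∀ t : ℝ, HasSum (fun n => (b n : ℂ) * Complex.exp (t * Complex.I) ^ n) (g t)) (l : ℕ) :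
    ∫ t in -Real.pi..Real.pi, g t * Complex.exp (-(l * t * Complex.I)) = 2 * Real.pi * b l := by
  have hpi := Real.pi_pos
  have key : ∀ n : ℕ, ∫ t in -Real.pi..Real.pi,
      (b n : ℂ) * Complex.exp (t * Complex.I) ^ n * Complex.exp (-(l * t * Complex.I)) =
      if n = l then (2 * Real.pi * b l : ℂ) else 0 := by
    intro n
    have h1 : ∀ t : ℝ, (b n : ℂ) * Complex.exp (t * Complex.I) ^ n *
        Complex.exp (-(l * t * Complex.I)) = b n * Complex.exp (((n : ℂ) - l) * Complex.I * t) := by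
      intro t
      rw [← Complex.exp_nat_mul, mul_assoc, ← Complex.exp_add]
      congr 2
      ring
    simp_rw [h1]
    rw [intervalIntegral.integral_const_mul]
    split_ifs with h
    · subst h
      simp
      ring
    · have h2 : ((n : ℂ) - l) * Complex.I ≠ 0 :=
        mul_ne_zero (sub_ne_zero.2 (by exact_mod_cast h)) Complex.I_ne_zero
      rw [integral_exp_mul_complex h2]
      have h3 : Complex.exp (((n : ℂ) - l) * Complex.I * (Real.pi : ℝ)) =
          Complex.exp (((n : ℂ) - l) * Complex.I * ((-Real.pi : ℝ) : ℂ)) := by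
        rw [Complex.exp_eq_exp_iff_exists_int]
        refine ⟨(n : ℤ) - l, ?_⟩
        push_cast
        ring
      rw [h3, sub_self, zero_div, mul_zero]
  have h1 : HasSum (fun n => ∫ t in -Real.pi..Real.pi,
      (b n : ℂ) * Complex.exp (t * Complex.I) ^ n * Complex.exp (-(l * t * Complex.I)))
      (∫ t in -Real.pi..Real.pi, g t * Complex.exp (-(l * t * Complex.I))) := by
    refine intervalIntegral.hasSum_integral_of_dominated_convergence (fun n _ => ‖b n‖)
      (fun n => Continuous.aestronglyMeasurable (by fun_prop)) (fun n => ?_)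
      (Filter.Eventually.of_forall fun t _ => hb) (by simp)
      (Filter.Eventually.of_forall fun t _ => (hg t).mul_right _)
    refine Filter.Eventually.of_forall fun t _ => ?_
    rw [norm_mul, norm_mul, norm_pow, Complex.norm_exp_ofReal_mul_I, one_pow, mul_one,
      Complex.norm_real, show -((l : ℂ) * t * Complex.I) = ((-(l * t) : ℝ) : ℂ) * Complex.I by
        push_cast; ring, Complex.norm_exp_ofReal_mul_I, mul_one]
  simp_rw [key] at h1
  exact h1.unique (by simpa using hasSum_ite_eq l (2 * Real.pi * b l : ℂ))

end GaltonWatson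

/-! ### The central limit theorem and the Fourier formula for the total progeny. -/

namespace GaltonWatson

open Filter Topology

lemma charSeries_eq_integral (ν : Measure ℕ) [IsProbabilityMeasure ν] (t : ℝ) :
    charSeries (fun k => ν.real {k}) t = ∫ k : ℕ, Complex.exp (t * Complex.I) ^ k ∂ν := by
  have hI : Integrable (fun k : ℕ => Complex.exp (t * Complex.I) ^ k) ν := by
    refine Integrable.of_bound (measurable_of_countable _).aestronglyMeasurable 1
      (Eventually.of_forall fun k => ?_)
    rw [norm_pow, Complex.norm_exp_ofReal_mul_I, one_pow]
  have h := hasSum_integral_measure (μ := fun k : ℕ => ν {k} • Measure.dirac k)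
    (f := fun k : ℕ => Complex.exp (t * Complex.I) ^ k) (by rwa [Measure.sum_smul_dirac])
  rw [Measure.sum_smul_dirac] at h
  rw [← h.tsum_eq, charSeries]
  simp [integral_smul_measure, measureReal_def]

/-- This is the central limit theorem for the normalised variable `(k - 1) / √v`, evaluated at `√v *
s`; the factor `exp (-i r)` accounts for centring at the mean `1`. -/
lemma exists_tendsto_charSeries_pow {ν : Measure ℕ} [IsProbabilityMeasure ν]
    (hmean : ∫ k, (k : ℝ) ∂ν = 1) (hL2 : MemLp (fun k : ℕ => (k : ℝ)) 2 ν)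
    (hvar : 0 < variance (fun k : ℕ => (k : ℝ)) ν) :
    ∃ v : ℝ, 0 < v ∧ ∀ s : ℝ, Tendsto (fun n : ℕ =>
      (charSeries (fun k => ν.real {k}) ((√n)⁻¹ * s) *
        Complex.exp (-(((√n)⁻¹ * s : ℝ) * Complex.I))) ^ n) atTop
      (𝓝 (Complex.exp (-(v * s ^ 2 / 2 : ℝ)))) := by
  set v := variance (fun k : ℕ => (k : ℝ)) ν with hv
  have hint : Integrable (fun k : ℕ => (k : ℝ)) ν := hL2.integrable (by norm_num)
  have hv0 : √v ≠ 0 := (Real.sqrt_pos.2 hvar).ne'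
  set X : ℕ → ℝ := fun k => ((k : ℝ) - 1) / √v with hX
  have h0 : ∫ k, X k ∂ν = 0 := by
    simp only [hX]
    rw [integral_div, integral_sub hint (integrable_const _), hmean]
    simp
  have h1 : ∫ k, (X ^ 2) k ∂ν = 1 := by
    simp only [hX, Pi.pow_apply, div_pow]
    rw [integral_div, Real.sq_sqrt hvar.le, hv, variance_eq_integral hL2.aemeasurable, hmean,
      div_self]
    rw [← hmean, ← variance_eq_integral hL2.aemeasurable]
    exact hvar.ne'
  refine ⟨v, hvar, fun s => ?_⟩
  have h2 := tendsto_charFun_inv_sqrt_mul_pow (X := X) (P := ν)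
    (measurable_of_countable X).aemeasurable h0 h1 (√v * s)
  have h3 : ∀ r : ℝ, charFun (ν.map X) (√v * r) =
      charSeries (fun k => ν.real {k}) r * Complex.exp (-(r * Complex.I)) := by
    intro r
    rw [charFun_apply_real, integral_map (measurable_of_countable X).aemeasurable
      (Continuous.aestronglyMeasurable (by fun_prop)), charSeries_eq_integral, ← integral_mul_const]
    congr 1
    funext k
    rw [← Complex.exp_nat_mul, ← Complex.exp_add]
    congr 1
    simp only [hX]
    push_cast
    have : (√v : ℂ) ≠ 0 := by exact_mod_cast hv0
    field_simp
    ring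
  convert! h2 using 2
  · rw [← h3]
    congr 2
    ring
  · congr 1
    push_cast
    have hq : ((√v : ℝ) : ℂ) ^ 2 = v := by exact_mod_cast Real.sq_sqrt hvar.le
    rw [mul_pow, hq]
    ring

namespace ProgenyLaw

variable {p a : ℕ → ℝ} {F : ℂ → ℂ}

lemma dvd_of_coeff_pow_ne_zero {d : ℕ} (hd : ∀ k, p k ≠ 0 → d ∣ k) (m n : ℕ)
    (h : PowerSeries.coeff n ((PowerSeries.mk p) ^ m) ≠ 0) : d ∣ n := by
  induction m generalizing n with
  | zero =>
    rw [pow_zero, PowerSeries.coeff_one] at h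
    have : n = 0 := by
      by_contra h'
      exact h (if_neg h')
    simp [this]
  | succ m ih =>
    rw [pow_succ, PowerSeries.coeff_mul] at h
    obtain ⟨kl, hkl, hne⟩ := Finset.exists_ne_zero_of_sum_ne_zero h
    rw [← Finset.HasAntidiagonal.mem_antidiagonal.1 hkl]
    refine dvd_add (ih _ (left_ne_zero_of_mul hne)) (hd _ ?_)
    simpa using right_ne_zero_of_mul hne

lemma dvd_of_ne_zero (hp : CriticalOffspring p) (h : ProgenyLaw p a F) {d : ℕ}
    (hd : ∀ k, p k ≠ 0 → d ∣ k) {n : ℕ} (hn : 0 < n) (ha : a n ≠ 0) : d ∣ n - 1 := by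
  refine dvd_of_coeff_pow_ne_zero hd n _ ?_
  rw [← h.natCast_mul_eq_coeff hp hn]
  exact mul_ne_zero (by exact_mod_cast hn.ne') ha

/-- The left side is a coefficient of `Φ^n` of index `n - 1`. Writing `-(n - 1) = -n + 1` provides
one centring factor for each of the `n` characteristic functions and leaves a single `e^{it}`. -/
lemma mul_eq_integral (hp : CriticalOffspring p) (h : ProgenyLaw p a F) {n : ℕ} (hn : 0 < n) :
    (2 * Real.pi * (n * a n : ℝ) : ℂ) = ∫ t in -Real.pi..Real.pi,
      (charSeries p t * Complex.exp (-(t * Complex.I))) ^ n * Complex.exp (t * Complex.I) := by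
  have hP : ∀ n, 0 ≤ PowerSeries.coeff n (PowerSeries.mk p) := fun n => by simpa using hp.nonneg n
  have hs := (hasSum_coeff_pow_of_nonneg hP (by simpa using hp.hasSum_one) n).summable
  have h1 := coeff_eq_integral (b := fun l => PowerSeries.coeff l ((PowerSeries.mk p) ^ n))
    (g := fun t => charSeries p t ^ n) (hs.congr fun l => by
      rw [Real.norm_of_nonneg (coeff_pow_nonneg hP n l)]) (fun t => by
      refine (hasSum_coeff_pow (A := PowerSeries.mk p) ?_ (by
        simpa using hp.hasSum_charSeries t) n).2
      refine hp.hasSum_one.summable.congr fun k => ?_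
      rw [PowerSeries.coeff_mk, norm_mul_exp_pow hp.nonneg]) (n - 1)
  rw [h.natCast_mul_eq_coeff hp hn, ← h1]
  refine intervalIntegral.integral_congr fun t _ => ?_
  rw [mul_pow, mul_assoc (charSeries p t ^ n), ← Complex.exp_nat_mul, ← Complex.exp_add]
  congr 2
  push_cast [Nat.cast_sub hn]
  ring

/-- The support lies in the multiples of `d` and `d ∣ n - 1`, so the integrand has period `2π / d`.
One period around `0` suffices, and there the Gaussian bound holds. -/
lemma mul_eq_span_integral (hp : CriticalOffspring p) (h : ProgenyLaw p a F) {d : ℕ} (hd0 : 0 < d)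
    (hd : ∀ k, p k ≠ 0 → d ∣ k) {n : ℕ} (hn : 0 < n) (hdn : d ∣ n - 1) :
    (2 * Real.pi * (n * a n : ℝ) : ℂ) = d * ∫ t in -(Real.pi / d)..Real.pi / d,
      (charSeries p t * Complex.exp (-(t * Complex.I))) ^ n * Complex.exp (t * Complex.I) := by
  have hd' : (d : ℝ) ≠ 0 := by exact_mod_cast hd0.ne'
  have hdC : (d : ℂ) ≠ 0 := by exact_mod_cast hd0.ne'
  set f : ℝ → ℂ := fun t =>
    (charSeries p t * Complex.exp (-(t * Complex.I))) ^ n * Complex.exp (t * Complex.I) with hf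
  have hexp : ∀ (t : ℝ) (k : ℕ), d ∣ k →
      Complex.exp ((t + 2 * Real.pi / d : ℝ) * Complex.I) ^ k = Complex.exp (t * Complex.I) ^ k := by
    rintro t _ ⟨j, rfl⟩
    rw [← Complex.exp_nat_mul, ← Complex.exp_nat_mul, Complex.exp_eq_exp_iff_exists_int]
    refine ⟨j, ?_⟩
    push_cast
    field_simp
    try ring
  have hfe : ∀ t : ℝ, f t = charSeries p t ^ n * (Complex.exp (t * Complex.I) ^ (n - 1))⁻¹ := by
    intro t
    simp only [hf]
    rw [mul_pow, mul_assoc, ← Complex.exp_nat_mul, ← Complex.exp_nat_mul, ← Complex.exp_add,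
      ← Complex.exp_neg]
    congr 2
    push_cast [Nat.cast_sub hn]
    ring
  have hper : Function.Periodic f (2 * Real.pi / d) := by
    intro t
    rw [hfe, hfe, hexp t _ hdn]
    congr 2
    refine tsum_congr fun k => ?_
    by_cases hk : p k = 0
    · simp [hk]
    · rw [hexp t k (hd k hk)]
  have hcont : Continuous f := by
    have := hp.continuous_charSeries
    fun_prop
  rw [h.mul_eq_integral hp hn]
  have h1 := hper.intervalIntegral_add_zsmul_eq (d : ℤ) (-Real.pi)
    fun _ _ => hcont.intervalIntegrable _ _
  have h2 := hper.intervalIntegral_add_eq (-Real.pi) (-(Real.pi / d))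
  rw [h2] at h1
  have e1 : -Real.pi + (d : ℤ) • (2 * Real.pi / d) = Real.pi := by
    simp only [natCast_zsmul, nsmul_eq_mul]
    field_simp
    ring
  have e2 : -(Real.pi / d) + 2 * Real.pi / d = Real.pi / d := by ring
  rw [e1, e2] at h1
  rw [h1]
  simp

end ProgenyLaw

end GaltonWatson

/-! ### The local limit theorem for the total progeny. -/

namespace GaltonWatson

open Filter Topology

lemma exists_pos_forall_le {ι : Type*} {s : Finset ι} {f : ι → ℝ} (hf : ∀ i ∈ s, 0 < f i) :
    ∃ c, 0 < c ∧ ∀ i ∈ s, c ≤ f i := by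
  rcases s.eq_empty_or_nonempty with rfl | hs
  · exact ⟨1, one_pos, by simp⟩
  · obtain ⟨i, hi, h⟩ := s.exists_min_image f hs
    exact ⟨f i, hf i hi, h⟩

/-- The rescaled Fourier integral in the local limit theorem. -/
noncomputable def rescaledIntegral (p : ℕ → ℝ) (d n : ℕ) : ℂ :=
  ∫ s : ℝ, (Set.Ioc (-(√n * (Real.pi / d))) (√n * (Real.pi / d))).indicator (fun s : ℝ =>
    (charSeries p ((√n)⁻¹ * s) * Complex.exp (-(((√n)⁻¹ * s : ℝ) * Complex.I))) ^ n *
      Complex.exp (((√n)⁻¹ * s : ℝ) * Complex.I)) s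

variable {p a : ℕ → ℝ} {F : ℂ → ℂ}

lemma ProgenyLaw.mul_eq_rescaledIntegral (hp : CriticalOffspring p) (h : ProgenyLaw p a F) {d : ℕ}
    (hd0 : 0 < d) (hd : ∀ k, p k ≠ 0 → d ∣ k) {n : ℕ} (hn : 0 < n) (hdn : d ∣ n - 1) :
    ((2 * Real.pi * (a n * (n * √n)) : ℝ) : ℂ) = d * rescaledIntegral p d n := by
  have hn' : (0 : ℝ) < n := by exact_mod_cast hn
  have hs : 0 < √(n : ℝ) := Real.sqrt_pos.2 hn'
  have h1 := h.mul_eq_span_integral hp hd0 hd hn hdn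
  have h2 := intervalIntegral.integral_comp_mul_left (a := -(√n * (Real.pi / d)))
    (b := √n * (Real.pi / d)) (fun t : ℝ =>
      (charSeries p t * Complex.exp (-(t * Complex.I))) ^ n * Complex.exp (t * Complex.I))
    (inv_ne_zero hs.ne')
  rw [mul_neg, inv_mul_cancel_left₀ hs.ne', inv_inv, intervalIntegral.integral_of_le
    (by have := Real.pi_pos; rw [neg_le_self_iff]; positivity),
    ← integral_indicator measurableSet_Ioc] at h2
  rw [rescaledIntegral, h2, Complex.real_smul, mul_left_comm (d : ℂ), ← h1]
  push_cast
  ring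

/-- Dominated convergence: after rescaling, the Gaussian bound on the characteristic function
becomes `exp (-c s²)` for every positive `n`, and each fixed `s` eventually lies in the window of
integration. -/
lemma tendsto_rescaledIntegral (hp : CriticalOffspring p) {d : ℕ} (hd0 : 0 < d) {c v : ℝ}
    (hc : 0 < c) (hbound : ∀ t : ℝ, |t| ≤ Real.pi / d → ‖charSeries p t‖ ≤ Real.exp (-c * t ^ 2))
    (hlim : ∀ s : ℝ, Tendsto (fun n : ℕ => (charSeries p ((√n)⁻¹ * s) *
        Complex.exp (-(((√n)⁻¹ * s : ℝ) * Complex.I))) ^ n) atTop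
      (𝓝 (Complex.exp (-(v * s ^ 2 / 2 : ℝ))))) :
    Tendsto (rescaledIntegral p d) atTop (𝓝 ((√(Real.pi / (v / 2)) : ℝ) : ℂ)) := by
  have hd' : (0 : ℝ) < d := by exact_mod_cast hd0
  have hpi := Real.pi_pos
  have hG : ((√(Real.pi / (v / 2)) : ℝ) : ℂ) = ∫ s : ℝ, Complex.exp (-(v * s ^ 2 / 2 : ℝ)) := by
    rw [← integral_gaussian, ← integral_complex_ofReal]
    congr 1
    funext s
    push_cast
    congr 1
    ring
  rw [hG]
  have hsqrt : Tendsto (fun n : ℕ => √(n : ℝ)) atTop atTop :=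
    Real.tendsto_sqrt_atTop.comp tendsto_natCast_atTop_atTop
  refine tendsto_integral_filter_of_dominated_convergence (fun s => Real.exp (-c * s ^ 2)) ?_ ?_
    (integrable_exp_neg_mul_sq hc) ?_
  · refine Eventually.of_forall fun n => ?_
    refine (Continuous.aestronglyMeasurable ?_).indicator measurableSet_Ioc
    have := hp.continuous_charSeries
    fun_prop
  · filter_upwards [eventually_gt_atTop 0] with n hn
    refine Eventually.of_forall fun s => ?_
    have hn' : (0 : ℝ) < n := by exact_mod_cast hn
    have hs : 0 < √(n : ℝ) := Real.sqrt_pos.2 hn'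
    by_cases hmem : s ∈ Set.Ioc (-(√n * (Real.pi / d))) (√n * (Real.pi / d))
    · rw [Set.indicator_of_mem hmem, norm_mul, Complex.norm_exp_ofReal_mul_I, mul_one, norm_pow,
        norm_mul, ← neg_mul, ← Complex.ofReal_neg, Complex.norm_exp_ofReal_mul_I, mul_one]
      have h1 : |(√n)⁻¹ * s| ≤ Real.pi / d := by
        rw [abs_mul, abs_of_pos (inv_pos.2 hs), inv_mul_le_iff₀ hs]
        exact abs_le.2 ⟨hmem.1.le, hmem.2⟩
      calc ‖charSeries p ((√n)⁻¹ * s)‖ ^ n ≤ Real.exp (-c * ((√n)⁻¹ * s) ^ 2) ^ n := by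
            gcongr
            exact hbound _ h1
        _ = Real.exp (-c * s ^ 2) := by
            rw [← Real.exp_nat_mul, mul_pow, inv_pow, Real.sq_sqrt hn'.le]
            congr 1
            field_simp
    · rw [Set.indicator_of_notMem hmem, norm_zero]
      positivity
  · refine Eventually.of_forall fun s => ?_
    have h1 : Tendsto (fun n : ℕ => Complex.exp (((√n)⁻¹ * s : ℝ) * Complex.I)) atTop (𝓝 1) := by
      have h2 : Tendsto (fun n : ℕ => (√(n : ℝ))⁻¹ * s) atTop (𝓝 0) := by
        simpa using (tendsto_inv_atTop_zero.comp hsqrt).mul_const s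
      have h3 : Continuous fun r : ℝ => Complex.exp (r * Complex.I) := by fun_prop
      have h5 := (h3.tendsto 0).comp h2
      rw [Complex.ofReal_zero, zero_mul, Complex.exp_zero] at h5
      exact h5
    have h4 := (hlim s).mul h1
    rw [mul_one] at h4
    refine h4.congr' ?_
    have h5 := hsqrt.eventually_gt_atTop (|s| / (Real.pi / d))
    filter_upwards [h5] with n hn
    rw [div_lt_iff₀ (by positivity), abs_lt] at hn
    rw [Set.indicator_of_mem
      (show s ∈ Set.Ioc (-(√n * (Real.pi / d))) (√n * (Real.pi / d)) from ⟨hn.1, hn.2.le⟩)]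

/-- Local limit bounds for the total progeny. -/
lemma ProgenyLaw.exists_bounds (hp : CriticalOffspring p) (h : ProgenyLaw p a F) {v : ℝ}
    (hv : 0 < v) (hlim : ∀ s : ℝ, Tendsto (fun n : ℕ => (charSeries p ((√n)⁻¹ * s) *
        Complex.exp (-(((√n)⁻¹ * s : ℝ) * Complex.I))) ^ n) atTop
      (𝓝 (Complex.exp (-(v * s ^ 2 / 2 : ℝ))))) :
    ∃ (d N : ℕ) (c C : ℝ), 0 < d ∧ (∀ k, p k ≠ 0 → d ∣ k) ∧ (∀ n, a n ≠ 0 → d ∣ n - 1) ∧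
      0 < c ∧ 0 < C ∧ (∀ n, a n * (n * √n) ≤ C) ∧ (∀ n, a n ≠ 0 → c ≤ a n * (n * √n)) ∧
      ∀ m, N ≤ m → c ≤ a (1 + d * m) * ((1 + d * m : ℕ) * √(1 + d * m : ℕ)) := by
  obtain ⟨d, hd0, hd, C₀, hC₀⟩ := hp.exists_span
  obtain ⟨c₀, hc₀, hbound⟩ := hp.exists_norm_charSeries_le_exp hd0 hC₀
  have hd' : (0 : ℝ) < d := by exact_mod_cast hd0
  have hpi := Real.pi_pos
  have ht := (tendsto_rescaledIntegral hp hd0 hc₀ hbound hlim).norm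
  set L := ‖((√(Real.pi / (v / 2)) : ℝ) : ℂ)‖ with hL
  have hL0 : 0 < L := by
    rw [hL, Complex.norm_real, norm_pos_iff]
    positivity
  have heq : ∀ n, 0 < n → d ∣ n - 1 →
      a n * (n * √n) = d * ‖rescaledIntegral p d n‖ / (2 * Real.pi) := by
    intro n hn hdn
    have h1 := congrArg norm (h.mul_eq_rescaledIntegral hp hd0 hd hn hdn)
    have h0 := h.nonneg n
    rw [Complex.norm_real, Real.norm_of_nonneg (by positivity), norm_mul, Complex.norm_natCast] at h1
    rw [← h1]
    field_simp
  have hdvd : ∀ n, a n ≠ 0 → 0 < n ∧ d ∣ n - 1 := by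
    intro n hn
    have hn0 : 0 < n := by
      refine Nat.pos_of_ne_zero fun h0 => hn ?_
      rw [h0, h.apply_zero hp]
    exact ⟨hn0, h.dvd_of_ne_zero hp hd hn0 hn⟩
  obtain ⟨N, hN⟩ := eventually_atTop.1 (ht.eventually_const_lt (half_lt_self hL0))
  obtain ⟨B, hB⟩ := ht.bddAbove_range
  -- The limit gives a lower bound only from `N` on; the finitely many smaller sizes of positive
  -- probability supply a second constant.
  obtain ⟨c₂, hc₂, hc₂'⟩ := exists_pos_forall_le
    (f := fun n => a n * (n * √n)) (s := {n ∈ Finset.range N | a n ≠ 0}) (fun n hn => by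
      have hn2 := (Finset.mem_filter.1 hn).2
      have hn0 : (0 : ℝ) < n := by exact_mod_cast (hdvd n hn2).1
      have := (h.nonneg n).lt_of_ne' hn2
      positivity)
  set c₁ := d * (L / 2) / (2 * Real.pi) with hc₁
  have hc₁0 : 0 < c₁ := by positivity
  have hlarge : ∀ n, N ≤ n → 0 < n → d ∣ n - 1 → c₁ ≤ a n * (n * √n) := by
    intro n hn hn0 hdn
    rw [heq n hn0 hdn, hc₁]
    gcongr
    exact (hN n hn).le
  refine ⟨d, N, min c₁ c₂, max (d * B / (2 * Real.pi)) 1, hd0, hd, fun n hn => (hdvd n hn).2,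
    lt_min hc₁0 hc₂, by positivity, fun n => ?_, fun n hn => ?_, fun m hm => ?_⟩
  · by_cases hn : a n = 0
    · simp [hn]
    · rw [heq n (hdvd n hn).1 (hdvd n hn).2]
      refine le_trans ?_ (le_max_left _ _)
      gcongr
      exact hB ⟨n, rfl⟩
  · rcases Nat.lt_or_ge n N with hnN | hnN
    · exact (min_le_right _ _).trans
        (hc₂' n (Finset.mem_filter.2 ⟨Finset.mem_range.2 hnN, hn⟩))
    · exact (min_le_left _ _).trans (hlarge n hnN (hdvd n hn).1 (hdvd n hn).2)
  · refine (min_le_left _ _).trans (hlarge _ ?_ (by omega) (by simp))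
    nlinarith

end GaltonWatson

/-! ### Power series with coefficients of order `m ^ (-3/2)`. -/

namespace GaltonWatson

lemma norm_one_sub_pow_le {u : ℂ} (hu : ‖u‖ ≤ 1) (n : ℕ) : ‖1 - u ^ n‖ ≤ n * ‖1 - u‖ := by
  induction n with
  | zero => simp
  | succ n ih =>
    calc ‖1 - u ^ (n + 1)‖ = ‖(1 - u ^ n) + u ^ n * (1 - u)‖ := by congr 1; ring
      _ ≤ ‖1 - u ^ n‖ + ‖u‖ ^ n * ‖1 - u‖ := (norm_add_le _ _).trans (by rw [norm_mul, norm_pow])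
      _ ≤ n * ‖1 - u‖ + 1 * ‖1 - u‖ := by
          gcongr
          exact pow_le_one₀ (norm_nonneg _) hu
      _ = (n + 1 : ℕ) * ‖1 - u‖ := by push_cast; ring

lemma norm_one_sub_le_two {u : ℂ} (hu : ‖u‖ ≤ 1) : ‖1 - u‖ ≤ 2 := by
  refine (norm_sub_le _ _).trans ?_
  rw [norm_one]
  linarith

/-- If `b m` is at least of order `m ^ (-3/2)`, then the modulus of `∑ b m ζ ^ m` stays away from
`1` by at least the order of `√|1 - ζ|`. -/
lemma exists_norm_tsum_le {b : ℕ → ℝ} {N : ℕ} {c : ℝ} (hb : ∀ m, 0 ≤ b m) (hs : Summable b)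
    (hs1 : ∑' m, b m ≤ 1) (hc : 0 < c) (hlow : ∀ m, N ≤ m → c ≤ b m * (m * √m)) :
    ∃ κ : ℝ, 0 < κ ∧ ∀ ζ : ℂ, ‖ζ‖ < 1 →
      κ * √‖1 - ζ‖ ≤ 1 - ‖∑' m, (b m : ℂ) * ζ ^ m‖ := by
  -- With `M ≥ K / ε` and `ε ≤ 2`, the bound `2 * N` places the block `[M, 2M)` beyond `N`, and the
  -- bound `4` makes its geometric sum at most half the number of its terms.
  set K : ℝ := max (2 * N) 4 with hK
  have hK4 : 4 ≤ K := le_max_right _ _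
  refine ⟨c / (4 * √(2 * (K + 2))), by positivity, fun ζ hζ => ?_⟩
  set ε := ‖1 - ζ‖ with hε
  have hε0 : 0 < ε := by
    rw [hε, norm_pos_iff, sub_ne_zero]
    rintro rfl
    simp at hζ
  have hε2 : ε ≤ 2 := norm_one_sub_le_two hζ.le
  set M := ⌈K / ε⌉₊ with hM
  have hM1 : K / ε ≤ M := Nat.le_ceil _
  have hM2 : (M : ℝ) ≤ (K + 2) / ε := by
    refine (Nat.ceil_lt_add_one (by positivity)).le.trans ?_
    rw [add_div]
    gcongr
    rwa [le_div_iff₀ hε0, one_mul]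
  have hMε : 4 ≤ M * ε := by
    rw [div_le_iff₀ hε0] at hM1
    linarith
  have hM0 : (0 : ℝ) < M := by
    by_contra h
    nlinarith
  have hMN : N ≤ M := by
    have : (N : ℝ) ≤ M := by
      refine le_trans ?_ hM1
      rw [le_div_iff₀ hε0]
      have : (2 * N : ℝ) ≤ K := le_max_left _ _
      nlinarith [(Nat.cast_nonneg N : (0 : ℝ) ≤ N)]
    exact_mod_cast this
  -- This is a lower bound for every coefficient of the block. Removing a constant `δ` from them
  -- leaves a series with nonnegative coefficients.
  set δ := c / (2 * M * √(2 * M)) with hδ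
  have hδ0 : 0 < δ := by positivity
  set B := Finset.Ico M (2 * M) with hB
  have hblock : ∀ m ∈ B, δ ≤ b m := by
    intro m hm
    obtain ⟨h1, h2⟩ := Finset.mem_Ico.1 hm
    have h1' : (M : ℝ) ≤ m := by exact_mod_cast h1
    have h2' : (m : ℝ) ≤ 2 * M := by exact_mod_cast h2.le
    have hm0 : (0 : ℝ) < m := hM0.trans_le h1'
    rw [hδ, div_le_iff₀ (by positivity)]
    refine (hlow m (hMN.trans h1)).trans ?_
    gcongr
    exact hb m
  set e : ℕ → ℝ := fun m => if m ∈ B then δ else 0 with he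
  have hcard : B.card = M := by simp [hB]; omega
  have hesum : HasSum e (M * δ) := by
    have : HasSum e _ := hasSum_sum_of_ne_finset_zero (s := B) (f := e) fun m hm => if_neg hm
    rwa [Finset.sum_congr rfl (g := fun _ => δ) (fun m hm => if_pos hm), Finset.sum_const, hcard,
      nsmul_eq_mul] at this
  have heC : HasSum (fun m => (e m : ℂ) * ζ ^ m) (δ * ∑ m ∈ B, ζ ^ m) := by
    have : HasSum (fun m => (e m : ℂ) * ζ ^ m) _ :=
      hasSum_sum_of_ne_finset_zero (s := B) fun m hm => by simp [he, hm]
    rwa [Finset.sum_congr rfl (g := fun m => (δ : ℂ) * ζ ^ m) (fun m hm => by simp [he, hm]),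
      ← Finset.mul_sum] at this
  -- This cancellation is the source of the gain: the constant part has mass `M δ` but modulus at
  -- most `M δ / 2`. The loss `M δ / 2` is of order `M^(-1/2)`, that is `√ε`.
  have hgeom : ‖∑ m ∈ B, ζ ^ m‖ ≤ M / 2 := by
    have h1 : (∑ m ∈ B, ζ ^ m) * (1 - ζ) = ζ ^ M - ζ ^ (2 * M) := by
      have := geom_sum_Ico_mul ζ (show M ≤ 2 * M by omega)
      linear_combination -this
    have h2 : ‖∑ m ∈ B, ζ ^ m‖ * ε ≤ 2 := by
      rw [hε, ← norm_mul, h1]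
      refine (norm_sub_le _ _).trans ?_
      rw [norm_pow, norm_pow]
      have h3 := pow_le_one₀ (n := M) (norm_nonneg ζ) hζ.le
      have h4 := pow_le_one₀ (n := 2 * M) (norm_nonneg ζ) hζ.le
      linarith
    have h3 : ‖∑ m ∈ B, ζ ^ m‖ * ε ≤ M / 2 * ε := by linarith
    exact le_of_mul_le_mul_right h3 hε0
  have hbC : Summable fun m => (b m : ℂ) * ζ ^ m := by
    refine Summable.of_norm_bounded hs fun m => ?_
    rw [norm_mul, norm_pow, Complex.norm_real, Real.norm_of_nonneg (hb m)]
    exact mul_le_of_le_one_right (hb m) (pow_le_one₀ (norm_nonneg _) hζ.le)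
  have hdiff := hbC.hasSum.sub heC
  have hdiffle := tsum_of_norm_bounded (hs.hasSum.sub hesum)
    (f := fun m => (b m : ℂ) * ζ ^ m - (e m : ℂ) * ζ ^ m) fun m => by
      have hnn : 0 ≤ b m - e m := by
        simp only [he]
        split_ifs with hm
        · exact sub_nonneg.2 (hblock m hm)
        · simpa using hb m
      rw [← sub_mul, ← Complex.ofReal_sub, norm_mul, norm_pow, Complex.norm_real,
        Real.norm_of_nonneg hnn]
      exact mul_le_of_le_one_right hnn (pow_le_one₀ (norm_nonneg _) hζ.le)
  rw [hdiff.tsum_eq] at hdiffle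
  have hfin : ‖∑' m, (b m : ℂ) * ζ ^ m‖ ≤ 1 - M * δ / 2 := by
    calc ‖∑' m, (b m : ℂ) * ζ ^ m‖
        = ‖(∑' m, (b m : ℂ) * ζ ^ m - δ * ∑ m ∈ B, ζ ^ m) + δ * ∑ m ∈ B, ζ ^ m‖ := by
          rw [sub_add_cancel]
      _ ≤ (∑' m, b m - M * δ) + δ * (M / 2) := by
          refine (norm_add_le _ _).trans (add_le_add hdiffle ?_)
          rw [norm_mul, Complex.norm_real, Real.norm_of_nonneg hδ0.le]
          gcongr
      _ ≤ 1 - M * δ / 2 := by linarith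
  have hMδ : M * δ / 2 = c / (4 * √(2 * M)) := by
    rw [hδ]
    field_simp
    ring
  have hsq : √(2 * M) * √ε ≤ √(2 * (K + 2)) := by
    rw [← Real.sqrt_mul (by positivity)]
    refine Real.sqrt_le_sqrt ?_
    rw [le_div_iff₀ hε0] at hM2
    linarith
  have hlast : c / (4 * √(2 * (K + 2))) * √ε ≤ M * δ / 2 := by
    rw [hMδ, div_mul_eq_mul_div, div_le_div_iff₀ (by positivity) (by positivity)]
    calc c * √ε * (4 * √(2 * M)) = 4 * c * (√(2 * M) * √ε) := by ring
      _ ≤ 4 * c * √(2 * (K + 2)) := by gcongr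
      _ = _ := by ring
  linarith

lemma sqrt_succ_le {m : ℕ} (hm : 0 < m) : √(m + 1 : ℕ) ≤ 3 / 2 * √m := by
  rw [Real.sqrt_le_left (by positivity), mul_pow, Real.sq_sqrt (by positivity)]
  have : (1 : ℝ) ≤ m := by exact_mod_cast hm
  push_cast
  linarith

/-- If `b m` is at most of order `m ^ (-3/2)`, then `∑ b m (1 - ζ ^ m)` is at most of order
`√|1 - ζ|`. -/
lemma exists_norm_one_sub_tsum_le {b : ℕ → ℝ} {C : ℝ} (hb : ∀ m, 0 ≤ b m) (hs : HasSum b 1)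
    (hup : ∀ m, b m * (m * √m) ≤ C) :
    ∃ K : ℝ, 0 < K ∧ ∀ ζ : ℂ, ‖ζ‖ < 1 → ‖1 - ∑' m, (b m : ℂ) * ζ ^ m‖ ≤ K * √‖1 - ζ‖ := by
  have hC : 0 ≤ C := by simpa using hup 0
  -- The terms are at most `C / √m`, which is compared with a telescoping difference of square
  -- roots; the tail bound below telescopes `1 / √m` in the same way.
  have hhead : ∀ M : ℕ, ∑ m ∈ Finset.range M, b m * m ≤ 3 * C * √M := by
    intro M
    induction M with
    | zero => simp
    | succ M ih =>
      rw [Finset.sum_range_succ]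
      rcases Nat.eq_zero_or_pos M with rfl | hM
      · simpa using hC
      have hM' : (0 : ℝ) < M := by exact_mod_cast hM
      have h1 := sqrt_succ_le hM
      have h2 : 0 < √(M : ℝ) := Real.sqrt_pos.2 hM'
      have h3 : √(M : ℝ) ^ 2 = M := Real.sq_sqrt hM'.le
      have h4 : √((M + 1 : ℕ) : ℝ) ^ 2 = M + 1 := by
        rw [Real.sq_sqrt (by positivity)]
        push_cast
        ring
      have h5 : b M * M ≤ C / √M := by
        rw [le_div_iff₀ h2, mul_assoc]
        exact hup M
      have h6 : C / √M ≤ 3 * C * (√(M + 1 : ℕ) - √M) := by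
        rw [div_le_iff₀ h2]
        have h7 : 1 ≤ 3 * (√((M + 1 : ℕ) : ℝ) - √M) * √M := by
          have h8 : √(M : ℝ) ≤ √((M + 1 : ℕ) : ℝ) := Real.sqrt_le_sqrt (by push_cast; linarith)
          nlinarith [mul_nonneg (sub_nonneg.2 h8) (sub_nonneg.2 h1)]
        nlinarith
      linarith
  have htail : ∀ M n : ℕ, 0 < M →
      ∑ i ∈ Finset.range n, b (i + M) ≤ 4 * C * (1 / √M - 1 / √(n + M : ℕ)) := by
    intro M n hM
    induction n with
    | zero => simp
    | succ n ih =>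
      rw [Finset.sum_range_succ]
      set k := n + M with hk
      have hk0 : 0 < k := by omega
      have hk' : (0 : ℝ) < k := by exact_mod_cast hk0
      rw [show n + 1 + M = k + 1 by omega]
      have h1 := sqrt_succ_le hk0
      have h2 : 0 < √(k : ℝ) := Real.sqrt_pos.2 hk'
      have h2' : 0 < √((k + 1 : ℕ) : ℝ) := Real.sqrt_pos.2 (by positivity)
      have h3 : √(k : ℝ) ^ 2 = k := Real.sq_sqrt hk'.le
      have h4 : √((k + 1 : ℕ) : ℝ) ^ 2 = k + 1 := by
        rw [Real.sq_sqrt (by positivity)]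
        push_cast
        ring
      have h5 : b k ≤ C / (k * √k) := by
        rw [le_div_iff₀ (by positivity)]
        exact hup k
      have h6 : 1 / (k * √k) ≤ 4 * (1 / √k - 1 / √(k + 1 : ℕ)) := by
        rw [div_sub_div _ _ h2.ne' h2'.ne', mul_div_assoc', div_le_div_iff₀ (by positivity)
          (by positivity)]
        set r := √(k : ℝ)
        set s := √((k + 1 : ℕ) : ℝ)
        rw [← h3]
        have h7 : (s - r) * (s + r) = 1 := by nlinarith
        have h8 : s * (s + r) ≤ 4 * r ^ 2 := by nlinarith
        have h9 : s ≤ 4 * (s - r) * r ^ 2 := by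
          have hsr : 0 < s + r := by positivity
          have : s * (s + r) ≤ 4 * (s - r) * r ^ 2 * (s + r) := by
            calc s * (s + r) ≤ 4 * r ^ 2 := h8
              _ = 4 * r ^ 2 * ((s - r) * (s + r)) := by rw [h7, mul_one]
              _ = _ := by ring
          exact le_of_mul_le_mul_right this hsr
        nlinarith
      calc _ ≤ 4 * C * (1 / √M - 1 / √k) + C * (1 / (k * √k)) := by
            rw [mul_one_div]
            exact add_le_add ih h5
        _ ≤ 4 * C * (1 / √M - 1 / √k) + C * (4 * (1 / √k - 1 / √(k + 1 : ℕ))) := by gcongr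
        _ = _ := by ring
  -- The head contributes `6 * C` and the tail `8 * C`; the `1` secures positivity when `C = 0`.
  refine ⟨14 * C + 1, by positivity, fun ζ hζ => ?_⟩
  set ε := ‖1 - ζ‖ with hε
  have hε0 : 0 < ε := by
    rw [hε, norm_pos_iff, sub_ne_zero]
    rintro rfl
    simp at hζ
  have hε2 : ε ≤ 2 := norm_one_sub_le_two hζ.le
  -- The cut at `1 / ε` balances the two bounds `|1 - ζ^m| ≤ m ε`, used below `M`, and `|1 - ζ^m| ≤
  -- 2`, used above.
  set M := ⌈1 / ε⌉₊ with hM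
  have hM1 : 1 ≤ M * ε := by
    rw [← div_le_iff₀ hε0]
    exact Nat.le_ceil _
  have hM2 : (M : ℝ) * ε ≤ 3 := by
    have := (Nat.ceil_lt_add_one (show 0 ≤ 1 / ε by positivity)).le
    calc (M : ℝ) * ε ≤ (1 / ε + 1) * ε := by gcongr
      _ = 1 + ε := by field_simp
      _ ≤ 3 := by linarith
  have hM0' : (0 : ℝ) < M := by
    by_contra h
    nlinarith
  have hM0 : 0 < M := by exact_mod_cast hM0'
  set f : ℕ → ℝ := fun m => b m * ‖1 - ζ ^ m‖ with hf
  have hf0 : ∀ m, 0 ≤ f m := fun m => mul_nonneg (hb m) (norm_nonneg _)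
  have hf2 : ∀ m, f m ≤ 2 * b m := fun m => by
    rw [mul_comm 2]
    exact mul_le_mul_of_nonneg_left (norm_one_sub_le_two (by
      rw [norm_pow]; exact pow_le_one₀ (norm_nonneg _) hζ.le)) (hb m)
  have hfs : Summable f := Summable.of_nonneg_of_le hf0 hf2 (hs.summable.mul_left 2)
  have h1 : ‖1 - ∑' m, (b m : ℂ) * ζ ^ m‖ ≤ ∑' m, f m := by
    have hbC : Summable fun m => (b m : ℂ) * ζ ^ m := by
      refine Summable.of_norm_bounded hs.summable fun m => ?_
      rw [norm_mul, norm_pow, Complex.norm_real, Real.norm_of_nonneg (hb m)]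
      exact mul_le_of_le_one_right (hb m) (pow_le_one₀ (norm_nonneg _) hζ.le)
    have h2 := (Complex.hasSum_ofReal.2 hs).sub hbC.hasSum
    rw [Complex.ofReal_one] at h2
    rw [← h2.tsum_eq]
    refine tsum_of_norm_bounded hfs.hasSum fun m => ?_
    rw [show (b m : ℂ) - b m * ζ ^ m = b m * (1 - ζ ^ m) by ring, norm_mul, Complex.norm_real,
      Real.norm_of_nonneg (hb m)]
  have hhead' : ∑ m ∈ Finset.range M, f m ≤ ε * (3 * C * √M) := by
    calc ∑ m ∈ Finset.range M, f m ≤ ∑ m ∈ Finset.range M, ε * (b m * m) := by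
          refine Finset.sum_le_sum fun m _ => ?_
          calc f m ≤ b m * (m * ε) := mul_le_mul_of_nonneg_left (norm_one_sub_pow_le hζ.le m) (hb m)
            _ = _ := by ring
      _ = ε * ∑ m ∈ Finset.range M, b m * m := by rw [Finset.mul_sum]
      _ ≤ _ := by gcongr; exact hhead M
  have htail' : ∑' i, f (i + M) ≤ 8 * C * (1 / √M) := by
    refine Real.tsum_le_of_sum_range_le (fun i => hf0 _) fun n => ?_
    calc ∑ i ∈ Finset.range n, f (i + M) ≤ ∑ i ∈ Finset.range n, 2 * b (i + M) :=
          Finset.sum_le_sum fun i _ => hf2 _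
      _ = 2 * ∑ i ∈ Finset.range n, b (i + M) := by rw [Finset.mul_sum]
      _ ≤ 2 * (4 * C * (1 / √M - 1 / √(n + M : ℕ))) := by gcongr; exact htail M n hM0
      _ ≤ 2 * (4 * C * (1 / √M)) := by
          gcongr
          exact sub_le_self _ (by positivity)
      _ = _ := by ring
  have hsε : √ε ^ 2 = ε := Real.sq_sqrt hε0.le
  have hsM : 0 < √(M : ℝ) := Real.sqrt_pos.2 hM0'
  have hprod : √(M : ℝ) * √ε ≤ 2 := by
    rw [← Real.sqrt_mul hM0'.le]
    refine (Real.sqrt_le_sqrt hM2).trans ?_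
    rw [Real.sqrt_le_left (by norm_num)]
    norm_num
  have hprod' : 1 / √(M : ℝ) ≤ √ε := by
    rw [div_le_iff₀ hsM, mul_comm, ← Real.sqrt_mul hM0'.le]
    exact Real.one_le_sqrt.2 hM1
  have hs0 : 0 ≤ √ε := Real.sqrt_nonneg _
  have h2 : ε * (3 * C * √M) ≤ 6 * C * √ε := by
    calc ε * (3 * C * √M) = 3 * C * √ε * (√M * √ε) := by
          nth_rewrite 1 [← hsε]
          ring
      _ ≤ 3 * C * √ε * 2 := by gcongr
      _ = _ := by ring
  have h3 : 8 * C * (1 / √M) ≤ 8 * C * √ε := by gcongr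
  rw [← hfs.sum_add_tsum_nat_add M] at h1
  linarith

end GaltonWatson

/-! ### Bounds on `F` and `w` in the unit disc. -/

namespace GaltonWatson

variable {p a : ℕ → ℝ} {F : ℂ → ℂ}

namespace CriticalOffspring

lemma summable_descFactorial_one (hp : CriticalOffspring p) :
    Summable fun k => p k * k.descFactorial 1 := by
  simpa using hp.hasSum_mean.summable

lemma summable_descFactorial_two (hp : CriticalOffspring p) :
    Summable fun k => p k * k.descFactorial 2 := by
  refine Summable.of_nonneg_of_le (fun k => mul_nonneg (hp.nonneg k) (Nat.cast_nonneg _))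
    (fun k => mul_le_mul_of_nonneg_left ?_ (hp.nonneg k)) hp.summable_sq
  exact_mod_cast Nat.descFactorial_le_pow k 2

lemma hasSum_pgfDeriv_one (hp : CriticalOffspring p) {u : ℂ} (hu : ‖u‖ ≤ 1) :
    HasSum (fun k => ((p k * k : ℝ) : ℂ) * u ^ (k - 1)) (pgfDeriv p 1 u) := by
  simpa using hasSum_pgfDeriv hp.nonneg hp.summable_descFactorial_one hu

/-- `Φ'` has nonnegative coefficients of total mass `1`. A single index `k₀ ≥ 2` of positive mass
suffices, since its power satisfies `‖u‖ ^ (k₀ - 1) ≤ ‖u‖`. -/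
lemma exists_norm_pgfDeriv_one_le (hp : CriticalOffspring p) :
    ∃ c : ℝ, 0 < c ∧ ∀ u : ℂ, ‖u‖ ≤ 1 → c * (1 - ‖u‖) ≤ 1 - ‖pgfDeriv p 1 u‖ := by
  obtain ⟨k₀, hk₀, hpos⟩ := hp.exists_two_le
  have hk' : (0 : ℝ) < k₀ := by exact_mod_cast (by omega : 0 < k₀)
  refine ⟨p k₀ * k₀, by positivity, fun u hu => ?_⟩
  have h1 : HasSum (fun k => p k * k - if k = k₀ then p k₀ * k₀ * (1 - ‖u‖) else 0)
      (1 - p k₀ * k₀ * (1 - ‖u‖)) := hp.hasSum_mean.sub (hasSum_ite_eq k₀ _)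
  have h2 := tsum_of_norm_bounded h1 (f := fun k => ((p k * k : ℝ) : ℂ) * u ^ (k - 1)) fun k => by
    have hpk : 0 ≤ p k * k := mul_nonneg (hp.nonneg k) (Nat.cast_nonneg k)
    rw [norm_mul, norm_pow, Complex.norm_real, Real.norm_of_nonneg hpk]
    split_ifs with hk
    · subst hk
      have : ‖u‖ ^ (k - 1) ≤ ‖u‖ := pow_le_of_le_one (norm_nonneg _) hu (by omega)
      nlinarith
    · rw [sub_zero]
      exact mul_le_of_le_one_right hpk (pow_le_one₀ (norm_nonneg _) hu)
  rw [(hp.hasSum_pgfDeriv_one hu).tsum_eq] at h2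
  linarith

end CriticalOffspring

namespace ProgenyLaw

lemma norm_le (h : ProgenyLaw p a F) {z : ℂ} (hz : ‖z‖ ≤ 1) : ‖F z‖ ≤ 1 := by
  refine (h.hasSum z hz).tsum_eq ▸ (tsum_of_norm_bounded h.summable.hasSum fun n => ?_).trans
    h.tsum_le_one
  rw [norm_mul, norm_pow, Complex.norm_real, Real.norm_of_nonneg (h.nonneg n)]
  exact mul_le_of_le_one_right (h.nonneg n) (pow_le_one₀ (norm_nonneg _) hz)

/-- Critical Galton-Watson trees are finite. -/
lemma hasSum_one (hp : CriticalOffspring p) (h : ProgenyLaw p a F) : HasSum a 1 := by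
  set s := ∑' n, a n with hs
  have hs1 : s ≤ 1 := h.tsum_le_one
  have hs0 : 0 ≤ s := tsum_nonneg h.nonneg
  have hF1 : F 1 = s := by
    refine (h.hasSum 1 (by simp)).unique ?_
    simpa using Complex.hasSum_ofReal.2 h.summable.hasSum
  have h1 : HasSum (fun k => p k * s ^ k) s := by
    have := h.hasSum_offspring 1 (by simp)
    rw [hF1] at this
    rw [← Complex.hasSum_ofReal]
    simpa using this
  -- Criticality makes the line `1 + (s - 1) = s` the tangent of `Φ` at `1`. The terms are
  -- nonnegative by Bernoulli's inequality, so all vanish, and equality at an index `k ≥ 2` forces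
  -- `s = 1`.
  have h2 : HasSum (fun k => p k * (s ^ k - (1 + k * (s - 1)))) 0 := by
    convert! h1.sub (hp.hasSum_one.add (hp.hasSum_mean.mul_right (s - 1))) using 1
    · funext k
      ring
    · ring
  have hbern : ∀ k : ℕ, 0 ≤ s ^ k - (1 + k * (s - 1)) := fun k => by
    have := one_add_mul_le_pow (show -2 ≤ s - 1 by linarith) k
    rw [add_sub_cancel] at this
    linarith
  have h3 := (hasSum_zero_iff_of_nonneg fun k => mul_nonneg (hp.nonneg k) (hbern k)).1 h2
  obtain ⟨k, hk, hpk⟩ := hp.exists_two_le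
  have h4 : s ^ k - (1 + k * (s - 1)) = 0 := by
    have := congrFun h3 k
    simpa [hpk.ne'] using this
  obtain ⟨j, rfl⟩ : ∃ j, k = j + 2 := ⟨k - 2, by omega⟩
  have h5 := mul_le_mul_of_nonneg_left (hbern (j + 1)) hs0
  have h6 : (s - 1) ^ 2 ≤ 0 := by
    push_cast at h4 h5
    have hj : (0 : ℝ) ≤ j := Nat.cast_nonneg j
    have e : s ^ (j + 2) = s * s ^ (j + 1) := by ring
    nlinarith [mul_nonneg hj (sq_nonneg (s - 1))]
  have h7 : s = 1 := by nlinarith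
  exact h7 ▸ h.summable.hasSum

/-- Periodicity of the total progeny: `F z = z * F' (z ^ d)` for a power series `F'`. -/
lemma eq_mul_tsum (hp : CriticalOffspring p) (h : ProgenyLaw p a F) {d : ℕ} (hd0 : 0 < d)
    (hd : ∀ n, a n ≠ 0 → d ∣ n - 1) {z : ℂ} (hz : ‖z‖ ≤ 1) :
    F z = z * ∑' m, (a (1 + d * m) : ℂ) * (z ^ d) ^ m := by
  rw [← tsum_mul_left, ← (h.hasSum z hz).tsum_eq]
  have hinj : Function.Injective fun m : ℕ => 1 + d * m := fun m n hmn => by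
    simpa [hd0.ne'] using hmn
  rw [← hinj.tsum_eq (f := fun n => (a n : ℂ) * z ^ n)]
  · refine tsum_congr fun m => ?_
    ring
  · intro n hn
    have hn' : a n ≠ 0 := fun h0 => hn (by simp [h0])
    have hn0 : n ≠ 0 := fun h0 => hn' (h0 ▸ h.apply_zero hp)
    obtain ⟨m, hm⟩ := hd n hn'
    exact ⟨m, by simp only; omega⟩

lemma hasSum_span (hp : CriticalOffspring p) (h : ProgenyLaw p a F) {d : ℕ} (hd0 : 0 < d)
    (hd : ∀ n, a n ≠ 0 → d ∣ n - 1) : HasSum (fun m => a (1 + d * m)) 1 := by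
  have hinj : Function.Injective fun m : ℕ => 1 + d * m := fun m n hmn => by
    simpa [hd0.ne'] using hmn
  refine (hinj.hasSum_iff fun n hn => ?_).2 (h.hasSum_one hp)
  by_contra hn'
  have hn0 : n ≠ 0 := fun h0 => hn' (h0 ▸ h.apply_zero hp)
  obtain ⟨m, hm⟩ := hd n hn'
  exact hn ⟨m, by simp only; omega⟩

/-- The point `z * u` stands for `F z`. For `k` in the support, `z (z u)^(k-1) = (z^d)^(k/d)
u^(k-1)`, so only `z ^ d` matters; each factor `k` from a power joins the weight `p k * k` and leads
to the second moment. -/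
lemma norm_one_sub_mul_pgfDeriv_le (hp : CriticalOffspring p) {d : ℕ} (hd0 : 0 < d)
    (hdk : ∀ k, p k ≠ 0 → d ∣ k) {z u : ℂ} (hz : ‖z‖ ≤ 1) (hu : ‖u‖ ≤ 1) :
    ‖1 - z * pgfDeriv p 1 (z * u)‖ ≤
      (∑' k, p k * (k : ℝ) ^ 2) * (‖1 - z ^ d‖ + ‖1 - u‖) := by
  have hzu : ‖z * u‖ ≤ 1 := by
    rw [norm_mul]
    exact mul_le_one₀ hz (norm_nonneg _) hu
  have h1 := (Complex.hasSum_ofReal.2 hp.hasSum_mean).sub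
    ((hp.hasSum_pgfDeriv_one hzu).mul_left z)
  rw [Complex.ofReal_one] at h1
  rw [← h1.tsum_eq]
  refine tsum_of_norm_bounded (hp.summable_sq.hasSum.mul_right _) fun k => ?_
  by_cases hk : p k = 0
  · simp [hk]
  rcases Nat.eq_zero_or_pos k with rfl | hk0
  · simp
  obtain ⟨j, rfl⟩ := hdk k hk
  have hj : (j : ℝ) ≤ (d * j : ℕ) := by exact_mod_cast Nat.le_mul_of_pos_left j hd0
  have hpk : 0 ≤ p (d * j) * (d * j : ℕ) := mul_nonneg (hp.nonneg _) (Nat.cast_nonneg _)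
  have e1 : z * (z * u) ^ (d * j - 1) = (z ^ d) ^ j * u ^ (d * j - 1) := by
    rw [mul_pow, ← mul_assoc, ← pow_succ', Nat.sub_add_cancel hk0, pow_mul]
  rw [show ((p (d * j) * (d * j : ℕ) : ℝ) : ℂ) - z * (((p (d * j) * (d * j : ℕ) : ℝ) : ℂ) *
    (z * u) ^ (d * j - 1)) = ((p (d * j) * (d * j : ℕ) : ℝ) : ℂ) *
      (1 - z * (z * u) ^ (d * j - 1)) by ring, e1, norm_mul, Complex.norm_real,
    Real.norm_of_nonneg hpk]
  have hzd : ‖z ^ d‖ ≤ 1 := by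
    rw [norm_pow]
    exact pow_le_one₀ (norm_nonneg _) hz
  have h2 : ‖1 - (z ^ d) ^ j * u ^ (d * j - 1)‖ ≤ (d * j : ℕ) * (‖1 - z ^ d‖ + ‖1 - u‖) := by
    calc ‖1 - (z ^ d) ^ j * u ^ (d * j - 1)‖
        = ‖(1 - (z ^ d) ^ j) + (z ^ d) ^ j * (1 - u ^ (d * j - 1))‖ := by congr 1; ring
      _ ≤ ‖1 - (z ^ d) ^ j‖ + 1 * ‖1 - u ^ (d * j - 1)‖ := by
          refine (norm_add_le _ _).trans ?_
          rw [norm_mul]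
          gcongr
          rw [norm_pow]
          exact pow_le_one₀ (norm_nonneg _) hzd
      _ ≤ j * ‖1 - z ^ d‖ + 1 * ((d * j - 1 : ℕ) * ‖1 - u‖) := by
          gcongr
          · exact norm_one_sub_pow_le hzd j
          · exact norm_one_sub_pow_le hu _
      _ ≤ (d * j : ℕ) * ‖1 - z ^ d‖ + 1 * ((d * j : ℕ) * ‖1 - u‖) := by
          gcongr
          omega
      _ = _ := by ring
  calc p (d * j) * (d * j : ℕ) * ‖1 - (z ^ d) ^ j * u ^ (d * j - 1)‖
      ≤ p (d * j) * (d * j : ℕ) * ((d * j : ℕ) * (‖1 - z ^ d‖ + ‖1 - u‖)) := by gcongr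
    _ = _ := by ring

/-- Bounds on `F` and `w z = z * Φ' (F z)` in the unit disc: `w` stays in a nontangential region,
and `1 - |w|`, `1 - |F|` are at least of the order `√|1 - z ^ d|`. -/
lemma exists_disc_bounds (hp : CriticalOffspring p) (h : ProgenyLaw p a F) {d N : ℕ} {c C : ℝ}
    (hd0 : 0 < d) (hdk : ∀ k, p k ≠ 0 → d ∣ k) (hd : ∀ n, a n ≠ 0 → d ∣ n - 1) (hc : 0 < c)
    (hup : ∀ n, a n * (n * √n) ≤ C)
    (hlow : ∀ m, N ≤ m → c ≤ a (1 + d * m) * ((1 + d * m : ℕ) * √(1 + d * m : ℕ))) :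
    ∃ κ : ℝ, 0 < κ ∧ ∀ z : ℂ, ‖z‖ < 1 →
      κ * √‖1 - z ^ d‖ ≤ 1 - ‖z * pgfDeriv p 1 (F z)‖ ∧
      κ * ‖1 - z * pgfDeriv p 1 (F z)‖ ≤ 1 - ‖z * pgfDeriv p 1 (F z)‖ ∧
      κ * ‖1 - z * pgfDeriv p 1 (F z)‖ ≤ 1 - ‖F z‖ := by
  have hd0' : (0 : ℝ) < d := by exact_mod_cast hd0
  have hb := h.hasSum_span hp hd0 hd
  have hbn : ∀ m, 0 ≤ a (1 + d * m) := fun m => h.nonneg _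
  -- The bound `m ≥ 1` is needed for `1 + d m ≤ (d + 1) m`, which passes from the index `1 + d m` to
  -- `m` at the cost of the denominator of `c`.
  obtain ⟨κ₁, hκ₁, hF⟩ := exists_norm_tsum_le (N := max N 1) (c := c / ((d + 1) * √(d + 1 : ℕ))) hbn
    hb.summable hb.tsum_eq.le (by positivity) (by
      intro m hm
      have hm1 : 1 ≤ m := (le_max_right _ _).trans hm
      have hle : (1 + d * m : ℕ) ≤ (d + 1) * m := by nlinarith
      have hle' : ((1 + d * m : ℕ) : ℝ) ≤ (d + 1 : ℕ) * m := by exact_mod_cast hle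
      rw [div_le_iff₀ (by positivity)]
      refine (hlow m ((le_max_left _ _).trans hm)).trans ?_
      calc a (1 + d * m) * ((1 + d * m : ℕ) * √(1 + d * m : ℕ))
          ≤ a (1 + d * m) * (((d + 1 : ℕ) * m) * √((d + 1 : ℕ) * m)) := by
            gcongr
            exact h.nonneg _
        _ = _ := by
            rw [Real.sqrt_mul (by positivity)]
            push_cast
            ring)
  obtain ⟨K, hK, hF1⟩ := exists_norm_one_sub_tsum_le (C := C) hbn hb (by
    intro m
    refine le_trans ?_ (hup (1 + d * m))
    have hle : m ≤ 1 + d * m := by nlinarith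
    have hle' : (m : ℝ) ≤ (1 + d * m : ℕ) := by exact_mod_cast hle
    gcongr
    exact h.nonneg _)
  obtain ⟨κ₂, hκ₂, hw⟩ := hp.exists_norm_pgfDeriv_one_le
  set Q := ∑' k, p k * (k : ℝ) ^ 2 with hQ
  have hQ0 : 0 ≤ Q := tsum_nonneg fun k => mul_nonneg (hp.nonneg k) (by positivity)
  set R := Q * (2 + K) + 1 with hR
  have hR0 : 0 < R := by positivity
  have main : ∀ z : ℂ, ‖z‖ < 1 → κ₁ * √‖1 - z ^ d‖ ≤ 1 - ‖F z‖ ∧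
      κ₂ * (1 - ‖F z‖) ≤ 1 - ‖z * pgfDeriv p 1 (F z)‖ ∧
      ‖1 - z * pgfDeriv p 1 (F z)‖ ≤ R * √‖1 - z ^ d‖ := by
    intro z hz
    have hzd : ‖z ^ d‖ < 1 := by
      rw [norm_pow]
      exact pow_lt_one₀ (norm_nonneg _) hz hd0.ne'
    have hFz := h.eq_mul_tsum hp hd0 hd hz.le
    set u := ∑' m, (a (1 + d * m) : ℂ) * (z ^ d) ^ m with hu
    have hs := Real.sqrt_nonneg ‖1 - z ^ d‖
    have h1 := hF _ hzd
    have h2 := hF1 _ hzd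
    rw [← hu] at h1 h2
    have hu1 : ‖u‖ ≤ 1 := by nlinarith
    have hFu : ‖F z‖ ≤ ‖u‖ := by
      rw [hFz, norm_mul]
      exact mul_le_of_le_one_left (norm_nonneg _) hz.le
    refine ⟨by linarith, (hw _ (hFu.trans hu1)).trans ?_, ?_⟩
    · rw [norm_mul]
      have := mul_le_of_le_one_left (norm_nonneg (pgfDeriv p 1 (F z))) hz.le
      linarith
    · rw [hFz]
      refine (norm_one_sub_mul_pgfDeriv_le hp hd0 hdk hz.le hu1).trans ?_
      have h3 : ‖1 - z ^ d‖ ≤ 2 * √‖1 - z ^ d‖ := by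
        have h4 := norm_one_sub_le_two hzd.le
        have h5 := Real.sq_sqrt (norm_nonneg (1 - z ^ d))
        have h6 : √‖1 - z ^ d‖ ≤ 2 := by
          rw [Real.sqrt_le_left (by norm_num)]
          linarith
        nlinarith
      calc Q * (‖1 - z ^ d‖ + ‖1 - u‖) ≤ Q * (2 * √‖1 - z ^ d‖ + K * √‖1 - z ^ d‖) := by gcongr
        _ ≤ R * √‖1 - z ^ d‖ := by
            rw [hR]
            nlinarith
  -- Eliminates `s = √|1 - z^d|` between a lower bound for `A` and an upper bound for `B` of the
  -- same order. This is how the Stolz condition on `w` arises.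
  have hfrac : ∀ {A B s : ℝ}, 0 ≤ s → κ₁ * s ≤ A → B ≤ R * s → κ₁ / R * B ≤ A := by
    intro A B s hs hA hB
    calc κ₁ / R * B ≤ κ₁ / R * (R * s) := by gcongr
      _ = κ₁ * s := by field_simp
      _ ≤ A := hA
  refine ⟨min (κ₂ * κ₁) (min (κ₂ * (κ₁ / R)) (κ₁ / R)), by positivity, fun z hz => ?_⟩
  obtain ⟨h1, h2, h3⟩ := main z hz
  have hs := Real.sqrt_nonneg ‖1 - z ^ d‖
  have h4 := hfrac hs h1 h3
  have hn := norm_nonneg (1 - z * pgfDeriv p 1 (F z))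
  refine ⟨?_, ?_, ?_⟩
  · calc _ ≤ κ₂ * κ₁ * √‖1 - z ^ d‖ := by gcongr; exact min_le_left _ _
      _ = κ₂ * (κ₁ * √‖1 - z ^ d‖) := by ring
      _ ≤ κ₂ * (1 - ‖F z‖) := by gcongr
      _ ≤ _ := h2
  · calc _ ≤ κ₂ * (κ₁ / R) * ‖1 - z * pgfDeriv p 1 (F z)‖ := by
          gcongr
          exact (min_le_right _ _).trans (min_le_left _ _)
      _ = κ₂ * (κ₁ / R * ‖1 - z * pgfDeriv p 1 (F z)‖) := by ring
      _ ≤ κ₂ * (1 - ‖F z‖) := by gcongr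
      _ ≤ _ := h2
  · refine le_trans ?_ h4
    gcongr
    exact (min_le_right _ _).trans (min_le_right _ _)

end ProgenyLaw

end GaltonWatson

/-! ### Geometry of the domain, and derivatives of the offspring generating function. -/

namespace GaltonWatson

/-- Let `r = |1 - x|`. If `r ≥ ε`, the radius bound gives `|x| - 1 ≤ ε² ≤ ε r`. If `r < ε` and `|x|
> 1`, the angle gives `Re (x - 1) ≤ r ε / 2`, hence `|x|² - 1 ≤ ε r + r² ≤ 2 ε r`, and `|x| + 1 ≥
2`. -/
lemma norm_sub_one_le_of_mem_deltaDomain {ε : ℝ} (hε0 : 0 < ε) (hε1 : ε ≤ 1) {x : ℂ}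
    (hx : x ∈ deltaDomain (ε / 2) (ε ^ 2)) : x ≠ 1 ∧ ‖x‖ ≤ 2 ∧ ‖x‖ - 1 ≤ ε * ‖1 - x‖ := by
  obtain ⟨h1, h2, h3⟩ := hx
  have hx2 : ‖x‖ ≤ 2 := by nlinarith
  refine ⟨h2, hx2, ?_⟩
  set r := ‖1 - x‖ with hr
  have hr0 : 0 ≤ r := norm_nonneg _
  rcases le_or_gt ‖x‖ 1 with hx1 | hx1
  · nlinarith
  rcases le_or_gt ε r with hr1 | hr1
  · nlinarith
  have hr' : ‖x - 1‖ = r := norm_sub_rev _ _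
  have hcos : Real.cos (Complex.arg (x - 1)) ≤ ε / 2 := by
    rw [← Real.cos_abs]
    have hpi := Real.pi_gt_three
    calc Real.cos |Complex.arg (x - 1)| ≤ Real.cos (Real.pi / 2 - ε / 2) :=
          Real.cos_le_cos_of_nonneg_of_le_pi (by linarith) (Complex.abs_arg_le_pi _) h3.le
      _ = Real.sin (ε / 2) := Real.cos_pi_div_two_sub _
      _ ≤ ε / 2 := Real.sin_le (by positivity)
  have hre : (x - 1).re ≤ r * (ε / 2) := by
    rw [← Complex.norm_mul_cos_arg (x - 1), hr']
    gcongr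
  have hsq : ‖x‖ ^ 2 - 1 = 2 * (x - 1).re + r ^ 2 := by
    rw [← hr', Complex.sq_norm, Complex.sq_norm, Complex.normSq_apply, Complex.normSq_apply]
    simp only [Complex.sub_re, Complex.sub_im, Complex.one_re, Complex.one_im]
    ring
  nlinarith

/-- Let `s = |1 - xw|`. Then `|1 - x| ≤ s + 2 |1 - w|`, while the Stolz condition gives `κ |1 - w| ≤
1 - |w| ≤ s + (κ/4) |1 - x|`. Combining the two, the term `(κ/2) |1 - x|` is absorbed on the left,
so `κ |1 - x| ≤ 6 s`, and then `κ |1 - w| ≤ 7 s`. -/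
lemma norm_one_sub_mul_bounds {κ : ℝ} (hκ0 : 0 < κ) (hκ1 : κ ≤ 1) {w x : ℂ} (hw1 : ‖w‖ ≤ 1)
    (hw : κ * ‖1 - w‖ ≤ 1 - ‖w‖) (hx2 : ‖x‖ ≤ 2) (hx : ‖x‖ - 1 ≤ κ / 4 * ‖1 - x‖) :
    κ / 7 * ‖1 - x‖ ≤ ‖1 - x * w‖ ∧ κ / 7 * ‖1 - w‖ ≤ ‖1 - x * w‖ := by
  set s := ‖1 - x * w‖ with hs
  have hs0 : 0 ≤ s := norm_nonneg _
  have h1 : ‖1 - x‖ ≤ s + ‖x‖ * ‖1 - w‖ := by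
    calc ‖1 - x‖ = ‖(1 - x * w) - x * (1 - w)‖ := by congr 1; ring
      _ ≤ _ := (norm_sub_le _ _).trans (by rw [norm_mul])
  have h2 : 1 - ‖x‖ * ‖w‖ ≤ s := by
    have := norm_sub_norm_le (1 : ℂ) (x * w)
    rwa [norm_one, norm_mul] at this
  have h3 : ‖1 - w‖ ≤ s + ‖1 - x‖ := by
    calc ‖1 - w‖ = ‖(1 - x * w) - w * (1 - x)‖ := by congr 1; ring
      _ ≤ s + ‖w‖ * ‖1 - x‖ := (norm_sub_le _ _).trans (by rw [norm_mul])
      _ ≤ s + ‖1 - x‖ := by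
          gcongr
          exact mul_le_of_le_one_left (norm_nonneg _) hw1
  have h4 : 1 - ‖w‖ ≤ s + κ / 4 * ‖1 - x‖ := by
    have h5 : (‖x‖ - 1) * ‖w‖ ≤ κ / 4 * ‖1 - x‖ := by
      rcases le_or_gt ‖x‖ 1 with hx1 | hx1
      · have : (‖x‖ - 1) * ‖w‖ ≤ 0 := mul_nonpos_of_nonpos_of_nonneg (by linarith) (norm_nonneg _)
        have : 0 ≤ κ / 4 * ‖1 - x‖ := by positivity
        linarith
      · exact (mul_le_of_le_one_right (by linarith) hw1).trans hx
    linarith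
  have h5 : κ * ‖1 - x‖ ≤ 6 * s := by
    have : ‖x‖ * ‖1 - w‖ ≤ 2 * ‖1 - w‖ := by gcongr
    nlinarith [norm_nonneg (1 - x), norm_nonneg (1 - w)]
  constructor <;> nlinarith

lemma natCast_mul_pow_le {r : ℝ} (hr0 : 0 ≤ r) (hr1 : r < 1) (n : ℕ) :
    n * r ^ (n - 1) ≤ 1 / (1 - r) := by
  have h0 : 0 < 1 - r := by linarith
  rw [le_div_iff₀ h0]
  have h1 : (n : ℝ) * r ^ (n - 1) ≤ ∑ i ∈ Finset.range n, r ^ i := by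
    calc (n : ℝ) * r ^ (n - 1) = ∑ i ∈ Finset.range n, r ^ (n - 1) := by simp
      _ ≤ _ := Finset.sum_le_sum fun i hi =>
        pow_le_pow_of_le_one hr0 hr1.le (by have := Finset.mem_range.1 hi; omega)
  have h2 := mul_neg_geom_sum r n
  have h3 : 0 ≤ r ^ n := pow_nonneg hr0 n
  nlinarith

lemma descFactorial_succ_mul_pow_le {p : ℕ → ℝ} (hp : ∀ k, 0 ≤ p k) {r : ℝ} (hr0 : 0 ≤ r)
    (hr1 : r < 1) (j k : ℕ) :
    p k * k.descFactorial (j + 1) * r ^ (k - (j + 1)) ≤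
      p k * k.descFactorial j * (1 / (1 - r)) := by
  rw [Nat.descFactorial_succ]
  push_cast
  calc p k * (((k - j : ℕ) : ℝ) * k.descFactorial j) * r ^ (k - (j + 1))
      = p k * k.descFactorial j * (((k - j : ℕ) : ℝ) * r ^ (k - j - 1)) := by
        rw [Nat.sub_sub]
        ring
    _ ≤ _ := mul_le_mul_of_nonneg_left (natCast_mul_pow_le hr0 hr1 _)
        (mul_nonneg (hp k) (Nat.cast_nonneg _))

lemma norm_pgfDeriv_term {p : ℕ → ℝ} (hp : ∀ k, 0 ≤ p k) (j k : ℕ) (u : ℂ) :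
    ‖((p k * k.descFactorial j : ℝ) : ℂ) * u ^ (k - j)‖ =
      p k * k.descFactorial j * ‖u‖ ^ (k - j) := by
  rw [norm_mul, norm_pow, Complex.norm_real,
    Real.norm_of_nonneg (mul_nonneg (hp k) (Nat.cast_nonneg _))]

lemma norm_pgfDeriv_le {p : ℕ → ℝ} (hp : ∀ k, 0 ≤ p k) {j : ℕ}
    (hs : Summable fun k => p k * k.descFactorial j) {u : ℂ} (hu : ‖u‖ ≤ 1) :
    ‖pgfDeriv p j u‖ ≤ ∑' k, p k * k.descFactorial j :=
  tsum_of_norm_bounded hs.hasSum fun k => by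
    rw [norm_pgfDeriv_term hp]
    exact mul_le_of_le_one_right (mul_nonneg (hp k) (Nat.cast_nonneg _))
      (pow_le_one₀ (norm_nonneg _) hu)

/-- One further derivative costs a factor `1 / (1 - ‖u‖)` in place of a further moment, because `n
r^(n-1) ≤ ∑_{i<n} r^i`. It bounds `Φ'''` when only two moments are finite. -/
lemma norm_pgfDeriv_succ_le {p : ℕ → ℝ} (hp : ∀ k, 0 ≤ p k) {j : ℕ}
    (hs : Summable fun k => p k * k.descFactorial j) {u : ℂ} (hu : ‖u‖ < 1) :
    ‖pgfDeriv p (j + 1) u‖ ≤ (∑' k, p k * k.descFactorial j) * (1 / (1 - ‖u‖)) :=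
  tsum_of_norm_bounded (hs.hasSum.mul_right _) fun k => by
    rw [norm_pgfDeriv_term hp]
    exact descFactorial_succ_mul_pow_le hp (norm_nonneg _) hu j k

lemma hasDerivAt_pgfDeriv {p : ℕ → ℝ} (hp : ∀ k, 0 ≤ p k) {j : ℕ}
    (hs : Summable fun k => p k * k.descFactorial j) {u : ℂ} (hu : ‖u‖ < 1) :
    HasDerivAt (pgfDeriv p j) (pgfDeriv p (j + 1) u) u := by
  obtain ⟨r, hur, hr1⟩ := exists_between hu
  have hr0 : 0 ≤ r := (norm_nonneg u).trans hur.le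
  refine hasDerivAt_tsum_of_isPreconnected (t := Metric.ball 0 r)
    (u := fun k => p k * k.descFactorial j * (1 / (1 - r)))
    (g := fun k u => ((p k * k.descFactorial j : ℝ) : ℂ) * u ^ (k - j))
    (g' := fun k u => ((p k * k.descFactorial (j + 1) : ℝ) : ℂ) * u ^ (k - (j + 1)))
    (hs.mul_right _) Metric.isOpen_ball
    (convex_ball _ _).isPreconnected (fun k y _ => ?_) (fun k y hy => ?_)
    (y₀ := 0) (Metric.mem_ball_self ((norm_nonneg u).trans_lt hur))
    (hasSum_pgfDeriv hp hs (by simp)).summable (by simpa using hur)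
  · have h1 := (hasDerivAt_pow (k - j) y).const_mul ((p k * k.descFactorial j : ℝ) : ℂ)
    convert! h1 using 1
    rw [Nat.descFactorial_succ, Nat.sub_sub]
    push_cast
    ring
  · rw [norm_pgfDeriv_term hp]
    refine le_trans ?_ (descFactorial_succ_mul_pow_le hp hr0 hr1 j k)
    have hy' : ‖y‖ ≤ r := by simpa using (Metric.mem_ball.1 hy).le
    exact mul_le_mul_of_nonneg_left (pow_le_pow_left₀ (norm_nonneg _) hy' _)
      (mul_nonneg (hp k) (Nat.cast_nonneg _))

end GaltonWatson

/-! ### The `z`-derivative of the pair kernel. -/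

namespace GaltonWatson

variable {p a : ℕ → ℝ} {F : ℂ → ℂ}

/-- The generating function of the pair sums in terms of the total progeny. -/
noncomputable def pairKernel (p : ℕ → ℝ) (F : ℂ → ℂ) (x y z : ℂ) : ℂ :=
  F z * (1 + x * y * (z * F z * pgfDeriv p 2 (F z) - (z * pgfDeriv p 1 (F z)) ^ 2)) *
    (1 - z * pgfDeriv p 1 (F z))⁻¹ * (1 - x * (z * pgfDeriv p 1 (F z)))⁻¹ *
    (1 - y * (z * pgfDeriv p 1 (F z)))⁻¹

namespace ProgenyLaw

lemma eq_mul_pgfDeriv_zero (hp : CriticalOffspring p) (h : ProgenyLaw p a F) {z : ℂ}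
    (hz : ‖z‖ ≤ 1) : F z = z * pgfDeriv p 0 (F z) := by
  have h1 := (hasSum_pgfDeriv hp.nonneg (j := 0) (by simpa using hp.hasSum_one.summable)
    (h.norm_le hz)).mul_left z
  refine (h.hasSum_offspring z hz).unique ?_
  convert! h1 using 2 with k
  simp
  ring

/-- `F` is differentiable as a power series; differentiating `F = z Φ(F)` gives the relation, which
is kept free of division by `1 - w`. -/
lemma exists_hasDerivAt (hp : CriticalOffspring p) (h : ProgenyLaw p a F) {z : ℂ} (hz : ‖z‖ < 1)
    (hF : ‖F z‖ < 1) :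
    ∃ F' : ℂ, HasDerivAt F F' z ∧ F' * (1 - z * pgfDeriv p 1 (F z)) = pgfDeriv p 0 (F z) := by
  have hFa : ∀ z, ‖z‖ ≤ 1 → F z = pgfDeriv a 0 z := fun z hz => by
    refine (h.hasSum z hz).unique ?_
    simpa using hasSum_pgfDeriv h.nonneg (j := 0) (by simpa using h.summable) hz
  have hnear : ∀ᶠ y in nhds z, ‖y‖ < 1 := continuous_norm.continuousAt.eventually_lt_const hz
  have h1 : HasDerivAt F (pgfDeriv a 1 z) z :=
    (hasDerivAt_pgfDeriv h.nonneg (j := 0) (by simpa using h.summable) hz).congr_of_eventuallyEq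
      (hnear.mono fun y hy => hFa y hy.le)
  refine ⟨_, h1, ?_⟩
  have h2 : HasDerivAt (fun z => z * pgfDeriv p 0 (F z))
      (1 * pgfDeriv p 0 (F z) + z * (pgfDeriv p 1 (F z) * pgfDeriv a 1 z)) z :=
    (hasDerivAt_id z).mul ((hasDerivAt_pgfDeriv hp.nonneg (j := 0)
      (by simpa using hp.hasSum_one.summable) hF).comp z h1)
  have h3 := h1.unique (h2.congr_of_eventuallyEq
    (hnear.mono fun y hy => h.eq_mul_pgfDeriv_zero hp hy.le))
  linear_combination h3

end ProgenyLaw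

lemma hasDerivAt_inv_one_sub_mul {w : ℂ → ℂ} {w' z : ℂ} (hw : HasDerivAt w w' z) (x : ℂ)
    (hne : 1 - x * w z ≠ 0) :
    HasDerivAt (fun z => (1 - x * w z)⁻¹) (x * w' * ((1 - x * w z)⁻¹) ^ 2) z := by
  convert! ((hw.const_mul x).const_sub 1).inv hne using 1
  rw [neg_neg, inv_pow, div_eq_mul_inv]

set_option maxHeartbeats 1000000 in
/-- The derivative of the pair kernel at a point of the unit disc is controlled by the
distances to one. -/
lemma ProgenyLaw.exists_norm_deriv_pairKernel_le (hp : CriticalOffspring p) (h : ProgenyLaw p a F)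
    {κ : ℝ} (hκ0 : 0 < κ) :
    ∃ T : ℝ, 0 < T ∧ ∀ x y z : ℂ, ‖x‖ ≤ 2 → ‖y‖ ≤ 2 → x ≠ 1 → y ≠ 1 → ‖z‖ < 1 →
      0 < ‖1 - z * pgfDeriv p 1 (F z)‖ →
      κ * ‖1 - z * pgfDeriv p 1 (F z)‖ ≤ 1 - ‖F z‖ →
      κ * ‖1 - x‖ ≤ ‖1 - x * (z * pgfDeriv p 1 (F z))‖ →
      κ * ‖1 - z * pgfDeriv p 1 (F z)‖ ≤ ‖1 - x * (z * pgfDeriv p 1 (F z))‖ →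
      κ * ‖1 - y‖ ≤ ‖1 - y * (z * pgfDeriv p 1 (F z))‖ →
      κ * ‖1 - z * pgfDeriv p 1 (F z)‖ ≤ ‖1 - y * (z * pgfDeriv p 1 (F z))‖ →
      ∃ G' : ℂ, HasDerivAt (pairKernel p F x y) G' z ∧
        ‖G'‖ ≤ T * (‖1 - x‖⁻¹ * ‖1 - y‖⁻¹) * ‖1 - z * pgfDeriv p 1 (F z)‖⁻¹ ^ 3 := by
  set S := ∑' k, p k * k.descFactorial 2 with hS
  have hS0 : 0 ≤ S := tsum_nonneg fun k => mul_nonneg (hp.nonneg k) (Nat.cast_nonneg _)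
  set W := 2 + S with hW
  set q := 6 * S + S / κ with hq
  set n₀ := 5 + 4 * S with hn₀
  set n₁ := 2 * n₀ + 4 * q + 16 * W with hn₁
  set L := κ⁻¹ with hL
  have hL0 : 0 < L := inv_pos.2 hκ0
  have hq0 : 0 ≤ q := by positivity
  -- The summands come from differentiating the numerator, then `(1 - w)⁻¹`, then the two factors
  -- with `x` and `y`, which contribute `2 * n₀ * W * L` each.
  refine ⟨L ^ 2 * (n₁ + n₀ * W + 4 * n₀ * W * L), by positivity, ?_⟩
  intro x y z hx hy hx1 hy1 hz he hF hx2 hx3 hy2 hy3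
  have hFlt : ‖F z‖ < 1 := by
    have : 0 < κ * ‖1 - z * pgfDeriv p 1 (F z)‖ := by positivity
    linarith
  obtain ⟨F', hF', hFeq⟩ := h.exists_hasDerivAt hp hz hFlt
  have hs1 := hp.summable_descFactorial_one
  have hs2 := hp.summable_descFactorial_two
  set w : ℂ → ℂ := fun z => z * pgfDeriv p 1 (F z) with hw
  set E := ‖1 - w z‖⁻¹ with hE
  have hE0 : 0 < E := inv_pos.2 he
  have hX0 : 0 < ‖1 - x‖ := norm_pos_iff.2 (sub_ne_zero.2 hx1.symm)
  have hY0 : 0 < ‖1 - y‖ := norm_pos_iff.2 (sub_ne_zero.2 hy1.symm)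
  have hΦ0 : ‖pgfDeriv p 0 (F z)‖ ≤ 1 := by
    have := norm_pgfDeriv_le hp.nonneg (j := 0) (by simpa using hp.hasSum_one.summable) hFlt.le
    simpa [hp.hasSum_one.tsum_eq] using this
  have hΦ1 : ‖pgfDeriv p 1 (F z)‖ ≤ 1 := by
    have := norm_pgfDeriv_le hp.nonneg hs1 hFlt.le
    simpa [hp.hasSum_mean.tsum_eq] using this
  have hΦ2 : ‖pgfDeriv p 2 (F z)‖ ≤ S := norm_pgfDeriv_le hp.nonneg hs2 hFlt.le
  have hwle : ‖w z‖ ≤ 1 := by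
    rw [hw, norm_mul]
    exact mul_le_one₀ hz.le (norm_nonneg _) hΦ1
  -- Since `E` is bounded below, lower powers of `E` can be absorbed into higher ones throughout.
  have hE2 : 1 ≤ 2 * E := by
    have := norm_one_sub_le_two hwle
    rw [hE, ← div_eq_mul_inv, le_div_iff₀ he]
    linarith
  have hΦ3 : ‖pgfDeriv p 3 (F z)‖ ≤ S / κ * E := by
    refine (norm_pgfDeriv_succ_le hp.nonneg hs2 hFlt).trans ?_
    rw [div_mul_eq_mul_div, mul_div_assoc]
    refine mul_le_mul_of_nonneg_left ?_ hS0
    rw [hE, ← one_div, div_div, mul_comm ‖1 - w z‖]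
    exact one_div_le_one_div_of_le (by positivity) hF
  have hF'le : ‖F'‖ ≤ E := by
    have h1 : ‖F'‖ * ‖1 - w z‖ ≤ 1 := by
      rw [← norm_mul]
      exact hFeq ▸ hΦ0
    rw [hE, ← one_div, le_div_iff₀ he]
    exact h1
  set w' := pgfDeriv p 1 (F z) + z * (pgfDeriv p 2 (F z) * F') with hw'
  have hdw : HasDerivAt w w' z := by
    have := (hasDerivAt_id z).mul ((hasDerivAt_pgfDeriv hp.nonneg hs1 hFlt).comp z hF')
    convert! this using 1
    simp [hw']
  have hw'le : ‖w'‖ ≤ W * E := by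
    calc ‖w'‖ ≤ ‖pgfDeriv p 1 (F z)‖ + ‖z‖ * (‖pgfDeriv p 2 (F z)‖ * ‖F'‖) :=
          (norm_add_le _ _).trans (by rw [norm_mul, norm_mul])
      _ ≤ 1 + 1 * (S * E) := by gcongr
      _ ≤ W * E := by rw [hW]; linarith
  set Q : ℂ → ℂ := fun z => z * F z * pgfDeriv p 2 (F z) with hQ
  set Q' := (F z + z * F') * pgfDeriv p 2 (F z) + z * F z * (pgfDeriv p 3 (F z) * F') with hQ'
  have hdQ : HasDerivAt Q Q' z := by
    have := ((hasDerivAt_id z).mul hF').mul ((hasDerivAt_pgfDeriv hp.nonneg hs2 hFlt).comp z hF')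
    convert! this using 1
    simp [hQ']
  have hQle : ‖Q z‖ ≤ S := by
    rw [hQ, norm_mul, norm_mul]
    calc ‖z‖ * ‖F z‖ * ‖pgfDeriv p 2 (F z)‖ ≤ 1 * 1 * S := by gcongr
      _ = S := by ring
  have hQ'le : ‖Q'‖ ≤ q * E ^ 2 := by
    calc ‖Q'‖ ≤ (‖F z‖ + ‖z‖ * ‖F'‖) * ‖pgfDeriv p 2 (F z)‖ +
          ‖z‖ * ‖F z‖ * (‖pgfDeriv p 3 (F z)‖ * ‖F'‖) := by
          refine (norm_add_le _ _).trans ?_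
          rw [norm_mul, norm_mul, norm_mul, norm_mul]
          gcongr
          exact (norm_add_le _ _).trans (by rw [norm_mul])
      _ ≤ (1 + 1 * E) * S + 1 * 1 * (S / κ * E * E) := by gcongr
      _ ≤ q * E ^ 2 := by
          rw [hq]
          have h1 : 1 ≤ 4 * E ^ 2 := by nlinarith
          have h2 : E ≤ 2 * E ^ 2 := by nlinarith
          nlinarith
  set Nn : ℂ → ℂ := fun z => F z * (1 + x * y * (Q z - w z ^ 2)) with hNn
  set N' := F' * (1 + x * y * (Q z - w z ^ 2)) + F z * (x * y * (Q' - 2 * w z * w')) with hN'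
  have hdN : HasDerivAt Nn N' z := by
    have := hF'.mul (((hdQ.sub (hdw.pow 2)).const_mul (x * y)).const_add 1)
    convert! this using 1
    simp [hN']
  have hxy : ‖x * y‖ ≤ 4 := by
    rw [norm_mul]
    nlinarith [norm_nonneg x, norm_nonneg y]
  have hin : ‖1 + x * y * (Q z - w z ^ 2)‖ ≤ n₀ := by
    calc ‖1 + x * y * (Q z - w z ^ 2)‖ ≤ 1 + ‖x * y‖ * (‖Q z‖ + ‖w z‖ ^ 2) := by
          refine (norm_add_le _ _).trans ?_
          rw [norm_one, norm_mul]
          gcongr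
          exact (norm_sub_le _ _).trans (by rw [norm_pow])
      _ ≤ 1 + 4 * (S + 1 ^ 2) := by gcongr
      _ = n₀ := by rw [hn₀]; ring
  have hn₀0 : 0 ≤ n₀ := (norm_nonneg _).trans hin
  have hNle : ‖Nn z‖ ≤ n₀ := by
    rw [hNn, norm_mul]
    calc ‖F z‖ * ‖1 + x * y * (Q z - w z ^ 2)‖ ≤ 1 * n₀ := by gcongr
      _ = n₀ := one_mul _
  have hN'le : ‖N'‖ ≤ n₁ * E ^ 2 := by
    calc ‖N'‖ ≤ ‖F'‖ * ‖1 + x * y * (Q z - w z ^ 2)‖ +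
          ‖F z‖ * (‖x * y‖ * (‖Q'‖ + 2 * ‖w z‖ * ‖w'‖)) := by
          refine (norm_add_le _ _).trans ?_
          rw [norm_mul, norm_mul (F z), norm_mul (x * y)]
          gcongr
          refine (norm_sub_le _ _).trans ?_
          rw [norm_mul, norm_mul]
          simp
      _ ≤ E * n₀ + 1 * (4 * (q * E ^ 2 + 2 * 1 * (W * E))) := by gcongr
      _ ≤ n₁ * E ^ 2 := by
          have h2 : E ≤ 2 * E ^ 2 := by nlinarith
          have hW0 : 0 ≤ W := by positivity
          rw [hn₁]
          nlinarith [mul_le_mul_of_nonneg_left h2 hn₀0, mul_le_mul_of_nonneg_left h2 hW0]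
  have hA : HasDerivAt (fun z => (1 - w z)⁻¹) (w' * ((1 - w z)⁻¹) ^ 2) z := by
    simpa using hasDerivAt_inv_one_sub_mul hdw 1 (by simpa using norm_pos_iff.1 he)
  have hB := hasDerivAt_inv_one_sub_mul hdw x
    (norm_pos_iff.1 ((mul_pos hκ0 hX0).trans_le hx2))
  have hC := hasDerivAt_inv_one_sub_mul hdw y
    (norm_pos_iff.1 ((mul_pos hκ0 hY0).trans_le hy2))
  have hinv : ∀ {s t : ℝ}, 0 < s → κ * s ≤ t → t⁻¹ ≤ L * s⁻¹ := by
    intro s t hs hst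
    rw [hL, ← mul_inv]
    exact inv_anti₀ (by positivity) hst
  set A := (1 - w z)⁻¹ with hAdef
  set B := (1 - x * w z)⁻¹ with hBdef
  set D := (1 - y * w z)⁻¹ with hDdef
  have hAn : ‖A‖ = E := norm_inv _
  have hB1 : ‖B‖ ≤ L * ‖1 - x‖⁻¹ := by rw [hBdef, norm_inv]; exact hinv hX0 hx2
  have hB2 : ‖B‖ ≤ L * E := by rw [hBdef, norm_inv]; exact hinv he hx3
  have hD1 : ‖D‖ ≤ L * ‖1 - y‖⁻¹ := by rw [hDdef, norm_inv]; exact hinv hY0 hy2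
  have hD2 : ‖D‖ ≤ L * E := by rw [hDdef, norm_inv]; exact hinv he hy3
  refine ⟨_, ((hdN.mul hA).mul hB).mul hC, ?_⟩
  set X := ‖1 - x‖⁻¹ with hX
  set Y := ‖1 - y‖⁻¹ with hY
  have hX0' : 0 < X := inv_pos.2 hX0
  have hY0' : 0 < Y := inv_pos.2 hY0
  have hW0 : 0 ≤ W := by positivity
  have hn₁0 : 0 ≤ n₁ := by positivity
  have t1 : ‖N' * A * B * D‖ ≤ n₁ * E ^ 2 * E * (L * X) * (L * Y) := by
    rw [norm_mul, norm_mul, norm_mul, hAn]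
    gcongr
  have t2 : ‖Nn z * (w' * A ^ 2) * B * D‖ ≤ n₀ * (W * E * E ^ 2) * (L * X) * (L * Y) := by
    rw [norm_mul, norm_mul, norm_mul, norm_mul w', norm_pow, hAn]
    gcongr
  -- Of the two factors `B`, one is bounded through `|1 - x|` and the other through `|1 - w|`. Thus
  -- `|1 - x|⁻¹` appears only to the first power; `t4` treats `D` in the same way.
  have t3 : ‖Nn z * A * (x * w' * B ^ 2) * D‖ ≤
      n₀ * E * (2 * (W * E) * ((L * E) * (L * X))) * (L * Y) := by
    rw [norm_mul, norm_mul _ (x * w' * B ^ 2), norm_mul, norm_mul _ (B ^ 2), norm_mul x, norm_pow,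
      hAn, sq]
    gcongr
  have t4 : ‖Nn z * A * B * (y * w' * D ^ 2)‖ ≤
      n₀ * E * (L * X) * (2 * (W * E) * ((L * E) * (L * Y))) := by
    rw [norm_mul, norm_mul _ B, norm_mul, norm_mul _ (D ^ 2), norm_mul y, norm_pow, hAn, sq]
    gcongr
  have e1 : ((N' * A + Nn z * (w' * A ^ 2)) * B + Nn z * A * (x * w' * B ^ 2)) * D +
      Nn z * A * B * (y * w' * D ^ 2) = N' * A * B * D + Nn z * (w' * A ^ 2) * B * D +
      Nn z * A * (x * w' * B ^ 2) * D + Nn z * A * B * (y * w' * D ^ 2) := by ring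
  refine (congrArg norm e1).trans_le ?_
  refine (norm_add_le _ _).trans ((add_le_add ((norm_add_le _ _).trans
    (add_le_add ((norm_add_le _ _).trans (add_le_add t1 t2)) t3)) t4).trans (le_of_eq ?_))
  ring

end GaltonWatson

/-! ### Circle means of `|1 - z^d| ^ (-3/2)`. -/

namespace GaltonWatson

/-- A radial point close to the circle is at least as far from one as its angle dictates. -/
lemma one_sub_add_abs_le_norm {ρ φ : ℝ} (h0 : 0 ≤ ρ) (h1 : ρ ≤ 1) (hφ : |φ| ≤ Real.pi) :
    (1 - ρ + |φ|) / 8 ≤ ‖1 - (ρ : ℂ) * Complex.exp (φ * Complex.I)‖ := by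
  set t := ‖1 - (ρ : ℂ) * Complex.exp (φ * Complex.I)‖ with ht
  have hA : 1 - ρ ≤ t := by
    have := norm_sub_norm_le (1 : ℂ) ((ρ : ℂ) * Complex.exp (φ * Complex.I))
    rw [norm_mul, Complex.norm_exp_ofReal_mul_I, norm_one, Complex.norm_real, Real.norm_eq_abs,
      abs_of_nonneg h0, mul_one] at this
    exact this
  have hB : 2 / Real.pi * |φ| ≤ ‖Complex.exp (φ * Complex.I) - 1‖ := by
    have h2 := Real.mul_abs_le_abs_sin (x := φ / 2) (by
      rw [abs_div, abs_two]; linarith)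
    have h3 : ‖Complex.exp (φ * Complex.I) - 1‖ = 2 * |Real.sin (φ / 2)| := by
      rw [mul_comm, Complex.norm_exp_I_mul_ofReal_sub_one, norm_mul, Real.norm_eq_abs, Real.norm_eq_abs, abs_two]
    rw [h3]
    rw [abs_div, abs_two] at h2
    linarith
  have hC : ‖Complex.exp (φ * Complex.I) - 1‖ ≤ t + (1 - ρ) := by
    have e : Complex.exp (φ * Complex.I) - 1 =
        -(1 - (ρ : ℂ) * Complex.exp (φ * Complex.I)) +
          ((1 - ρ : ℝ) : ℂ) * Complex.exp (φ * Complex.I) := by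
      push_cast; ring
    rw [e]
    refine (norm_add_le _ _).trans ?_
    rw [norm_neg, norm_mul, Complex.norm_exp_ofReal_mul_I, Complex.norm_real, Real.norm_eq_abs,
      abs_of_nonneg (by linarith), mul_one]
  -- By `π ≤ 4`. Then `|φ| ≤ 4 t` and `1 - ρ ≤ t`, so even `5` would serve in place of `8`.
  have hD : |φ| / 2 ≤ 2 / Real.pi * |φ| := by
    rw [div_mul_eq_mul_div, div_le_div_iff₀ two_pos Real.pi_pos]
    nlinarith [Real.pi_le_four, abs_nonneg φ]
  linarith

lemma hasDerivAt_inv_sqrt {s u : ℝ} (hs : 0 < s + u) :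
    HasDerivAt (fun u => -2 * (√(s + u))⁻¹) ((√(s + u))⁻¹ ^ 3) u := by
  have h1 : HasDerivAt (fun u => s + u) 1 u := (hasDerivAt_id u).const_add s
  have h2 := ((h1.sqrt hs.ne').inv (Real.sqrt_pos.2 hs).ne').const_mul (-2)
  convert! h2 using 1
  have : √(s + u) ≠ 0 := (Real.sqrt_pos.2 hs).ne'
  field_simp

lemma integral_inv_sqrt_pow_three_le {s b : ℝ} (hs : 0 < s) (hb : 0 ≤ b) :
    ∫ u in (0 : ℝ)..b, (√(s + u))⁻¹ ^ 3 ≤ 2 * (√s)⁻¹ := by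
  have hpos : ∀ u ∈ Set.uIcc 0 b, 0 < s + u := fun u hu => by
    rw [Set.uIcc_of_le hb] at hu
    linarith [hu.1]
  rw [intervalIntegral.integral_eq_sub_of_hasDerivAt
    (fun u hu => hasDerivAt_inv_sqrt (hpos u hu))]
  · have : 0 ≤ (√(s + b))⁻¹ := by positivity
    rw [add_zero]
    linarith
  · refine ContinuousOn.intervalIntegrable ?_
    refine ContinuousOn.pow (ContinuousOn.inv₀ (by fun_prop) fun u hu => ?_) 3
    exact (Real.sqrt_pos.2 (hpos u hu)).ne'

/-- On `[-π, π]` the distance to `1` is comparable to `1 - ρ + |θ|`, whose power `-3/2` has an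
explicit antiderivative. -/
lemma integral_circle_inv_sqrt_le {ρ : ℝ} (h0 : 0 ≤ ρ) (h1 : ρ < 1) :
    ∫ θ in (0 : ℝ)..2 * Real.pi,
      (√‖1 - (ρ : ℂ) * Complex.exp (θ * Complex.I)‖)⁻¹ ^ 3 ≤ 4 * √8 ^ 3 * (√(1 - ρ))⁻¹ := by
  set f : ℝ → ℝ := fun θ => (√‖1 - (ρ : ℂ) * Complex.exp (θ * Complex.I)‖)⁻¹ ^ 3 with hf
  have hne : ∀ θ : ℝ, 0 < ‖1 - (ρ : ℂ) * Complex.exp (θ * Complex.I)‖ := fun θ => by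
    have := norm_sub_norm_le (1 : ℂ) ((ρ : ℂ) * Complex.exp (θ * Complex.I))
    rw [norm_mul, Complex.norm_exp_ofReal_mul_I, norm_one, Complex.norm_real, Real.norm_eq_abs,
      abs_of_nonneg h0, mul_one] at this
    linarith
  have hcont : Continuous f :=
    ((by fun_prop : Continuous fun θ : ℝ =>
      √‖1 - (ρ : ℂ) * Complex.exp (θ * Complex.I)‖).inv₀
        fun θ => (Real.sqrt_pos.2 (hne θ)).ne').pow 3
  have hper : Function.Periodic f (2 * Real.pi) := fun θ => by
    simp only [hf]
    congr 5
    push_cast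
    rw [add_mul, Complex.exp_add, Complex.exp_two_pi_mul_I, mul_one]
  have hle : ∀ θ : ℝ, |θ| ≤ Real.pi → f θ ≤ √8 ^ 3 * (√(1 - ρ + |θ|))⁻¹ ^ 3 := fun θ hθ => by
    have h3 := Real.sqrt_le_sqrt (one_sub_add_abs_le_norm h0 h1.le hθ)
    rw [Real.sqrt_div' _ (by norm_num)] at h3
    have hp : 0 < 1 - ρ + |θ| := by linarith [abs_nonneg θ]
    have h4 := inv_anti₀ (by positivity) h3
    rw [inv_div, div_eq_mul_inv] at h4
    calc f θ ≤ (√8 * (√(1 - ρ + |θ|))⁻¹) ^ 3 := pow_le_pow_left₀ (by positivity) h4 3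
      _ = _ := mul_pow _ _ _
  set g : ℝ → ℝ := fun θ => √8 ^ 3 * (√(1 - ρ + |θ|))⁻¹ ^ 3 with hg
  have hgc : Continuous g := by
    refine continuous_const.mul (Continuous.pow (Continuous.inv₀ (by fun_prop) fun θ => ?_) 3)
    exact (Real.sqrt_pos.2 (by linarith [abs_nonneg θ])).ne'
  have hshift : ∫ θ in (0 : ℝ)..2 * Real.pi, f θ = ∫ θ in (-Real.pi)..Real.pi, f θ := by
    have := hper.intervalIntegral_add_eq 0 (-Real.pi)
    rw [zero_add] at this
    rw [this]
    congr 1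
    ring
  have hπ := Real.pi_pos
  have hright : ∫ θ in (0 : ℝ)..Real.pi, g θ ≤ √8 ^ 3 * (2 * (√(1 - ρ))⁻¹) := by
    have e : ∫ θ in (0 : ℝ)..Real.pi, g θ =
        ∫ θ in (0 : ℝ)..Real.pi, √8 ^ 3 * (√(1 - ρ + θ))⁻¹ ^ 3 := by
      refine intervalIntegral.integral_congr fun θ hθ => ?_
      rw [Set.uIcc_of_le hπ.le] at hθ
      simp only [hg, abs_of_nonneg hθ.1]
    rw [e, intervalIntegral.integral_const_mul]
    exact mul_le_mul_of_nonneg_left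
      (integral_inv_sqrt_pow_three_le (by linarith) hπ.le) (by positivity)
  have hleft : ∫ θ in (-Real.pi)..0, g θ = ∫ θ in (0 : ℝ)..Real.pi, g θ := by
    have := intervalIntegral.integral_comp_neg (a := 0) (b := Real.pi) g
    rw [neg_zero] at this
    rw [← this]
    refine intervalIntegral.integral_congr fun θ _ => ?_
    simp only [hg, abs_neg]
  calc ∫ θ in (0 : ℝ)..2 * Real.pi, f θ = ∫ θ in (-Real.pi)..Real.pi, f θ := hshift
    _ ≤ ∫ θ in (-Real.pi)..Real.pi, g θ := by
        refine intervalIntegral.integral_mono_on (by linarith) (hcont.intervalIntegrable _ _)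
          (hgc.intervalIntegrable _ _) fun θ hθ => hle θ (abs_le.2 hθ)
    _ = (∫ θ in (-Real.pi)..0, g θ) + ∫ θ in (0 : ℝ)..Real.pi, g θ :=
        (intervalIntegral.integral_add_adjacent_intervals (hgc.intervalIntegrable _ _)
          (hgc.intervalIntegrable _ _)).symm
    _ ≤ 4 * √8 ^ 3 * (√(1 - ρ))⁻¹ := by rw [hleft]; linarith

/-- The circle means of `‖1 - z ^ d‖ ^ (-3 / 2)`. -/
lemma integral_circleMap_inv_sqrt_le {d : ℕ} (hd : 0 < d) {r : ℝ} (h0 : 0 ≤ r) (h1 : r < 1) :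
    ∫ θ in (0 : ℝ)..2 * Real.pi, (√‖1 - circleMap 0 r θ ^ d‖)⁻¹ ^ 3 ≤
      4 * √8 ^ 3 * (√(1 - r))⁻¹ := by
  set f : ℝ → ℝ := fun θ => (√‖1 - ((r ^ d : ℝ) : ℂ) * Complex.exp (θ * Complex.I)‖)⁻¹ ^ 3
    with hf
  have hd' : (d : ℝ) ≠ 0 := by positivity
  have hper : Function.Periodic f (2 * Real.pi) := fun θ => by
    simp only [hf]
    congr 5
    push_cast
    rw [add_mul, Complex.exp_add, Complex.exp_two_pi_mul_I, mul_one]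
  have e1 : ∀ θ : ℝ, (√‖1 - circleMap 0 r θ ^ d‖)⁻¹ ^ 3 = f (d * θ) := fun θ => by
    simp only [hf, circleMap, zero_add, mul_pow, ← Complex.exp_nat_mul]
    push_cast
    rw [mul_assoc]
  have hrd : r ^ d ≤ r := pow_le_of_le_one h0 h1.le hd.ne'
  -- The map `z ↦ z ^ d` runs `d` times around the circle of radius `r ^ d`, so the mean does not
  -- change; `r ^ d ≤ r` keeps that circle at least as far from the boundary.
  have hint : ∫ θ in (0 : ℝ)..2 * Real.pi, f (d * θ) = ∫ θ in (0 : ℝ)..2 * Real.pi, f θ := by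
    rw [intervalIntegral.integral_comp_mul_left f hd', mul_zero]
    have := hper.intervalIntegral_add_zsmul_eq (d : ℤ) 0 fun t₁ t₂ => by
      refine Continuous.intervalIntegrable ?_ _ _
      refine (Continuous.inv₀ (by fun_prop) fun θ => ?_).pow 3
      refine (Real.sqrt_pos.2 ?_).ne'
      have := norm_sub_norm_le (1 : ℂ) (((r ^ d : ℝ) : ℂ) * Complex.exp (θ * Complex.I))
      rw [norm_mul, Complex.norm_exp_ofReal_mul_I, norm_one, Complex.norm_real, Real.norm_eq_abs,
        abs_of_nonneg (by positivity), mul_one] at this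
      linarith
    simp only [zero_add, zsmul_eq_mul, Int.cast_natCast] at this
    rw [this, smul_eq_mul, inv_mul_cancel_left₀ hd']
  simp only [e1]
  rw [hint]
  refine (integral_circle_inv_sqrt_le (by positivity) (hrd.trans_lt h1)).trans ?_
  refine mul_le_mul_of_nonneg_left ?_ (by positivity)
  exact inv_anti₀ (Real.sqrt_pos.2 (by linarith)) (Real.sqrt_le_sqrt (by linarith))

end GaltonWatson

/-! ### From the derivative bound to coefficients, and the closed form of the pair generating
function. -/

namespace GaltonWatson

lemma coeff_eq_iteratedDeriv {f : ℂ → ℂ} {c : ℕ → ℂ} {ρ : ℝ} (hρ : 0 < ρ)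
    (hf : DifferentiableOn ℂ f (Metric.ball 0 ρ))
    (hc : ∀ z, ‖z‖ < ρ → HasSum (fun n => c n * z ^ n) (f z)) (n : ℕ) :
    c n = (n.factorial : ℂ)⁻¹ * iteratedDeriv n f 0 := by
  refine congrFun (coeff_unique_of_hasSum (d := fun n => (n.factorial : ℂ)⁻¹ * iteratedDeriv n f 0)
    hρ hc fun z hz => ?_) n
  convert! Complex.hasSum_taylorSeries_on_ball (z := z) hf (by simpa using hz) using 2 with n
  simp only [smul_eq_mul, sub_zero]
  ring

/-- Cauchy's estimate for the coefficients of a power series through its derivative. -/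
lemma succ_mul_norm_coeff_le {f : ℂ → ℂ} {c : ℕ → ℂ} {ρ r : ℝ} (hρ : 0 < ρ) (hρ1 : ρ ≤ 1)
    (hf : DifferentiableOn ℂ f (Metric.ball 0 1))
    (hc : ∀ z, ‖z‖ < ρ → HasSum (fun n => c n * z ^ n) (f z)) (hr : 0 < r) (hr1 : r < 1) (n : ℕ) :
    (n + 1) * ‖c (n + 1)‖ ≤
      ((2 * Real.pi)⁻¹ * ∫ θ in (0 : ℝ)..2 * Real.pi, ‖deriv f (circleMap 0 r θ)‖) * r⁻¹ ^ n := by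
  have hf' : DifferentiableOn ℂ (deriv f) (Metric.ball 0 1) := hf.deriv Metric.isOpen_ball
  have hcoeff := coeff_eq_iteratedDeriv hρ (hf.mono (Metric.ball_subset_ball hρ1)) hc (n + 1)
  have hcoeff' := coeff_eq_iteratedDeriv (f := deriv f)
    (c := (cauchyPowerSeries (deriv f) 0 r).coeff) hr (hf'.mono (Metric.ball_subset_ball hr1.le))
    (fun z hz => by
      lift r to NNReal using hr.le
      have h1 := (hf'.mono (Metric.closedBall_subset_ball hr1)).hasFPowerSeriesOnBall (R := r)
        (by exact_mod_cast hr)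
      have h2 := h1.hasSum (y := z) (by
        rw [Metric.eball_coe]
        simpa using hz)
      simpa [mul_comm] using h2) n
  have key : ((n : ℂ) + 1) * c (n + 1) = (cauchyPowerSeries (deriv f) 0 r).coeff n := by
    rw [hcoeff, hcoeff', iteratedDeriv_succ', Nat.factorial_succ]
    have h1 : (n.factorial : ℂ) ≠ 0 := by exact_mod_cast n.factorial_ne_zero
    have h2 : (n : ℂ) + 1 ≠ 0 := by exact_mod_cast n.succ_ne_zero
    push_cast
    field_simp
  have h3 := norm_cauchyPowerSeries_le (deriv f) 0 r n
  rw [FormalMultilinearSeries.norm_apply_eq_norm_coef, ← key, norm_mul, abs_of_pos hr] at h3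
  rwa [show ‖(n : ℂ) + 1‖ = n + 1 by exact_mod_cast Complex.norm_natCast (n + 1)] at h3

/-- Cauchy's estimate is taken at radius `r = n / (n + 1)`. There the circle mean of the derivative
is `O(√n)` and `r⁻¹ ^ (n - 1) ≤ e ≤ 3`. The constant is `24 = 4 * 2 * 3`: circle mean, `(1 -
r)^(-1/2) ≤ 2 √n`, and the power of `r⁻¹`. -/
lemma norm_coeff_mul_le_sqrt {f : ℂ → ℂ} {c : ℕ → ℂ} {ρ K : ℝ} {d : ℕ} (hd : 0 < d) (hK : 0 ≤ K)
    (hder : ∀ z, ‖z‖ < 1 → ∃ f', HasDerivAt f f' z ∧ ‖f'‖ ≤ K * (√‖1 - z ^ d‖)⁻¹ ^ 3)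
    (hρ : 0 < ρ) (hρ1 : ρ ≤ 1) (hc : ∀ z, ‖z‖ < ρ → HasSum (fun n => c n * z ^ n) (f z)) {n : ℕ}
    (hn : 1 ≤ n) : ‖c n‖ * n ≤ 24 * √8 ^ 3 * K * √n := by
  obtain ⟨n, rfl⟩ : ∃ m, n = m + 1 := ⟨n - 1, by omega⟩
  have hf : DifferentiableOn ℂ f (Metric.ball 0 1) := fun z hz => by
    obtain ⟨f', h1, -⟩ := hder z (by simpa using hz)
    exact h1.differentiableAt.differentiableWithinAt
  have hle : ∀ z, ‖z‖ < 1 → ‖deriv f z‖ ≤ K * (√‖1 - z ^ d‖)⁻¹ ^ 3 := fun z hz => by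
    obtain ⟨f', h1, h2⟩ := hder z hz
    rwa [h1.deriv]
  set t : ℝ := n + 1 with ht
  have ht1 : 1 ≤ t := by rw [ht]; linarith [(Nat.cast_nonneg n : (0 : ℝ) ≤ n)]
  set r : ℝ := t / (t + 1) with hr
  have hr0 : 0 < r := by positivity
  have hr1 : r < 1 := by rw [hr, div_lt_one (by positivity)]; linarith
  have hmem : ∀ θ, ‖circleMap 0 r θ‖ = r := fun θ => by simp [abs_of_pos hr0]
  have hint : ∫ θ in (0 : ℝ)..2 * Real.pi, ‖deriv f (circleMap 0 r θ)‖ ≤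
      K * (4 * √8 ^ 3 * (√(1 - r))⁻¹) := by
    refine le_trans (intervalIntegral.integral_mono_on
      (g := fun θ => K * (√‖1 - circleMap 0 r θ ^ d‖)⁻¹ ^ 3) (by positivity) ?_ ?_
      fun θ _ => hle _ ((hmem θ).trans_lt hr1)) ?_
    · refine Continuous.intervalIntegrable (continuous_norm.comp ?_) _ _
      refine (hf.deriv Metric.isOpen_ball).continuousOn.comp_continuous (continuous_circleMap _ _)
        fun θ => ?_
      simpa [abs_of_pos hr0] using hr1
    · refine Continuous.intervalIntegrable (continuous_const.mul
        (((Continuous.inv₀ (by fun_prop) fun θ => ?_).pow 3))) _ _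
      refine (Real.sqrt_pos.2 (norm_pos_iff.2 (sub_ne_zero.2 fun h1 => ?_))).ne'
      have h2 := congrArg norm h1
      rw [norm_one, norm_pow, hmem] at h2
      exact (pow_lt_one₀ hr0.le hr1 hd.ne').ne' h2
    · rw [intervalIntegral.integral_const_mul]
      exact mul_le_mul_of_nonneg_left (integral_circleMap_inv_sqrt_le hd hr0.le hr1) hK
  have hsqrt : (√(1 - r))⁻¹ ≤ 2 * √t := by
    have e : 1 - r = (t + 1)⁻¹ := by rw [hr]; field_simp; ring
    rw [e, Real.sqrt_inv, inv_inv, Real.sqrt_le_left (by positivity), mul_pow,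
      Real.sq_sqrt (by positivity)]
    linarith
  have hpow : r⁻¹ ^ n ≤ 3 := by
    have e : r⁻¹ = t⁻¹ + 1 := by rw [hr]; field_simp; ring
    calc r⁻¹ ^ n ≤ Real.exp t⁻¹ ^ n := by
          rw [e]; exact pow_le_pow_left₀ (by positivity) (Real.add_one_le_exp _) n
      _ = Real.exp (n * t⁻¹) := (Real.exp_nat_mul _ _).symm
      _ ≤ Real.exp 1 := by
          rw [Real.exp_le_exp, ← div_eq_mul_inv, div_le_one (by positivity), ht]
          linarith
      _ ≤ 3 := by linarith [Real.exp_one_lt_d9]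
  have hπ : (2 * Real.pi)⁻¹ ≤ 1 := inv_le_one_of_one_le₀ (by linarith [Real.pi_gt_three])
  have hmain := succ_mul_norm_coeff_le hρ hρ1 hf hc hr0 hr1 n
  push_cast
  rw [mul_comm, ← ht]
  calc t * ‖c (n + 1)‖ ≤ _ := hmain
    _ ≤ (1 * (K * (4 * √8 ^ 3 * (2 * √t)))) * 3 := by
        gcongr
        · exact intervalIntegral.integral_nonneg (by positivity) fun _ _ => norm_nonneg _
        · exact hint.trans (by gcongr)
    _ = _ := by ring

/-- The system is triangular: the height sums are `F / (1 - xw)` and `F / (1 - yw)`, and the pair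
sum follows on division by `1 - w`. In the numerator `(1 - xw)(1 - yw) + xw(1 - yw) + yw(1 - xw)`
collapses to `1 - xy w²`. -/
lemma treeExp_pairPoly_eq_pairKernel (ν : Measure ℕ) [IsProbabilityMeasure ν] {x y z : ℂ}
    (hp : CriticalOffspring fun k => ν.real {k}) (hz : ‖z‖ ≤ 1 / 16) (hx : ‖x‖ ≤ 2) (hy : ‖y‖ ≤ 2)
    (hw : 1 - z * pgfDeriv (fun k => ν.real {k}) 1 (treeExp ν (sizeWeight z)) ≠ 0)
    (hwx : 1 - x * (z * pgfDeriv (fun k => ν.real {k}) 1 (treeExp ν (sizeWeight z))) ≠ 0)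
    (hwy : 1 - y * (z * pgfDeriv (fun k => ν.real {k}) 1 (treeExp ν (sizeWeight z))) ≠ 0) :
    treeExp ν (fun t => sizeWeight z t * pairPoly x y t) =
      pairKernel (fun k => ν.real {k}) (fun z => treeExp ν (sizeWeight z)) x y z := by
  have hX := treeExp_heightSum hz hx hp.summable_descFactorial_one
  have hY := treeExp_heightSum hz hy hp.summable_descFactorial_one
  have hG := treeExp_pairPoly hz hx hy hp.summable_descFactorial_one
    hp.summable_descFactorial_two
  rw [pairKernel]
  generalize treeExp ν (fun t => sizeWeight z t * heightSum x t) = A at *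
  generalize treeExp ν (fun t => sizeWeight z t * heightSum y t) = B at *
  generalize treeExp ν (fun t => sizeWeight z t * pairPoly x y t) = G at *
  generalize treeExp ν (sizeWeight z) = F at *
  generalize pgfDeriv (fun k => ν.real {k}) 1 F = φ at *
  generalize pgfDeriv (fun k => ν.real {k}) 2 F = ψ at *
  have hA : A = F * (1 - x * (z * φ))⁻¹ := by
    rw [eq_mul_inv_iff_mul_eq₀ hwx]; linear_combination hX
  have hB : B = F * (1 - y * (z * φ))⁻¹ := by
    rw [eq_mul_inv_iff_mul_eq₀ hwy]; linear_combination hY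
  have hG' : G = (F + z * φ * (x * A + y * B) + x * y * (z * ψ) * A * B) * (1 - z * φ)⁻¹ := by
    rw [eq_mul_inv_iff_mul_eq₀ hw]; linear_combination hG
  rw [hG', hA, hB]
  generalize z * φ = w at *
  obtain ⟨P, hP⟩ : ∃ P, P = 1 - x * w := ⟨_, rfl⟩
  obtain ⟨R, hR⟩ : ∃ R, R = 1 - y * w := ⟨_, rfl⟩
  rw [← hP] at hwx ⊢
  rw [← hR] at hwy ⊢
  field_simp
  rw [hP, hR]
  ring

end GaltonWatson

/-! ### The theorem. -/

theorem theorem1p4 (ν : Measure ℕ) [IsProbabilityMeasure ν]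
    (hmean : ∫ k, (k : ℝ) ∂ν = 1)
    (hL2 : MemLp (fun k : ℕ => (k : ℝ)) 2 ν)
    (hvar : 0 < variance (fun k : ℕ => (k : ℝ)) ν) :
    ∃ C β δ : ℝ, 0 < C ∧ 0 < β ∧ β < Real.pi / 2 ∧ 0 < δ ∧
      ∀ n : ℕ, 1 ≤ n → 0 < GaltonWatson.law ν (GaltonWatson.sizeEvent n) →
        AnalyticOnNhd ℂ (fun p : ℂ × ℂ => GaltonWatson.pairGF ν n p.1 p.2)
          (GaltonWatson.deltaDomain β δ ×ˢ GaltonWatson.deltaDomain β δ) ∧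
        ∀ x ∈ GaltonWatson.deltaDomain β δ, ∀ y ∈ GaltonWatson.deltaDomain β δ,
          ‖GaltonWatson.pairGF ν n x y‖ ≤ C * n * ‖1 - x‖⁻¹ * ‖1 - y‖⁻¹ := by
  have hp := GaltonWatson.criticalOffspring_of_measure hmean hL2 hvar
  have h := GaltonWatson.progenyLaw_sizeProb ν
  obtain ⟨v, hv, hlim⟩ := GaltonWatson.exists_tendsto_charSeries_pow hmean hL2 hvar
  obtain ⟨d, N, c, C, hd0, hdk, hd, hc, -, hup, hsize, hlow⟩ := h.exists_bounds hp hv hlim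
  obtain ⟨κ, hκ0, hκ⟩ := h.exists_disc_bounds hp hd0 hdk hd hc hup hlow
  set ε := min κ 1 with hε
  have hε0 : 0 < ε := lt_min hκ0 one_pos
  have hε1 : ε ≤ 1 := min_le_right _ _
  have hεκ : ε ≤ κ := min_le_left _ _
  -- The loss `7` is that of `norm_one_sub_mul_bounds`. That lemma needs `|x| - 1 ≤ (ε/4) |1 - x|`,
  -- whence `β = ε / 8` and `δ = (ε / 4)²` below; the power `ε⁻¹ ^ 3` in `C` comes from replacing
  -- `|1 - w|⁻³` by `|1 - z^d|^(-3/2)`.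
  obtain ⟨T, hT0, hT⟩ := h.exists_norm_deriv_pairKernel_le hp (κ := ε / 7) (by positivity)
  refine ⟨c⁻¹ * (24 * √8 ^ 3 * (T * ε⁻¹ ^ 3)), ε / 4 / 2, (ε / 4) ^ 2, by positivity, by positivity,
    by linarith [Real.pi_gt_three], by positivity, fun n hn hpos =>
    ⟨GaltonWatson.analyticOnNhd_pairGF ν n _, fun x hx y hy => ?_⟩⟩
  obtain ⟨hx1, hx2, hx3⟩ :=
    GaltonWatson.norm_sub_one_le_of_mem_deltaDomain (by positivity) (by linarith) hx
  obtain ⟨hy1, hy2, hy3⟩ :=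
    GaltonWatson.norm_sub_one_le_of_mem_deltaDomain (by positivity) (by linarith) hy
  set X := ‖1 - x‖⁻¹ with hX
  set Y := ‖1 - y‖⁻¹ with hY
  have hXY : 0 ≤ X * Y := by positivity
  have hw : ∀ z : ℂ, ‖z‖ < 1 → 0 < √‖1 - z ^ d‖ ∧ ε * √‖1 - z ^ d‖ ≤
      ‖1 - z * GaltonWatson.pgfDeriv (fun k => ν.real {k}) 1
        (GaltonWatson.treeExp ν (GaltonWatson.sizeWeight z))‖ := fun z hz => by
    constructor
    · refine Real.sqrt_pos.2 (norm_pos_iff.2 (sub_ne_zero.2 fun h1 => ?_))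
      have h2 := congrArg norm h1
      rw [norm_one, norm_pow] at h2
      exact (pow_lt_one₀ (norm_nonneg _) hz hd0.ne').ne' h2
    · refine (mul_le_mul_of_nonneg_right hεκ (Real.sqrt_nonneg _)).trans ((hκ z hz).1.trans ?_)
      simpa only [norm_one] using norm_sub_norm_le (1 : ℂ) _
  have hbd : ∀ z : ℂ, ‖z‖ < 1 → ∀ x : ℂ, ‖x‖ ≤ 2 → ‖x‖ - 1 ≤ ε / 4 * ‖1 - x‖ →
      ε / 7 * ‖1 - x‖ ≤ ‖1 - x * (z * GaltonWatson.pgfDeriv (fun k => ν.real {k}) 1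
        (GaltonWatson.treeExp ν (GaltonWatson.sizeWeight z)))‖ ∧
      ε / 7 * ‖1 - z * GaltonWatson.pgfDeriv (fun k => ν.real {k}) 1
        (GaltonWatson.treeExp ν (GaltonWatson.sizeWeight z))‖ ≤
        ‖1 - x * (z * GaltonWatson.pgfDeriv (fun k => ν.real {k}) 1
        (GaltonWatson.treeExp ν (GaltonWatson.sizeWeight z)))‖ := fun z hz x hx2 hx3 => by
    have h1 := (hκ z hz).2.1
    refine GaltonWatson.norm_one_sub_mul_bounds hε0 hε1 ?_
      ((mul_le_mul_of_nonneg_right hεκ (norm_nonneg _)).trans h1) hx2 hx3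
    have : 0 ≤ κ * ‖1 - z * GaltonWatson.pgfDeriv (fun k => ν.real {k}) 1
        (GaltonWatson.treeExp ν (GaltonWatson.sizeWeight z))‖ := by positivity
    linarith
  -- The derivative bound holds on the whole unit disc, whereas the kernel is identified with the
  -- probabilistic series only for `‖z‖ < 1 / 16`.
  have hpm : ‖GaltonWatson.pairMoment ν n x y‖ * n ≤
      24 * √8 ^ 3 * (T * ε⁻¹ ^ 3 * (X * Y)) * √n := by
    refine GaltonWatson.norm_coeff_mul_le_sqrt (ρ := 1 / 16)
      (f := GaltonWatson.pairKernel (fun k => ν.real {k})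
        (fun z => GaltonWatson.treeExp ν (GaltonWatson.sizeWeight z)) x y)
      (c := fun n => GaltonWatson.pairMoment ν n x y) hd0 (by positivity) (fun z hz => ?_)
      (by norm_num) (by norm_num) (fun z hz => ?_) hn
    · obtain ⟨hs, hs'⟩ := hw z hz
      have hw0 := (mul_pos hε0 hs).trans_le hs'
      obtain ⟨G', hG, hG'⟩ := hT x y z hx2 hy2 hx1 hy1 hz hw0
        ((mul_le_mul_of_nonneg_right (by linarith) (norm_nonneg _)).trans (hκ z hz).2.2)
        (hbd z hz x hx2 hx3).1 (hbd z hz x hx2 hx3).2 (hbd z hz y hy2 hy3).1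
        (hbd z hz y hy2 hy3).2
      refine ⟨G', hG, hG'.trans ?_⟩
      have h1 := inv_anti₀ (mul_pos hε0 hs) hs'
      rw [mul_inv] at h1
      calc _ ≤ T * (X * Y) * (ε⁻¹ * (√‖1 - z ^ d‖)⁻¹) ^ 3 := by gcongr
        _ = _ := by ring
    · have hz1 : ‖z‖ < 1 := hz.trans (by norm_num)
      obtain ⟨hs, hs'⟩ := hw z hz1
      have hw0 := (mul_pos hε0 hs).trans_le hs'
      rw [← GaltonWatson.treeExp_pairPoly_eq_pairKernel ν hp hz.le hx2 hy2 (norm_pos_iff.1 hw0)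
        (norm_pos_iff.1 ((by positivity : (0 : ℝ) < _).trans_le (hbd z hz1 x hx2 hx3).2))
        (norm_pos_iff.1 ((by positivity : (0 : ℝ) < _).trans_le (hbd z hz1 y hy2 hy3).2))]
      exact GaltonWatson.hasSum_pairMoment ν hz.le hx2 hy2
  have ha0 : GaltonWatson.sizeProb ν n ≠ 0 := (ENNReal.toReal_pos hpos.ne' (measure_ne_top _ _)).ne'
  have ha := hsize n ha0
  have hapos : 0 < GaltonWatson.sizeProb ν n := (h.nonneg n).lt_of_ne' ha0
  have hn0 : (0 : ℝ) < n := by exact_mod_cast hn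
  rw [GaltonWatson.pairGF_eq, norm_mul, Complex.norm_real, Real.norm_eq_abs,
    abs_of_pos (inv_pos.2 hapos)]
  have hsq : √(n : ℝ) * √n = n := Real.mul_self_sqrt hn0.le
  have hs0 : 0 < √(n : ℝ) := Real.sqrt_pos.2 hn0
  rw [inv_mul_le_iff₀ hapos]
  refine le_of_mul_le_mul_right (hpm.trans ?_) hn0
  -- The local lower bound `sizeProb ≥ c n^(-3/2)`, written as a factor at least `1`; it converts
  -- `√n` into `n` times the size probability.
  have hone : 1 ≤ c⁻¹ * (GaltonWatson.sizeProb ν n * (n * √n)) := by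
    rw [← div_eq_inv_mul, le_div_iff₀ hc]
    linarith
  calc 24 * √8 ^ 3 * (T * ε⁻¹ ^ 3 * (X * Y)) * √n
      ≤ 24 * √8 ^ 3 * (T * ε⁻¹ ^ 3 * (X * Y)) * √n *
        (c⁻¹ * (GaltonWatson.sizeProb ν n * (n * √n))) :=
        le_mul_of_one_le_right (by positivity) hone
    _ = 24 * √8 ^ 3 * (T * ε⁻¹ ^ 3 * (X * Y)) * (√n * √n) *
        (c⁻¹ * (GaltonWatson.sizeProb ν n * n)) := by ring
    _ = _ := by rw [hsq]; ring
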